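/- Let $d\ge 1$ and let $M$ be a smooth ($C^\infty$), Hausdorff, second countable manifold of dimension $d+1$, with a time-oriented Lorentzian metric $g$ of regularity $C^0$ (signature $(-,+,\dots,+)$). Let $N\subseteq M$ be open with compact closure in $M$ and such that $(N,g|_N)$ is globally hyperbolic. Write $B_r(0)\subseteq\mathbb R^d$ for the open Euclidean ball of radius $r$ about the origin, and assume that there is a smooth embedding $\psi:B_2(0)\hookrightarrow M$ such that $\psi(B_1(0))\subseteq N$ and $\psi(B_1(0))$ is a Cauchy hypersurface of $(N,g|_N)$. Then the spacelike diameter of $N$ is finite: $$\mathrm{diam}_s(N):=\sup_{\Sigma}\ \sup_{p,q\in\Sigma}\ \inf_{\gamma}\ \int_0^1\sqrt{g(\dot\gamma(s),\dot\gamma(s))}\,ds\;<\;\infty .$$ Here $\Sigma$ ranges over all Cauchy hypersurfaces of $(N,g|_N)$, and $\gamma$ over all piecewise smooth curves $\gamma:[0,1]\to\Sigma$ with $\gamma(0)=p$ and $\gamma(1)=q$ (with $\inf\emptyset=\infty$). The notions used are the following. A *timelike curve* is a piecewise smooth curve $\gamma:I\to N$ on an interval $I\subseteq\mathbb R$ with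 more than one point (with finitely many break points on each compact subinterval of $I$, and smooth up to the end points of each piece) whose one-sided derivatives all satisfy $g(\dot\gamma,\dot\gamma)<0$ and whose left- and right-sided derivatives at each interior point of $I$ lie in the same connected component of the double cone of timelike vectors. It is *inextendible* in $N$ if it has a limit in $N$ neither at the left end nor at the right end of $I$ (so it cannot be extended continuously within $N$ to either end). A *Cauchy hypersurface* of $(N,g|_N)$ is a smooth embedded hypersurface of $N$ that is met exactly once (at exactly one parameter value) by every inextendible timelike curve of $(N,g|_N)$; $(N,g|_N)$ is *globally hyperbolic* if it has a Cauchy hypersurface. -/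

import Mathlib

open Set Filter MeasureTheory
open scoped Manifold ContDiff ENNReal Topology

-- Selects the identity chart as the manifold structure of a vector space, ahead of definitionally
-- equal instances that Mathlib offers for the underlying topological space.
attribute [local instance 2000] chartedSpaceSelf

noncomputable section

section Lorentz

variable {d : ℕ} {M : Type*} [TopologicalSpace M]
  [ChartedSpace (EuclideanSpace ℝ (Fin (d + 1))) M] [IsManifold (𝓡 (d + 1)) ∞ M]

/-- A Lorentzian metric of regularity `C^0` on a smooth manifold `M` of dimension `d + 1`: a
continuous section `x ↦ g_x` of the bundle of bilinear forms on the tangent spaces, each `g_x` being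
symmetric of signature `(-, +, …, +)`. -/
structure LorentzianMetric (d : ℕ) (M : Type*) [TopologicalSpace M]
    [ChartedSpace (EuclideanSpace ℝ (Fin (d + 1))) M] [IsManifold (𝓡 (d + 1)) ∞ M] where
  /-- The bilinear form on the tangent space at each point. -/
  form : ∀ x : M, TangentSpace (𝓡 (d + 1)) x →L[ℝ] TangentSpace (𝓡 (d + 1)) x →L[ℝ] ℝ
  symm : ∀ (x : M) (v w : TangentSpace (𝓡 (d + 1)) x), form x v w = form x w v
  signature : ∀ x : M, ∃ b : Module.Basis (Fin (d + 1)) ℝ (TangentSpace (𝓡 (d + 1)) x),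
    ∀ i j, form x (b i) (b j) = if i = j then (if i = 0 then -1 else 1) else 0
  continuous : Continuous fun x : M ↦
    Bundle.TotalSpace.mk' (EuclideanSpace ℝ (Fin (d + 1)) →L[ℝ]
      EuclideanSpace ℝ (Fin (d + 1)) →L[ℝ] ℝ)
      (E := fun x : M ↦
        TangentSpace (𝓡 (d + 1)) x →L[ℝ] TangentSpace (𝓡 (d + 1)) x →L[ℝ] ℝ) x (form x)

namespace LorentzianMetric

/-- A tangent vector `v` is timelike if `g(v, v) < 0`. -/
def IsTimelike (g : LorentzianMetric d M) {x : M} (v : TangentSpace (𝓡 (d + 1)) x) : Prop :=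
  g.form x v v < 0

/-- Two timelike vectors at the same point lie in the same connected component of the timelike
double cone (the same timecone) iff `g(v, w) < 0`. -/
def SameTimecone (g : LorentzianMetric d M) {x : M} (v w : TangentSpace (𝓡 (d + 1)) x) : Prop :=
  g.IsTimelike v ∧ g.IsTimelike w ∧ g.form x v w < 0

/-- A time orientation, given by a continuous (everywhere) timelike vector field. -/
structure TimeOrientation (g : LorentzianMetric d M) where
  /-- The vector field. -/
  field : ∀ x : M, TangentSpace (𝓡 (d + 1)) x
  continuous : Continuous fun x : M ↦ (⟨x, field x⟩ : TangentBundle (𝓡 (d + 1)) M)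
  timelike : ∀ x : M, g.IsTimelike (field x)

end LorentzianMetric

/-- The restriction of `γ : ℝ → M` to the interval `J` is a piecewise smooth curve: it is continuous,
and there is a set `P` of break points, finitely many on each compact subinterval of `J`, such that
`γ` is smooth (up to and including the end points) on every compact subinterval of `J` without break
points in its interior. -/
def IsPiecewiseSmoothCurveOn (d : ℕ) {M : Type*} [TopologicalSpace M]
    [ChartedSpace (EuclideanSpace ℝ (Fin (d + 1))) M] (γ : ℝ → M) (J : Set ℝ) : Prop :=
  ContinuousOn γ J ∧ ∃ P : Set ℝ, (∀ a ∈ J, ∀ b ∈ J, (P ∩ Icc a b).Finite) ∧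
    ∀ a b : ℝ, a < b → Icc a b ⊆ J → Disjoint (Ioo a b) P →
      ContMDiffOn 𝓘(ℝ, ℝ) (𝓡 (d + 1)) ∞ γ (Icc a b)

/-- The right-sided derivative of the curve `γ` at `s`. -/
def rightVelocity (d : ℕ) {M : Type*} [TopologicalSpace M]
    [ChartedSpace (EuclideanSpace ℝ (Fin (d + 1))) M] (γ : ℝ → M) (s : ℝ) :
    TangentSpace (𝓡 (d + 1)) (γ s) :=
  mfderivWithin 𝓘(ℝ, ℝ) (𝓡 (d + 1)) γ (Ici s) s (1 : ℝ)

/-- The left-sided derivative of the curve `γ` at `s`. -/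
def leftVelocity (d : ℕ) {M : Type*} [TopologicalSpace M]
    [ChartedSpace (EuclideanSpace ℝ (Fin (d + 1))) M] (γ : ℝ → M) (s : ℝ) :
    TangentSpace (𝓡 (d + 1)) (γ s) :=
  mfderivWithin 𝓘(ℝ, ℝ) (𝓡 (d + 1)) γ (Iic s) s (1 : ℝ)

namespace LorentzianMetric

/-- `γ`, restricted to `J`, is a timelike curve of `(M, g)`: `J` is an interval with more than one
point, `γ` is piecewise smooth on `J`, its one-sided derivatives are timelike, and at each interior
point the left- and right-sided derivatives lie in the same timecone. -/
structure IsTimelikeCurveOn (g : LorentzianMetric d M) (γ : ℝ → M) (J : Set ℝ) : Prop where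
  ordConnected : J.OrdConnected
  nontrivial : J.Nontrivial
  piecewiseSmooth : IsPiecewiseSmoothCurveOn d γ J
  timelike_right : ∀ s ∈ J, (∃ t ∈ J, s < t) → g.IsTimelike (rightVelocity d γ s)
  timelike_left : ∀ s ∈ J, (∃ t ∈ J, t < s) → g.IsTimelike (leftVelocity d γ s)
  sameTimecone : ∀ s ∈ J, (∃ t ∈ J, s < t) → (∃ t ∈ J, t < s) →
    g.SameTimecone (leftVelocity d γ s) (rightVelocity d γ s)

/-- For an open subset `N` of `M`: `γ`, restricted to the interval `J`, is an inextendible timelike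
curve of the Lorentzian manifold `(N, g|_N)`, i.e. a timelike curve contained in `N` that has a
limit in `N` neither at the left end nor at the right end of `J`. (If an end point belongs to `J`, then `γ` has a limit there by
continuity, so `J` is an open interval.) -/
def IsInextendibleTimelikeCurveOn (g : LorentzianMetric d M) (N : Set M) (γ : ℝ → M)
    (J : Set ℝ) : Prop :=
  g.IsTimelikeCurveOn γ J ∧ MapsTo γ J N ∧
    (¬ ∃ q ∈ N, Tendsto (fun s : J ↦ γ s) atTop (𝓝 q)) ∧
    (¬ ∃ q ∈ N, Tendsto (fun s : J ↦ γ s) atBot (𝓝 q))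

end LorentzianMetric

/-- `S` is a smooth embedded hypersurface of the `(d + 1)`-dimensional manifold `M`: around each of
its points there is a smooth chart of `M` in which `S` is the coordinate slice `{x₀ = 0}`. -/
def IsSmoothEmbeddedHypersurface (d : ℕ) {M : Type*} [TopologicalSpace M]
    [ChartedSpace (EuclideanSpace ℝ (Fin (d + 1))) M] (S : Set M) : Prop :=
  ∀ p ∈ S, ∃ φ ∈ IsManifold.maximalAtlas (𝓡 (d + 1)) ∞ M,
    p ∈ φ.source ∧ ∀ q ∈ φ.source, q ∈ S ↔ φ q 0 = 0

namespace LorentzianMetric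

/-- For an open subset `N` of `M`: `S` is a Cauchy hypersurface of the Lorentzian manifold
`(N, g|_N)`, i.e. a smooth embedded hypersurface contained in `N` that every inextendible timelike
curve of `(N, g|_N)` meets exactly once (at exactly one parameter value). -/
structure IsCauchyHypersurface (g : LorentzianMetric d M) (N S : Set M) : Prop where
  subset : S ⊆ N
  hypersurface : IsSmoothEmbeddedHypersurface d S
  meets_once : ∀ (J : Set ℝ) (γ : ℝ → M), g.IsInextendibleTimelikeCurveOn N γ J →
    ∃! s, s ∈ J ∧ γ s ∈ S

/-- For an open subset `N` of `M`: `(N, g|_N)` is globally hyperbolic. -/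
def IsGloballyHyperbolic (g : LorentzianMetric d M) (N : Set M) : Prop :=
  ∃ S, g.IsCauchyHypersurface N S

/-- The length `∫₀¹ √g(γ', γ') ds ∈ [0, ∞]` of a piecewise smooth curve on `[0, 1]`. -/
def length (g : LorentzianMetric d M) (γ : ℝ → M) : ℝ≥0∞ :=
  ∫⁻ s in Icc (0 : ℝ) 1, ENNReal.ofReal
    (√(g.form (γ s) (mfderiv 𝓘(ℝ, ℝ) (𝓡 (d + 1)) γ s (1 : ℝ))
      (mfderiv 𝓘(ℝ, ℝ) (𝓡 (d + 1)) γ s (1 : ℝ))))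

/-- The infimum of the lengths of the piecewise smooth curves `[0, 1] → S` from `p` to `q`. -/
def distIn (g : LorentzianMetric d M) (S : Set M) (p q : M) : ℝ≥0∞ :=
  ⨅ (γ : ℝ → M) (_ : IsPiecewiseSmoothCurveOn d γ (Icc 0 1) ∧ MapsTo γ (Icc 0 1) S ∧
    γ 0 = p ∧ γ 1 = q), g.length γ

/-- The diameter of a Cauchy hypersurface `S`, an element of `[0, ∞]`. -/
def diam (g : LorentzianMetric d M) (S : Set M) : ℝ≥0∞ :=
  ⨆ (p ∈ S) (q ∈ S), g.distIn S p q

/-- For an open subset `N` of `M`: the spacelike diameter of `(N, g|_N)`, an element of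
`[0, ∞]`; the supremum of the diameters of all Cauchy hypersurfaces of `(N, g|_N)`. -/
def spacelikeDiam (g : LorentzianMetric d M) (N : Set M) : ℝ≥0∞ :=
  ⨆ (S : Set M) (_ : g.IsCauchyHypersurface N S), g.diam S

end LorentzianMetric

end Lorentz

/-- The open ball of radius `r` about the origin in `ℝ^d`, as an open subset. -/
def openBall (d : ℕ) (r : ℝ) : TopologicalSpace.Opens (EuclideanSpace ℝ (Fin d)) :=
  ⟨Metric.ball 0 r, Metric.isOpen_ball⟩

end

/-! The spacelike diameter is finite because all Cauchy hypersurfaces are graphs over one and the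
same ball, and a bound on the length of suitable curves in such a graph does not see the slope of
the graph.

Fix a smooth, compactly supported vector field that is timelike and future directed on the closure
of `N` (`exists_smoothFlow_field_mem_cone`); it has a global smooth flow. Each flow line in `N` hits
a given Cauchy hypersurface `S` exactly once and transversally, so `S` is the graph of a smooth
hitting time `f` over `ψ(B₁)` (`exists_hittingTime`). Two points of `S` are joined by the graph over
the segment between their parameters. Its velocity is a multiple of the field plus the image `w` of
the segment's direction under the derivative of the flow. Since the field is timelike, `g` of this
velocity is at most `g(w,w) - g(F,w)²/g(F,F)`, whatever the multiple is (`form_smul_add_le`). This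
expression is continuous in flow time, parameter and direction, so a bound independent of `S`
follows by compactness once the flow times are bounded.

The bound on the times (`exists_time_bound`) is the core. A flow line from `S₀ = ψ(B₁)` that stays
in `N` for long must come back near some point `z` of the compact closure of `N`. Because `ψ`
extends past the closed unit ball and the field is nowhere tangent to the closure of `S₀`, there is
near `z` a function `φ` that increases along the flow and vanishes on `S₀` (`exists_isBarrierAt`).
If the flow line is near `z` at two well separated times with the same sign of `φ`, a slightly
tilted flow line leads from the later passage back to the earlier one without touching `S₀`
(`sign_ne`). This closes up to a timelike loop in `N` that misses `S₀`, and running through the loop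
forever gives an inextendible curve that never meets a Cauchy hypersurface (`not_backward`,
`not_closed`). Hence each of finitely many neighbourhoods is visited a bounded number of times. -/

section SmoothDependence

/-! ### Smooth dependence of solutions of ODEs on initial values -/

open Metric NNReal

/-- Grönwall estimate for the linearisation of an autonomous ODE: the difference of two solutions
agrees with the solution of the variational equation up to a quadratic error. -/
theorem norm_sub_sub_le_of_variational_equation {E : Type*} [NormedAddCommGroup E]
    [NormedSpace ℝ E] {f : E → E} {A : E → E →L[ℝ] E} {B : Set E} {K : ℝ≥0} {R C T : ℝ}
    (hK : LipschitzOnWith K f B) (hR : 0 ≤ R)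
    (hA : ∀ y ∈ B, ∀ k, y + k ∈ B → ‖f (y + k) - f y - A y k‖ ≤ R * ‖k‖ ^ 2)
    {u v w : ℝ → E} {h : E}
    (hu : ∀ t ∈ Icc 0 T, HasDerivAt u (f (u t)) t) (hv : ∀ t ∈ Icc 0 T, HasDerivAt v (f (v t)) t)
    (hw : ∀ t ∈ Icc 0 T, HasDerivAt w (A (v t) (w t)) t)
    (huB : ∀ t ∈ Icc 0 T, u t ∈ B) (hvB : ∀ t ∈ Icc 0 T, v t ∈ B)
    (hvwB : ∀ t ∈ Icc 0 T, v t + w t ∈ B) (hwC : ∀ t ∈ Icc 0 T, ‖w t‖ ≤ C * ‖h‖)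
    (hu0 : u 0 = v 0 + h) (hw0 : w 0 = h) :
    ∀ t ∈ Icc 0 T, ‖u t - v t - w t‖ ≤ R * C ^ 2 * gronwallBound 0 K 1 T * ‖h‖ ^ 2 := by
  intro t ht
  -- `v + w` starts where `u` does and solves the same equation up to the Taylor remainder, which is
  -- at most `R * (C * ‖h‖) ^ 2`.
  have key := dist_le_of_approx_trajectories_ODE_of_mem (v := fun _ ↦ f) (s := fun _ ↦ B)
    (f := u) (g := fun t ↦ v t + w t) (f' := fun t ↦ f (u t))
    (g' := fun t ↦ f (v t) + A (v t) (w t)) (K := K) (a := 0) (b := T) (εf := 0)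
    (εg := R * (C * ‖h‖) ^ 2) (δ := 0)
    (fun t _ ↦ hK) (HasDerivAt.continuousOn hu)
    (fun t ht ↦ (hu t (Ico_subset_Icc_self ht)).hasDerivWithinAt) (by simp)
    (fun t ht ↦ huB t (Ico_subset_Icc_self ht))
    (HasDerivAt.continuousOn fun t ht ↦ (hv t ht).add (hw t ht))
    (fun t ht ↦ ((hv t (Ico_subset_Icc_self ht)).add
      (hw t (Ico_subset_Icc_self ht))).hasDerivWithinAt)
    (fun t ht ↦ by
      have ht' := Ico_subset_Icc_self ht
      have h1 := hA (v t) (hvB t ht') (w t) (hvwB t ht')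
      have h2 := hwC t ht'
      rw [dist_comm, dist_eq_norm, ← sub_sub]
      refine h1.trans ?_
      gcongr)
    (fun t ht ↦ hvwB t (Ico_subset_Icc_self ht)) (by simp [hu0, hw0]) t ht
  rw [dist_eq_norm, ← sub_sub] at key
  have hscale : ∀ x ε : ℝ, gronwallBound 0 K ε x = ε * gronwallBound 0 K 1 x := by
    intro x ε
    unfold gronwallBound
    split_ifs <;> ring
  have hmono : gronwallBound 0 K 1 (t - 0) ≤ gronwallBound 0 K 1 T :=
    gronwallBound_mono le_rfl zero_le_one K.2 (by linarith [ht.2])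
  rw [hscale] at key
  calc _ ≤ _ := key
    _ ≤ (0 + R * (C * ‖h‖) ^ 2) * gronwallBound 0 K 1 T := by gcongr
    _ = _ := by ring

/-- Mean value inequality on the segment from `y` to `y + k`: on a small ball the derivative is
Lipschitz, so along the segment it differs from its value at `y` by at most a constant times `‖k‖`.
-/
theorem exists_quadratic_remainder_bound {E : Type*} [NormedAddCommGroup E]
    [NormedSpace ℝ E] {f : E → E} {x₀ : E} (hf : ContDiffAt ℝ 2 f x₀) :
    ∃ r > 0, ∃ K : ℝ≥0, ∃ R : ℝ, 0 ≤ R ∧ LipschitzOnWith K f (ball x₀ r) ∧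
      ∀ y ∈ ball x₀ r, ∀ k, y + k ∈ ball x₀ r →
        ‖f (y + k) - f y - fderiv ℝ f y k‖ ≤ R * ‖k‖ ^ 2 := by
  obtain ⟨K, s, hs, hK⟩ := (hf.of_le one_le_two).exists_lipschitzOnWith
  obtain ⟨R, s', hs', hR⟩ :=
    (hf.fderiv_right (m := 1) (by norm_num)).exists_lipschitzOnWith
  have hd : ∀ᶠ y in 𝓝 x₀, DifferentiableAt ℝ f y :=
    (hf.eventually (by simp)).mono fun y hy ↦ hy.differentiableAt (by simp)
  obtain ⟨r, hr, hball⟩ := Metric.mem_nhds_iff.1 (inter_mem (inter_mem hs hs') hd)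
  refine ⟨r, hr, K, R, R.2, hK.mono fun y hy ↦ (hball hy).1.1, fun y hy k hyk ↦ ?_⟩
  have hseg : segment ℝ y (y + k) ⊆ ball x₀ r := (convex_ball x₀ r).segment_subset hy hyk
  have key := (convex_segment (𝕜 := ℝ) y (y + k)).norm_image_sub_le_of_norm_hasFDerivWithin_le'
    (f := f) (f' := fderiv ℝ f) (φ := fderiv ℝ f y) (C := R * ‖k‖)
    (fun z hz ↦ (hball (hseg hz)).2.hasFDerivAt.hasFDerivWithinAt)
    (fun z hz ↦ by
      refine (hR.norm_sub_le (hball (hseg hz)).1.2 (hball hy).1.2).trans ?_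
      have h1 : ‖z - y‖ ≤ ‖k‖ := by
        obtain ⟨θ, hθ, rfl⟩ := (segment_eq_image' ℝ y (y + k)) ▸ hz
        simp only [add_sub_cancel_left, norm_smul, Real.norm_eq_abs, abs_of_nonneg hθ.1]
        exact mul_le_of_le_one_left (norm_nonneg _) hθ.2
      gcongr)
    (left_mem_segment ℝ y (y + k)) (right_mem_segment ℝ y (y + k))
  rw [add_sub_cancel_left] at key
  exact key.trans_eq (by ring)

/-- The space derivative of a local flow is the solution of the variational equation. -/
theorem eventually_hasFDerivAt_of_variational_equation {E : Type*} [NormedAddCommGroup E]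
    [NormedSpace ℝ E] {f : E → E} {x₀ : E} (hf : ContDiffAt ℝ 2 f x₀)
    {φ : ℝ × E → E} {W : ℝ × E → E →L[ℝ] E}
    (hφ0 : ∀ᶠ p in 𝓝 ((0 : ℝ), x₀), φ (0, p.2) = p.2 ∧ W (0, p.2) = .id ℝ E)
    (hφ : ∀ᶠ p in 𝓝 ((0 : ℝ), x₀), HasDerivAt (fun t ↦ φ (t, p.2)) (f (φ p)) p.1)
    (hW : ∀ᶠ p in 𝓝 ((0 : ℝ), x₀),
      HasDerivAt (fun t ↦ W (t, p.2)) ((fderiv ℝ f (φ p)).comp (W p)) p.1)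
    (hφc : ContinuousAt φ (0, x₀)) (hWc : ContinuousAt W (0, x₀)) :
    ∀ᶠ p in 𝓝 ((0 : ℝ), x₀), HasFDerivAt (fun x ↦ φ (p.1, x)) (W p) p.2 := by
  obtain ⟨r, hr, K, R, hR, hK, hquad⟩ := exists_quadratic_remainder_bound hf
  have hφx0 : φ (0, x₀) = x₀ := hφ0.self_of_nhds.1
  have h1 : ∀ᶠ p in 𝓝 ((0 : ℝ), x₀), φ p ∈ ball x₀ (r / 2) :=
    hφc.eventually_mem (by rw [hφx0]; exact ball_mem_nhds _ (half_pos hr))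
  have h2 : ∀ᶠ p in 𝓝 ((0 : ℝ), x₀), ‖W p‖ < ‖W (0, x₀)‖ + 1 :=
    hWc.norm.eventually_lt_const (lt_add_one _)
  set C := ‖W (0, x₀)‖ + 1 with hC
  have hCpos : 0 < C := by positivity
  obtain ⟨ε, hε, hball⟩ := Metric.mem_nhds_iff.1
    (inter_mem (inter_mem (inter_mem hφ0 hφ) hW) (inter_mem h1 h2))
  have hmem : ∀ t x, |t| < ε → x ∈ ball x₀ ε → (t, x) ∈ ball ((0 : ℝ), x₀) ε := by
    intro t x ht hx
    rw [mem_ball, Prod.dist_eq]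
    exact max_lt (by simpa using ht) hx
  filter_upwards [ball_mem_nhds ((0 : ℝ), x₀) hε] with p hp
  have hp1 : |p.1| < ε := by
    have := (le_max_left _ _).trans_lt (Prod.dist_eq (x := p) ▸ (mem_ball.1 hp))
    simpa using this
  have hp2 : p.2 ∈ ball x₀ ε := (le_max_right _ _).trans_lt (Prod.dist_eq (x := p) ▸ (mem_ball.1 hp))
  rw [hasFDerivAt_iff_isLittleO_nhds_zero]
  set D := R * C ^ 2 * gronwallBound 0 K 1 |p.1|
  have hev : ∀ᶠ h in 𝓝 (0 : E), p.2 + h ∈ ball x₀ ε ∧ C * ‖h‖ < r / 2 := by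
    refine Filter.Eventually.and ?_ ?_
    · have : ContinuousAt (fun h : E ↦ p.2 + h) 0 := by fun_prop
      exact this.eventually_mem (by simpa using isOpen_ball.mem_nhds hp2)
    · have : ContinuousAt (fun h : E ↦ C * ‖h‖) 0 := by fun_prop
      exact this.eventually_lt_const (by simpa using half_pos hr)
  have hbound : ∀ᶠ h in 𝓝 (0 : E),
      ‖φ (p.1, p.2 + h) - φ (p.1, p.2) - W p h‖ ≤ D * ‖‖h‖ ^ 2‖ := by
    filter_upwards [hev] with h hh
    have good : ∀ t, |t| ≤ |p.1| → ∀ x ∈ ball x₀ ε,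
        (t, x) ∈ ball ((0 : ℝ), x₀) ε := fun t ht x hx ↦ hmem t x (ht.trans_lt hp1) hx
    have hinB : ∀ t, |t| ≤ |p.1| → φ (t, p.2) + W (t, p.2) h ∈ ball x₀ r := by
      intro t ht
      have ha := (hball (good t ht _ hp2)).2
      rw [mem_ball, dist_eq_norm, add_sub_right_comm]
      have hb : ‖W (t, p.2) h‖ ≤ C * ‖h‖ :=
        ((W (t, p.2)).le_opNorm h).trans (by gcongr; exact ha.2.le)
      have hc := mem_ball_iff_norm.1 ha.1
      exact (norm_add_le _ _).trans_lt (by linarith [hh.2])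
    have hsub : ball x₀ (r / 2) ⊆ ball x₀ r := ball_subset_ball (half_le_self hr.le)
    have h00 := (hball (good 0 (by simp) _ hp2)).1.1.1
    have h01 := (hball (good 0 (by simp) _ hh.1)).1.1.1
    rw [norm_pow, norm_norm]
    rcases le_total 0 p.1 with hs | hs
    · have habs : ∀ t ∈ Icc 0 p.1, |t| ≤ |p.1| := fun t ht ↦ by
        rw [abs_of_nonneg ht.1, abs_of_nonneg hs]; exact ht.2
      have := norm_sub_sub_le_of_variational_equation (A := fderiv ℝ f) (T := p.1) (C := C)
        (u := fun t ↦ φ (t, p.2 + h)) (v := fun t ↦ φ (t, p.2)) (w := fun t ↦ W (t, p.2) h)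
        (h := h) hK hR hquad
        (fun t ht ↦ (hball (good t (habs t ht) _ hh.1)).1.1.2)
        (fun t ht ↦ (hball (good t (habs t ht) _ hp2)).1.1.2)
        (fun t ht ↦ by
          simpa using (hball (good t (habs t ht) _ hp2)).1.2.clm_apply (hasDerivAt_const t h))
        (fun t ht ↦ hsub (hball (good t (habs t ht) _ hh.1)).2.1)
        (fun t ht ↦ hsub (hball (good t (habs t ht) _ hp2)).2.1)
        (fun t ht ↦ hinB t (habs t ht))
        (fun t ht ↦ ((W (t, p.2)).le_opNorm h).trans (by
          gcongr; exact (hball (good t (habs t ht) _ hp2)).2.2.le))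
        (by rw [h00.1, h01.1]) (by simp [h00.2]) p.1 (right_mem_Icc.2 hs)
      simpa [D, abs_of_nonneg hs] using this
    -- For negative times the estimate is applied to the time-reversed curves, which solve the
    -- equation of `-f`.
    · have habs : ∀ t ∈ Icc 0 (-p.1), |-t| ≤ |p.1| := fun t ht ↦ by
        rw [abs_neg, abs_of_nonneg ht.1, abs_of_nonpos hs]; exact ht.2
      have hrev : ∀ {G : Type _} [NormedAddCommGroup G] [NormedSpace ℝ G] {γ : ℝ → G} {γ' : G}
          {t : ℝ}, HasDerivAt γ γ' (-t) → HasDerivAt (fun s ↦ γ (-s)) (-γ') t := by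
        intro G _ _ γ γ' t hγ
        simpa [Function.comp_def] using HasDerivAt.scomp t hγ (hasDerivAt_neg t)
      have := norm_sub_sub_le_of_variational_equation (A := fun x ↦ -fderiv ℝ f x) (T := -p.1)
        (f := fun x ↦ - f x) (K := K) (R := R) (B := ball x₀ r) (C := C)
        (u := fun t ↦ φ (-t, p.2 + h)) (v := fun t ↦ φ (-t, p.2)) (w := fun t ↦ W (-t, p.2) h)
        (h := h) hK.neg hR
        (fun y hy k hk ↦ by
          have e : -f (y + k) - -f y - (-fderiv ℝ f y) k = -(f (y + k) - f y - fderiv ℝ f y k) := by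
            rw [_root_.neg_apply]; abel
          simpa only [e, norm_neg] using hquad y hy k hk)
        (fun t ht ↦ hrev (hball (good _ (habs t ht) _ hh.1)).1.1.2)
        (fun t ht ↦ hrev (hball (good _ (habs t ht) _ hp2)).1.1.2)
        (fun t ht ↦ by
          have := hrev ((hball (good _ (habs t ht) _ hp2)).1.2.clm_apply (hasDerivAt_const (-t) h))
          simpa using this)
        (fun t ht ↦ hsub (hball (good _ (habs t ht) _ hh.1)).2.1)
        (fun t ht ↦ hsub (hball (good _ (habs t ht) _ hp2)).2.1)
        (fun t ht ↦ hinB _ (habs t ht))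
        (fun t ht ↦ ((W (-t, p.2)).le_opNorm h).trans (by
          gcongr; exact (hball (good _ (habs t ht) _ hp2)).2.2.le))
        (by simp only [neg_zero]; rw [h00.1, h01.1]) (by simp [h00.2]) (-p.1) (right_mem_Icc.2 (by linarith))
      simpa [D, abs_of_nonpos hs] using this
  refine (Asymptotics.IsBigO.of_bound D hbound).trans_isLittleO ?_
  exact Asymptotics.isLittleO_norm_pow_id one_lt_two

/-- Smooth dependence on initial conditions: a `C^{n+1}` vector field on a Banach space has a
local flow of class `C^n`. -/
theorem ContDiffAt.exists_contDiffAt_localFlow (n : ℕ) :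
    ∀ {E : Type*} [NormedAddCommGroup E] [NormedSpace ℝ E] [CompleteSpace E] {f : E → E} {x₀ : E},
      ContDiffAt ℝ (n + 1) f x₀ → ∃ φ : ℝ × E → E,
        (∀ᶠ p in 𝓝 ((0 : ℝ), x₀), φ (0, p.2) = p.2 ∧
          HasDerivAt (fun t ↦ φ (t, p.2)) (f (φ p)) p.1) ∧ ContDiffAt ℝ n φ (0, x₀) := by
  induction n with
  | zero =>
    intro E _ _ _ f x₀ hf
    obtain ⟨ε, hε, a, r, L, K, hr, hpl⟩ := IsPicardLindelof.of_contDiffAt_one (by simpa using hf)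
    obtain ⟨α, hα, hc⟩ := (hpl 0).exists_forall_mem_closedBall_eq_hasDerivWithinAt_continuousOn
    have hnhds : Ioo (0 - ε) (0 + ε) ×ˢ ball x₀ r ∈ 𝓝 ((0 : ℝ), x₀) :=
      prod_mem_nhds (Ioo_mem_nhds (by linarith) (by linarith)) (ball_mem_nhds _ hr)
    refine ⟨fun p ↦ α (p.2, p.1), ?_, ?_⟩
    · filter_upwards [hnhds] with p hp
      have := hα p.2 (ball_subset_closedBall hp.2)
      exact ⟨this.1, (this.2 p.1 (Ioo_subset_Icc_self hp.1)).hasDerivAt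
        (Icc_mem_nhds hp.1.1 hp.1.2)⟩
    · simp only [Nat.cast_zero]
      rw [contDiffAt_zero]
      refine ⟨_, hnhds, hc.comp (by fun_prop) fun p hp ↦ ?_⟩
      exact ⟨ball_subset_closedBall hp.2, Ioo_subset_Icc_self hp.1⟩
  | succ n ih =>
    intro E _ _ _ f x₀ hf
    have hDf : ContDiffAt ℝ (n + 1) (fderiv ℝ f) x₀ := hf.fderiv_right (by simp)
    -- The equation is coupled with its variational equation on `E × (E →L[ℝ] E)`. This costs one
    -- derivative, so the induction hypothesis gives a `C^n` flow. Started at the identity, its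
    -- second component is the space derivative of the first. All partial derivatives of `φ` are
    -- then `C^n`, which makes `φ` of class `C^{n+1}`.
    have hF : ContDiffAt ℝ (n + 1)
        (fun q : E × (E →L[ℝ] E) ↦ (f q.1, (fderiv ℝ f q.1).comp q.2)) (x₀, .id ℝ E) := by
      refine ContDiffAt.prodMk ?_ ?_
      · exact ContDiffAt.comp (x₀, ContinuousLinearMap.id ℝ E)
          (hf.of_le (by exact_mod_cast Nat.le_succ _)) contDiffAt_fst
      · exact (ContDiffAt.comp (x₀, ContinuousLinearMap.id ℝ E) hDf contDiffAt_fst).clm_comp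
          contDiffAt_snd
    obtain ⟨Ψ, hΨ, hΨc⟩ := ih hF
    have hι : ContDiff ℝ n (fun p : ℝ × E ↦ (p.1, (p.2, ContinuousLinearMap.id ℝ E))) := by
      fun_prop
    have hιt : Tendsto (fun p : ℝ × E ↦ (p.1, (p.2, ContinuousLinearMap.id ℝ E)))
        (𝓝 ((0 : ℝ), x₀)) (𝓝 (0, (x₀, .id ℝ E))) := hι.continuous.tendsto _
    have hΨι : ContDiffAt ℝ n (fun p : ℝ × E ↦ Ψ (p.1, (p.2, .id ℝ E))) (0, x₀) :=
      ContDiffAt.comp (0, x₀) hΨc hι.contDiffAt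
    have hev := hιt.eventually hΨ
    set φ : ℝ × E → E := fun p ↦ (Ψ (p.1, (p.2, .id ℝ E))).1 with hφdef
    set W : ℝ × E → E →L[ℝ] E := fun p ↦ (Ψ (p.1, (p.2, .id ℝ E))).2 with hWdef
    have hφC : ContDiffAt ℝ n φ (0, x₀) := hΨι.fst
    have hWC : ContDiffAt ℝ n W (0, x₀) := hΨι.snd
    have hφ0 : ∀ᶠ p in 𝓝 ((0 : ℝ), x₀), φ (0, p.2) = p.2 ∧ W (0, p.2) = .id ℝ E := by
      filter_upwards [hev] with p hp
      simp [hφdef, hWdef, hp.1]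
    have hφ : ∀ᶠ p in 𝓝 ((0 : ℝ), x₀), HasDerivAt (fun t ↦ φ (t, p.2)) (f (φ p)) p.1 := by
      filter_upwards [hev] with p hp
      exact (hasFDerivAt_fst (𝕜 := ℝ)).comp_hasDerivAt _ hp.2
    have hW : ∀ᶠ p in 𝓝 ((0 : ℝ), x₀),
        HasDerivAt (fun t ↦ W (t, p.2)) ((fderiv ℝ f (φ p)).comp (W p)) p.1 := by
      filter_upwards [hev] with p hp
      exact (hasFDerivAt_snd (𝕜 := ℝ)).comp_hasDerivAt _ hp.2
    have hspace := eventually_hasFDerivAt_of_variational_equation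
      (hf.of_le (by norm_cast; omega)) hφ0 hφ hW hφC.continuousAt hWC.continuousAt
    have hφx0 : φ (0, x₀) = x₀ := hφ0.self_of_nhds.1
    have hffφ : ContDiffAt ℝ n (fun p ↦ f (φ p)) (0, x₀) :=
      ContDiffAt.comp (0, x₀) (by rw [hφx0]; exact hf.of_le (by norm_cast; omega)) hφC
    refine ⟨φ, (hφ0.and hφ).mono fun p hp ↦ ⟨hp.1.1, hp.2⟩, ?_⟩
    have hcont : ∀ {G : Type _} [NormedAddCommGroup G] [NormedSpace ℝ G] {k : ℝ × E → G},
        ContDiffAt ℝ n k (0, x₀) → ∀ᶠ p in 𝓝 ((0 : ℝ), x₀), ContinuousAt k p :=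
      fun hk ↦ (hk.eventually (by simp)).mono fun _ h ↦ h.continuousAt
    have hf' : ContDiffAt ℝ n (fun p ↦ (ContinuousLinearMap.toSpanSingleton ℝ (f (φ p))).coprod
        (W p)) (0, x₀) := by
      have e1 : ContDiffAt ℝ n (fun p ↦ ContinuousLinearMap.toSpanSingleton ℝ (f (φ p)))
          (0, x₀) :=
        (ContinuousLinearMap.toSpanSingletonCLE (𝕜 := ℝ) (E := E)).contDiff.contDiffAt.comp
          (0, x₀) hffφ
      have e2 : (fun p ↦ (ContinuousLinearMap.toSpanSingleton ℝ (f (φ p))).coprod (W p)) =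
          fun p ↦ (ContinuousLinearMap.toSpanSingleton ℝ (f (φ p))).comp
            (ContinuousLinearMap.fst ℝ ℝ E) + (W p).comp (ContinuousLinearMap.snd ℝ ℝ E) := by
        ext p <;> simp
      rw [e2]
      exact (e1.clm_comp contDiffAt_const).add (hWC.clm_comp contDiffAt_const)
    have hder : ∀ᶠ p in 𝓝 ((0 : ℝ), x₀), HasFDerivAt φ
        ((ContinuousLinearMap.toSpanSingleton ℝ (f (φ p))).coprod (W p)) p := by
      filter_upwards [hφ.eventually_nhds, hspace.eventually_nhds, hcont hffφ, hcont hWC]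
        with p h1 h2 h3 h4
      exact (hasStrictFDerivAt_uncurry_coprod (f := fun t x ↦ φ (t, x))
        (f₁ := fun t x ↦ ContinuousLinearMap.toSpanSingleton ℝ (f (φ (t, x))))
        (f₂ := fun t x ↦ W (t, x)) (h1.mono fun v hv ↦ hv.hasFDerivAt) h2
        ((ContinuousLinearMap.toSpanSingletonCLE (𝕜 := ℝ) (E := E)).continuous.continuousAt.comp h3)
        h4).hasFDerivAt
    obtain ⟨s, hs, hs'⟩ := hder.exists_mem
    rw [Nat.cast_succ, contDiffAt_succ_iff_hasFDerivAt]
    exact ⟨_, ⟨s, hs, hs'⟩, hf'⟩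

end SmoothDependence

/-! ### Global flows of compactly supported vector fields -/

section ManifoldFlow

variable {E : Type*} [NormedAddCommGroup E] [NormedSpace ℝ E] [CompleteSpace E]
  {M : Type*} [TopologicalSpace M] [ChartedSpace E M] [IsManifold 𝓘(ℝ, E) ∞ M]

/-- A smooth vector field on a boundaryless manifold has, near each point, a local flow of any
finite order of differentiability. -/
theorem exists_contMDiffAt_localFlow {v : ∀ x : M, TangentSpace 𝓘(ℝ, E) x}
    (hv : ContMDiff 𝓘(ℝ, E) 𝓘(ℝ, E).tangent ∞
      (fun x ↦ (⟨x, v x⟩ : TangentBundle 𝓘(ℝ, E) M))) (z : M) (n : ℕ) :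
    ∃ φ : ℝ × M → M, ContMDiffAt (𝓘(ℝ, ℝ).prod 𝓘(ℝ, E)) 𝓘(ℝ, E) n φ (0, z) ∧
      ∀ᶠ p in 𝓝 ((0 : ℝ), z), φ (0, p.2) = p.2 ∧
        HasMFDerivAt 𝓘(ℝ, ℝ) 𝓘(ℝ, E) (fun t ↦ φ (t, p.2)) p.1
          ((1 : ℝ →L[ℝ] ℝ).smulRight (v (φ p))) := by
  have : IsManifold 𝓘(ℝ, E) 1 M := IsManifold.of_le (n := ∞) (by simp)
  set e := extChartAt 𝓘(ℝ, E) z with he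
  set T := trivializationAt E (TangentSpace 𝓘(ℝ, E) : M → Type _) z with hT
  set f : E → E := fun y ↦ (T ⟨e.symm y, v (e.symm y)⟩).2 with hf
  have hzt : e.target ∈ 𝓝 (e z) := extChartAt_target_mem_nhds z
  have hsymm : ContMDiffAt 𝓘(ℝ, E) 𝓘(ℝ, E) ∞ e.symm (e z) :=
    (contMDiffOn_extChartAt_symm z).contMDiffAt hzt
  have hfs : ContDiffAt ℝ ∞ f (e z) := by
    rw [← contMDiffAt_iff_contDiffAt]
    have h1 := (Bundle.contMDiffAt_section (IB := 𝓘(ℝ, E)) (F := E) (n := ∞) z).1 (hv z)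
    have h2 : e.symm (e z) = z := extChartAt_to_inv z
    exact ContMDiffAt.comp (e z) (g := fun x ↦ (T ⟨x, v x⟩).2) (by rw [h2]; exact h1) hsymm
  obtain ⟨ψ, hψ, hψs⟩ := ContDiffAt.exists_contDiffAt_localFlow n (f := f) (x₀ := e z)
    (hfs.of_le (by exact_mod_cast le_top))
  have hec : ContMDiffAt 𝓘(ℝ, E) 𝓘(ℝ, E) ∞ e z := contMDiffAt_extChartAt
  have hι : ContMDiffAt (𝓘(ℝ, ℝ).prod 𝓘(ℝ, E)) (𝓘(ℝ, ℝ × E)) n (fun p : ℝ × M ↦ (p.1, e p.2))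
      (0, z) := by
    have h5 : ContMDiffAt (𝓘(ℝ, ℝ).prod 𝓘(ℝ, E)) 𝓘(ℝ, E) n (fun p : ℝ × M ↦ e p.2) (0, z) :=
      ContMDiffAt.comp (0, z) (g := e) (f := Prod.snd)
        (hec.of_le (by exact_mod_cast le_top)) contMDiffAt_snd
    have h6 : ContMDiffAt (𝓘(ℝ, ℝ).prod 𝓘(ℝ, E)) 𝓘(ℝ, ℝ) n (Prod.fst : ℝ × M → ℝ) (0, z) :=
      contMDiffAt_fst
    exact h6.prodMk_space h5
  have hψ0 : ψ (0, e z) = e z := hψ.self_of_nhds.1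
  refine ⟨fun p ↦ e.symm (ψ (p.1, e p.2)), ?_, ?_⟩
  · have h7 : ContMDiffAt (𝓘(ℝ, ℝ).prod 𝓘(ℝ, E)) 𝓘(ℝ, E) n
        (fun p : ℝ × M ↦ ψ (p.1, e p.2)) (0, z) :=
      ContMDiffAt.comp (0, z) (g := ψ) hψs.contMDiffAt hι
    have h8 : ContMDiffAt 𝓘(ℝ, E) 𝓘(ℝ, E) n e.symm (ψ (0, e z)) := by
      rw [hψ0]; exact hsymm.of_le (by exact_mod_cast le_top)
    exact ContMDiffAt.comp (0, z) h8 h7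
  · have hc : Tendsto (fun p : ℝ × M ↦ (p.1, e p.2)) (𝓝 (0, z)) (𝓝 (0, e z)) :=
      hι.continuousAt
    have h3 : ∀ᶠ p in 𝓝 ((0 : ℝ), e z), ψ p ∈ e.target :=
      hψs.continuousAt.eventually_mem (by rw [hψ0]; exact hzt)
    have h4 : ∀ᶠ p in 𝓝 ((0 : ℝ), z), p.2 ∈ e.source :=
      continuousAt_snd.eventually_mem (extChartAt_source_mem_nhds z)
    filter_upwards [hc.eventually hψ, hc.eventually h3, h4] with p h1 h2 h4
    refine ⟨by simp only [h1.1]; exact e.left_inv h4, ?_⟩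
    set y := ψ (p.1, e p.2) with hy
    have hsy : HasMFDerivAt 𝓘(ℝ, E) 𝓘(ℝ, E) e.symm y (mfderiv 𝓘(ℝ, E) 𝓘(ℝ, E) e.symm y) := by
      refine MDifferentiableAt.hasMFDerivAt ?_
      exact ((contMDiffOn_extChartAt_symm (n := 1) z).contMDiffAt
        ((isOpen_extChartAt_target z).mem_nhds h2)).mdifferentiableAt one_ne_zero
    have hψd : HasMFDerivAt 𝓘(ℝ, ℝ) 𝓘(ℝ, E) (fun t ↦ ψ (t, e p.2)) p.1
      ((1 : ℝ →L[ℝ] ℝ).smulRight (f y)) := h1.2.hasFDerivAt.hasMFDerivAt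
    refine (HasMFDerivAt.comp p.1 hsy hψd).congr_mfderiv ?_
    have hmem : e.symm y ∈ e.source := e.map_target h2
    have hfy : f y = mfderiv 𝓘(ℝ, E) 𝓘(ℝ, E) e (e.symm y) (v (e.symm y)) := by
      have hb : e.symm y ∈ (chartAt E z).source := by simpa [he] using hmem
      rw [hf, ← TangentBundle.continuousLinearMapAt_trivializationAt hb]
      exact (Bundle.Trivialization.continuousLinearMapAt_apply_of_mem (R := ℝ) (e := T) (by simpa [hT] using hb) _).symm
    have hinv := mfderivWithin_extChartAt_symm_comp_mfderiv_extChartAt (I := 𝓘(ℝ, E)) h2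
    rw [ModelWithCorners.range_eq_univ, mfderivWithin_univ] at hinv
    rw [hfy]
    ext
    have := DFunLike.congr_fun hinv (v (e.symm y))
    change (mfderiv 𝓘(ℝ, E) 𝓘(ℝ, E) e.symm y) ((1 : ℝ) • mfderiv 𝓘(ℝ, E) 𝓘(ℝ, E) e (e.symm y)
      (v (e.symm y))) = (1 : ℝ) • v (e.symm y)
    rw [one_smul, one_smul]
    exact this

/-- A global smooth flow on `M`, together with its generating vector field. -/
structure SmoothFlow (E : Type*) [NormedAddCommGroup E] [NormedSpace ℝ E]
    (M : Type*) [TopologicalSpace M] [ChartedSpace E M] [IsManifold 𝓘(ℝ, E) ∞ M] where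
  /-- The generating vector field. -/
  field : ∀ x : M, TangentSpace 𝓘(ℝ, E) x
  contMDiff_field : ContMDiff 𝓘(ℝ, E) 𝓘(ℝ, E).tangent ∞
    (fun x ↦ (⟨x, field x⟩ : TangentBundle 𝓘(ℝ, E) M))
  /-- The flow map. -/
  map : ℝ → M → M
  contMDiff_map : ContMDiff (𝓘(ℝ, ℝ).prod 𝓘(ℝ, E)) 𝓘(ℝ, E) ∞ (fun p : ℝ × M ↦ map p.1 p.2)
  map_zero : ∀ x, map 0 x = x
  map_add : ∀ s t x, map (s + t) x = map s (map t x)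
  isMIntegralCurve : ∀ x, IsMIntegralCurve (fun t ↦ map t x) field

/-- Finitely many local flows cover `K`, which makes the existence time uniform there; off `K`
constant curves serve. A uniform existence time is what allows integral curves to be prolonged to
all of `ℝ`. -/
theorem exists_integralCurves_of_compact_support {v : ∀ x : M, TangentSpace 𝓘(ℝ, E) x}
    (hv : ContMDiff 𝓘(ℝ, E) 𝓘(ℝ, E).tangent ∞
      (fun x ↦ (⟨x, v x⟩ : TangentBundle 𝓘(ℝ, E) M)))
    {K : Set M} (hK : IsCompact K) (hvK : ∀ x ∉ K, v x = 0) :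
    ∃ ε > 0, ∀ x : M, ∃ γ : ℝ → M, γ 0 = x ∧ IsMIntegralCurveOn γ v (Ioo (-ε) ε) := by
  have key : ∃ ε > 0, ∀ x ∈ K, ∃ γ : ℝ → M, γ 0 = x ∧ IsMIntegralCurveOn γ v (Ioo (-ε) ε) := by
    refine hK.induction_on (p := fun S ↦ ∃ ε > 0, ∀ x ∈ S, ∃ γ : ℝ → M, γ 0 = x ∧
      IsMIntegralCurveOn γ v (Ioo (-ε) ε)) ⟨1, one_pos, by simp⟩ ?_ ?_ ?_
    · rintro s t hst ⟨ε, hε, h⟩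
      exact ⟨ε, hε, fun x hx ↦ h x (hst hx)⟩
    · rintro s t ⟨ε, hε, h⟩ ⟨ε', hε', h'⟩
      refine ⟨min ε ε', lt_min hε hε', ?_⟩
      rintro x (hx | hx)
      · obtain ⟨γ, h0, hγ⟩ := h x hx
        exact ⟨γ, h0, hγ.mono (Ioo_subset_Ioo (neg_le_neg (min_le_left _ _)) (min_le_left _ _))⟩
      · obtain ⟨γ, h0, hγ⟩ := h' x hx
        exact ⟨γ, h0, hγ.mono (Ioo_subset_Ioo (neg_le_neg (min_le_right _ _)) (min_le_right _ _))⟩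
    · intro z _
      obtain ⟨φ, -, hφ⟩ := exists_contMDiffAt_localFlow hv z 0
      rw [nhds_prod_eq] at hφ
      obtain ⟨P, hP, Q, hQ, hPQ⟩ := Filter.eventually_prod_iff.1 hφ
      obtain ⟨ε, hε, hball⟩ := Metric.eventually_nhds_iff_ball.1 hP
      refine ⟨{x | Q x}, mem_nhdsWithin_of_mem_nhds hQ, ε, hε, fun x hx ↦
        ⟨fun t ↦ φ (t, x), (hPQ (hball 0 (Metric.mem_ball_self hε)) hx).1, fun t ht ↦ ?_⟩⟩
      exact (hPQ (hball t (by simpa [Real.ball_eq_Ioo] using ht)) hx).2.hasMFDerivWithinAt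
  obtain ⟨ε, hε, h⟩ := key
  refine ⟨ε, hε, fun x ↦ ?_⟩
  by_cases hx : x ∈ K
  · exact h x hx
  · exact ⟨fun _ ↦ x, rfl, (isMIntegralCurve_const (hvK x hx)).isMIntegralCurveOn _⟩

/-- A compactly supported smooth vector field generates a global smooth flow. -/
theorem SmoothFlow.exists_of_compact_support [T2Space M] {v : ∀ x : M, TangentSpace 𝓘(ℝ, E) x}
    (hv : ContMDiff 𝓘(ℝ, E) 𝓘(ℝ, E).tangent ∞
      (fun x ↦ (⟨x, v x⟩ : TangentBundle 𝓘(ℝ, E) M)))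
    {K : Set M} (hK : IsCompact K) (hvK : ∀ x ∉ K, v x = 0) :
    ∃ F : SmoothFlow E M, F.field = v := by
  have : IsManifold 𝓘(ℝ, E) 1 M := IsManifold.of_le (n := ∞) (by simp)
  have hv1 : ContMDiff 𝓘(ℝ, E) 𝓘(ℝ, E).tangent 1
      (fun x ↦ (⟨x, v x⟩ : TangentBundle 𝓘(ℝ, E) M)) := hv.of_le (by simp)
  obtain ⟨ε, hε, h⟩ := exists_integralCurves_of_compact_support hv hK hvK
  choose Φ hΦ0 hΦ using fun x ↦ exists_isMIntegralCurve_of_isMIntegralCurveOn hv1 hε h x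
  have hadd : ∀ s t x, Φ x (s + t) = Φ (Φ x t) s := by
    intro s t x
    have := isMIntegralCurve_Ioo_eq_of_contMDiff_boundaryless (t₀ := 0) hv1
      ((hΦ x).comp_add t) (hΦ (Φ x t)) (by simp [hΦ0])
    exact congrFun this s
  -- The neighbourhood on which a `C^n` local flow exists may shrink with `n`. Uniqueness of
  -- integral curves identifies each of them with the one map `Φ`, so smoothness can be shown one
  -- order at a time.
  have hloc : ∀ (n : ℕ) (z : M), ContMDiffAt (𝓘(ℝ, ℝ).prod 𝓘(ℝ, E)) 𝓘(ℝ, E) n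
      (fun p : ℝ × M ↦ Φ p.2 p.1) (0, z) := by
    intro n z
    obtain ⟨φ, hφs, hφ⟩ := exists_contMDiffAt_localFlow hv z n
    refine hφs.congr_of_eventuallyEq ?_
    rw [nhds_prod_eq] at hφ ⊢
    obtain ⟨P, hP, Q, hQ, hPQ⟩ := Filter.eventually_prod_iff.1 hφ
    obtain ⟨ε, hε, hball⟩ := Metric.eventually_nhds_iff_ball.1 hP
    have hb : Metric.ball (0 : ℝ) ε = Ioo (-ε) ε := by simp [Real.ball_eq_Ioo]
    refine Filter.eventually_prod_iff.2 ⟨fun t ↦ t ∈ Metric.ball 0 ε, Metric.ball_mem_nhds _ hε, Q, hQ,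
      fun {t} ht {x} hx ↦ ?_⟩
    rw [hb] at ht hball
    have h0 : (0 : ℝ) ∈ Ioo (-ε) ε := by simp [hε]
    exact isMIntegralCurveOn_Ioo_eqOn_of_contMDiff_boundaryless h0 hv1
      ((hΦ x).isMIntegralCurveOn _)
      (fun t ht ↦ (hPQ (hball t ht) hx).2.hasMFDerivWithinAt)
      (by rw [hΦ0]; exact (hPQ (hball 0 h0) hx).1.symm) ht
  have hev : ∀ (n : ℕ) (q : ℝ × M), ContMDiffAt (𝓘(ℝ, ℝ).prod 𝓘(ℝ, E)) 𝓘(ℝ, E) n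
      (fun p : ℝ × M ↦ Φ p.2 p.1) q → ∀ᶠ q' in 𝓝 q,
        ContMDiffAt (𝓘(ℝ, ℝ).prod 𝓘(ℝ, E)) 𝓘(ℝ, E) n (fun p : ℝ × M ↦ Φ p.2 p.1) q' := by
    intro n q hq
    have : IsManifold 𝓘(ℝ, E) n M := IsManifold.of_le (n := ∞) (by exact_mod_cast le_top)
    exact (contMDiffAt_iff_contMDiffAt_nhds (by simp)).1 hq
  have hsm : ∀ (n : ℕ) (t : ℝ) (x : M), ContMDiffAt (𝓘(ℝ, ℝ).prod 𝓘(ℝ, E)) 𝓘(ℝ, E) n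
      (fun p : ℝ × M ↦ Φ p.2 p.1) (t, x) := by
    intro n t x
    set A := {t : ℝ | ContMDiffAt (𝓘(ℝ, ℝ).prod 𝓘(ℝ, E)) 𝓘(ℝ, E) n
      (fun p : ℝ × M ↦ Φ p.2 p.1) (t, x)} with hA
    have hpair : ∀ t : ℝ, Tendsto (fun s : ℝ ↦ (s, x)) (𝓝 t) (𝓝 (t, x)) := fun t ↦
      (Continuous.prodMk_left x).tendsto t
    have hopen : IsOpen A := by
      rw [isOpen_iff_mem_nhds]
      intro t ht
      exact (hpair t).eventually (hev n _ ht)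
    -- For `s` in `A` close to `t`, the flow near time `t` is the flow for the short time `t - s`
    -- after the flow for time `s`, and both are `C^n` where needed.
    have hclosed : IsClosed A := by
      rw [← closure_subset_iff_isClosed]
      intro t ht
      have h1 : ∀ᶠ q in 𝓝 ((0 : ℝ), Φ x t), ContMDiffAt (𝓘(ℝ, ℝ).prod 𝓘(ℝ, E)) 𝓘(ℝ, E) n
          (fun p : ℝ × M ↦ Φ p.2 p.1) q := hev n _ (hloc n (Φ x t))
      have h2 : Tendsto (fun s : ℝ ↦ (t - s, Φ x s)) (𝓝 t) (𝓝 (0, Φ x t)) := by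
        have : ContinuousAt (fun s : ℝ ↦ (t - s, Φ x s)) t :=
          (by fun_prop : ContinuousAt (fun s : ℝ ↦ t - s) t).prodMk (hΦ x).continuous.continuousAt
        simpa [ContinuousAt] using this
      obtain ⟨s, hs, hsA⟩ := mem_closure_iff_nhds.1 ht _ (h2.eventually h1)
      have hg : ContMDiffAt (𝓘(ℝ, ℝ).prod 𝓘(ℝ, E)) (𝓘(ℝ, ℝ).prod 𝓘(ℝ, E)) n
          (fun p : ℝ × M ↦ (p.1 - s, Φ p.2 s)) (t, x) := by
        refine ContMDiffAt.prodMk ?_ ?_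
        · have e1 : ContMDiffAt 𝓘(ℝ, ℝ) 𝓘(ℝ, ℝ) n (fun r : ℝ ↦ r - s) t := by
            rw [contMDiffAt_iff_contDiffAt]; fun_prop
          have e2 : ContMDiffAt (𝓘(ℝ, ℝ).prod 𝓘(ℝ, E)) 𝓘(ℝ, ℝ) n
            (Prod.fst : ℝ × M → ℝ) (t, x) := contMDiffAt_fst
          exact ContMDiffAt.comp (t, x) e1 e2
        · have e3 : ContMDiffAt (𝓘(ℝ, ℝ).prod 𝓘(ℝ, E)) (𝓘(ℝ, ℝ).prod 𝓘(ℝ, E)) n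
              (fun p : ℝ × M ↦ (s, p.2)) (t, x) := contMDiffAt_const.prodMk contMDiffAt_snd
          have e4 : ContMDiffAt (𝓘(ℝ, ℝ).prod 𝓘(ℝ, E)) 𝓘(ℝ, E) n
            (fun p : ℝ × M ↦ Φ p.2 p.1) (s, x) := hsA
          exact ContMDiffAt.comp (t, x) e4 e3
      have e5 : ContMDiffAt (𝓘(ℝ, ℝ).prod 𝓘(ℝ, E)) 𝓘(ℝ, E) n
        (fun p : ℝ × M ↦ Φ p.2 p.1) (t - s, Φ x s) := hs
      have hcomp := ContMDiffAt.comp (t, x) e5 hg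
      refine hcomp.congr_of_eventuallyEq (Eventually.of_forall fun p ↦ ?_)
      simp [← hadd]
    have huniv : A = univ := IsClopen.eq_univ ⟨hclosed, hopen⟩ ⟨0, hloc n x⟩
    exact (huniv ▸ mem_univ t : t ∈ A)
  exact ⟨⟨v, hv, fun t x ↦ Φ x t, contMDiff_infty.2 fun n p ↦ hsm n p.1 p.2, hΦ0, hadd, hΦ⟩, rfl⟩

end ManifoldFlow

noncomputable section

/-! ### Time reversal of a flow -/

section ReverseFlow

variable {E : Type*} [NormedAddCommGroup E] [NormedSpace ℝ E]
  {M : Type*} [TopologicalSpace M] [ChartedSpace E M] [IsManifold 𝓘(ℝ, E) ∞ M]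

namespace SmoothFlow

/-- The flow run backwards in time. -/
def reverse (F : SmoothFlow E M) : SmoothFlow E M where
  field x := -F.field x
  contMDiff_field := by
    intro x
    have := (Bundle.contMDiffAt_section (IB := 𝓘(ℝ, E)) (F := E) (n := ∞) x).1
      (F.contMDiff_field x)
    refine (Bundle.contMDiffAt_section (IB := 𝓘(ℝ, E)) (F := E) (n := ∞) x).2 ?_
    refine this.neg.congr_of_eventuallyEq ?_
    set T := trivializationAt E (TangentSpace 𝓘(ℝ, E) : M → Type _) x with hT
    filter_upwards [T.open_baseSet.mem_nhds (FiberBundle.mem_baseSet_trivializationAt' x)] with y hy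
    rw [← Bundle.Trivialization.continuousLinearMapAt_apply_of_mem (R := ℝ) (e := T) hy,
      ← Bundle.Trivialization.continuousLinearMapAt_apply_of_mem (R := ℝ) (e := T) hy, map_neg]
  map t := F.map (-t)
  contMDiff_map := by
    have e1 : ContMDiff 𝓘(ℝ, ℝ) 𝓘(ℝ, ℝ) ∞ (fun t : ℝ ↦ -t) := contDiff_neg.contMDiff
    exact F.contMDiff_map.comp ((e1.comp contMDiff_fst).prodMk contMDiff_snd)
  map_zero x := by simp [F.map_zero]
  map_add s t x := by rw [neg_add]; exact F.map_add _ _ _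
  isMIntegralCurve x := by
    have := (F.isMIntegralCurve x).comp_mul (-1)
    convert! this using 2
    · simp
    · simp

theorem reverse_map (F : SmoothFlow E M) (t : ℝ) (x : M) : F.reverse.map t x = F.map (-t) x := rfl

theorem reverse_field (F : SmoothFlow E M) (x : M) : F.reverse.field x = -F.field x := rfl

theorem continuous_map (F : SmoothFlow E M) : Continuous (fun p : ℝ × M ↦ F.map p.1 p.2) :=
  F.contMDiff_map.continuous

theorem map_neg_map (F : SmoothFlow E M) (t : ℝ) (x : M) : F.map (-t) (F.map t x) = x := by
  rw [← F.map_add, neg_add_cancel, F.map_zero]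

theorem contMDiff_curve (F : SmoothFlow E M) (x : M) :
    ContMDiff 𝓘(ℝ, ℝ) 𝓘(ℝ, E) ∞ (fun t ↦ F.map t x) :=
  F.contMDiff_map.comp (contMDiff_id.prodMk contMDiff_const)

theorem mfderiv_curve (F : SmoothFlow E M) (x : M) (t : ℝ) :
    mfderiv 𝓘(ℝ, ℝ) 𝓘(ℝ, E) (fun t ↦ F.map t x) t (1 : ℝ) = F.field (F.map t x) := by
  rw [(F.isMIntegralCurve x t).mfderiv]
  exact one_smul ℝ _

end SmoothFlow

end ReverseFlow

/-! ### Timecones and a smooth timelike vector field -/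

section LorentzAlgebra

variable {d : ℕ} {M : Type*} [TopologicalSpace M]
  [ChartedSpace (EuclideanSpace ℝ (Fin (d + 1))) M] [IsManifold (𝓡 (d + 1)) ∞ M]

namespace LorentzianMetric

/-- The timelike vectors in the same timecone as `u`. -/
def cone (g : LorentzianMetric d M) {x : M} (u : TangentSpace (𝓡 (d + 1)) x) :
    Set (TangentSpace (𝓡 (d + 1)) x) :=
  {v | g.form x v v < 0 ∧ g.form x v u < 0}

/-- Reverse Cauchy–Schwarz inequality in qualitative form. -/
theorem form_neg_of_mem_cone (g : LorentzianMetric d M) {x : M}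
    {u v w : TangentSpace (𝓡 (d + 1)) x} (hu : g.form x u u < 0) (hv : v ∈ g.cone u)
    (hw : w ∈ g.cone u) : g.form x v w < 0 := by
  obtain ⟨b, hb⟩ := g.signature x
  have key : ∀ v w : TangentSpace (𝓡 (d + 1)) x, g.form x v w =
      -(b.repr v 0 * b.repr w 0) + ∑ i : Fin d, b.repr v i.succ * b.repr w i.succ := by
    intro v w
    have h1 : g.form x v w = ∑ i, ∑ j, b.repr v i * b.repr w j * g.form x (b i) (b j) := by
      conv_lhs => rw [← b.sum_repr v, ← b.sum_repr w]
      simp only [map_sum, map_smul, _root_.sum_apply, _root_.smul_apply,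
        smul_eq_mul, Finset.mul_sum]
      rw [Finset.sum_comm]
      exact Finset.sum_congr rfl fun i _ ↦ Finset.sum_congr rfl fun j _ ↦ by ring
    rw [h1]
    simp only [hb, mul_ite, mul_zero, Finset.sum_ite_eq, Finset.mem_univ, if_true]
    rw [Fin.sum_univ_succ]
    simp [Fin.succ_ne_zero]
  have cs : ∀ v w : TangentSpace (𝓡 (d + 1)) x, g.form x v v < 0 → g.form x w w < 0 →
      |∑ i : Fin d, b.repr v i.succ * b.repr w i.succ| < |b.repr v 0 * b.repr w 0| := by
    intro v w hv hw
    rw [key] at hv hw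
    have h := Finset.sum_mul_sq_le_sq_mul_sq Finset.univ (fun i : Fin d ↦ b.repr v i.succ)
      (fun i : Fin d ↦ b.repr w i.succ)
    simp only [← pow_two] at hv hw
    rw [← sq_lt_sq, mul_pow]
    refine h.trans_lt ?_
    have h0 : 0 ≤ ∑ i : Fin d, b.repr v i.succ ^ 2 := Finset.sum_nonneg fun i _ ↦ sq_nonneg _
    have h0' : 0 ≤ ∑ i : Fin d, b.repr w i.succ ^ 2 := Finset.sum_nonneg fun i _ ↦ sq_nonneg _
    exact mul_lt_mul'' (by linarith) (by linarith) h0 h0'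
  -- By Cauchy–Schwarz in the spatial coordinates the product of the time coordinates dominates, so
  -- it alone decides the sign of the form on two timelike vectors.
  have sgn : ∀ v w : TangentSpace (𝓡 (d + 1)) x, g.form x v v < 0 → g.form x w w < 0 →
      (g.form x v w < 0 ↔ 0 < b.repr v 0 * b.repr w 0) := by
    intro v w hv hw
    have h := cs v w hv hw
    rw [key]
    constructor
    · intro h'
      by_contra hn
      rw [abs_of_nonpos (not_lt.1 hn)] at h
      linarith [neg_abs_le (∑ i : Fin d, b.repr v i.succ * b.repr w i.succ)]
    · intro h'
      rw [abs_of_pos h'] at h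
      linarith [le_abs_self (∑ i : Fin d, b.repr v i.succ * b.repr w i.succ)]
  rw [sgn v w hv.1 hw.1]
  have h1 := (sgn v u hv.1 hu).1 hv.2
  have h2 := (sgn w u hw.1 hu).1 hw.2
  have h3 := mul_pos h1 h2
  have h4 : 0 ≤ b.repr u 0 ^ 2 := sq_nonneg _
  by_contra hn
  nlinarith

/-- The mixed terms are negative by `form_neg_of_mem_cone`. Convexity allows local fields with
values in the cones to be averaged by a partition of unity. -/
theorem convex_cone (g : LorentzianMetric d M) {x : M}
    {u : TangentSpace (𝓡 (d + 1)) x} (hu : g.form x u u < 0) : Convex ℝ (g.cone u) := by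
  intro v hv w hw a b ha hb hab
  have hvw := g.form_neg_of_mem_cone hu hv hw
  have hwv := g.form_neg_of_mem_cone hu hw hv
  have e1 : g.form x (a • v + b • w) (a • v + b • w) = a * a * g.form x v v +
      a * b * g.form x v w + a * b * g.form x w v + b * b * g.form x w w := by
    simp only [map_add, map_smul, _root_.add_apply, _root_.smul_apply,
      smul_eq_mul]
    ring
  have e2 : g.form x (a • v + b • w) u = a * g.form x v u + b * g.form x w u := by
    simp only [map_add, map_smul, _root_.add_apply, _root_.smul_apply,
      smul_eq_mul]
  have hv1 := hv.1
  have hw1 := hw.1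
  have hv2 := hv.2
  have hw2 := hw.2
  rcases ha.eq_or_lt with rfl | ha
  · have : b = 1 := by linarith
    subst this
    simpa using hw
  · refine ⟨?_, ?_⟩
    · rw [e1]
      nlinarith [mul_pos ha ha, mul_nonneg ha.le hb, mul_nonneg hb hb, mul_pos_of_neg_of_neg hv1 hv1,
        mul_nonneg (mul_nonneg ha.le hb) (neg_nonneg.2 hvw.le),
        mul_nonneg (mul_nonneg ha.le hb) (neg_nonneg.2 hwv.le),
        mul_nonneg (mul_nonneg hb hb) (neg_nonneg.2 hw1.le),
        mul_pos (mul_pos ha ha) (neg_pos.2 hv1)]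
    · rw [e2]
      nlinarith [mul_pos ha (neg_pos.2 hv2), mul_nonneg hb (neg_nonneg.2 hw2.le)]

theorem continuousAt_form (g : LorentzianMetric d M) {X : Type*} [TopologicalSpace X] {b : X → M}
    {v w : ∀ x, TangentSpace (𝓡 (d + 1)) (b x)} {x : X}
    (hv : ContinuousAt (fun x ↦ (⟨b x, v x⟩ : TangentBundle (𝓡 (d + 1)) M)) x)
    (hw : ContinuousAt (fun x ↦ (⟨b x, w x⟩ : TangentBundle (𝓡 (d + 1)) M)) x) :
    ContinuousAt (fun x ↦ g.form (b x) (v x) (w x)) x := by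
  have hf : ContinuousAt b x :=
    (FiberBundle.continuous_proj (EuclideanSpace ℝ (Fin (d + 1)))
      (TangentSpace (𝓡 (d + 1)) : M → Type _)).continuousAt.comp hv
  have hg : ContinuousAt (fun x ↦ Bundle.TotalSpace.mk' (EuclideanSpace ℝ (Fin (d + 1)) →L[ℝ]
      EuclideanSpace ℝ (Fin (d + 1)) →L[ℝ] ℝ)
      (E := fun x : M ↦
        TangentSpace (𝓡 (d + 1)) x →L[ℝ] TangentSpace (𝓡 (d + 1)) x →L[ℝ] ℝ) (b x) (g.form (b x))) x :=
    ContinuousAt.comp (g := fun y : M ↦ Bundle.TotalSpace.mk' (EuclideanSpace ℝ (Fin (d + 1)) →L[ℝ]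
      EuclideanSpace ℝ (Fin (d + 1)) →L[ℝ] ℝ)
      (E := fun x : M ↦
        TangentSpace (𝓡 (d + 1)) x →L[ℝ] TangentSpace (𝓡 (d + 1)) x →L[ℝ] ℝ) y (g.form y))
      g.continuous.continuousAt hf
  have : ContinuousAt
      (fun m ↦ Bundle.TotalSpace.mk' ℝ (E := Bundle.Trivial M ℝ) (b m) (g.form (b m) (v m) (w m))) x :=
    ContinuousAt.clm_bundle_apply₂ (E₃ := Bundle.Trivial M ℝ)
      (F₁ := EuclideanSpace ℝ (Fin (d + 1))) (F₂ := EuclideanSpace ℝ (Fin (d + 1))) hg hv hw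
  rw [FiberBundle.continuousAt_totalSpace] at this
  exact this.2

/-- Near a compact set there is a smooth compactly supported vector field which is timelike and
future directed on the set. -/
theorem exists_smoothFlow_field_mem_cone [T2Space M] [SecondCountableTopology M]
    (g : LorentzianMetric d M) (τ : g.TimeOrientation) {C : Set M} (hC : IsCompact C) :
    ∃ F : SmoothFlow (EuclideanSpace ℝ (Fin (d + 1))) M, ∀ x ∈ C, F.field x ∈ g.cone (τ.field x) := by
  classical
  have : LocallyCompactSpace M := ChartedSpace.locallyCompactSpace (EuclideanSpace ℝ (Fin (d + 1))) M
  obtain ⟨K, hK, hCK⟩ := exists_compact_superset hC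
  -- Convex constraints for the gluing: the cone on `C`, no condition on the rest of `K`, and zero
  -- off `K` to force compact support.
  let t : ∀ x : M, Set (TangentSpace (𝓡 (d + 1)) x) := fun x ↦
    if x ∈ C then g.cone (τ.field x) else if x ∈ K then univ else {0}
  have ht : ∀ x, Convex ℝ (t x) := by
    intro x
    simp only [t]
    split_ifs
    · exact g.convex_cone (τ.timelike x)
    · exact convex_univ
    · exact convex_singleton 0
  obtain ⟨s, hs⟩ := exists_contMDiffSection_forall_mem_convex_of_local (n := (⊤ : ℕ∞)) (𝓡 (d + 1))
    (F_fiber := EuclideanSpace ℝ (Fin (d + 1))) (TangentSpace (𝓡 (d + 1)) : M → Type _) t ht (by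
      intro x₀
      by_cases hx₀ : x₀ ∈ C
      · set T := trivializationAt (EuclideanSpace ℝ (Fin (d + 1)))
          (TangentSpace (𝓡 (d + 1)) : M → Type _) x₀ with hT
        have hx₀T : x₀ ∈ T.baseSet := FiberBundle.mem_baseSet_trivializationAt' x₀
        set w := T.continuousLinearMapAt ℝ x₀ (τ.field x₀) with hw
        -- The time orientation is merely continuous. Freezing its coordinates at `x₀` gives a
        -- smooth local field, which stays in the cone nearby.
        set σ : ∀ x : M, TangentSpace (𝓡 (d + 1)) x := fun x ↦ T.symmL ℝ x w with hσ
        have hσ0 : σ x₀ = τ.field x₀ := T.symmL_continuousLinearMapAt hx₀T _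
        have hσs : ContMDiffOn (𝓡 (d + 1)) (𝓡 (d + 1)).tangent ∞
            (fun x ↦ (⟨x, σ x⟩ : TangentBundle (𝓡 (d + 1)) M)) T.baseSet := by
          rw [T.contMDiffOn_section_baseSet_iff]
          refine contMDiffOn_const (c := w) |>.congr fun x hx ↦ ?_
          rw [← Bundle.Trivialization.continuousLinearMapAt_apply_of_mem (R := ℝ) (e := T) hx]
          exact T.continuousLinearMapAt_symmL hx w
        have hσc : ContinuousAt (fun x ↦ (⟨x, σ x⟩ : TangentBundle (𝓡 (d + 1)) M)) x₀ :=
          (hσs.continuousOn).continuousAt (T.open_baseSet.mem_nhds hx₀T)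
        have h1 : ∀ᶠ x in 𝓝 x₀, g.form x (σ x) (σ x) < 0 := by
          refine (g.continuousAt_form (b := id) hσc hσc).eventually_lt_const ?_
          simp only [id, hσ0]
          exact τ.timelike x₀
        have h2 : ∀ᶠ x in 𝓝 x₀, g.form x (σ x) (τ.field x) < 0 := by
          refine (g.continuousAt_form (b := id) hσc τ.continuous.continuousAt).eventually_lt_const ?_
          simp only [id, hσ0]
          exact τ.timelike x₀
        refine ⟨T.baseSet ∩ ({x | x ∈ interior K} ∩
          {x | g.form x (σ x) (σ x) < 0 ∧ g.form x (σ x) (τ.field x) < 0}),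
          inter_mem (T.open_baseSet.mem_nhds hx₀T) (inter_mem
            (isOpen_interior.mem_nhds (hCK hx₀)) (h1.and h2)), σ, hσs.mono inter_subset_left, ?_⟩
        rintro y ⟨-, hyK, hy⟩
        simp only [t]
        split_ifs with h3 h4
        · exact hy
        · exact mem_univ _
        · exact absurd (interior_subset hyK) h4
      · refine ⟨Cᶜ, hC.isClosed.isOpen_compl.mem_nhds hx₀, fun _ ↦ 0,
          (Bundle.contMDiff_zeroSection ℝ _).contMDiffOn, fun y hy ↦ ?_⟩
        simp only [t, if_neg hy]
        split_ifs <;> simp)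
  obtain ⟨F, hF⟩ := SmoothFlow.exists_of_compact_support (v := s) s.contMDiff hK (fun x hx ↦ by
    have := hs x
    simp only [t, if_neg hx, if_neg (fun h : x ∈ C ↦ hx (interior_subset (hCK h)))] at this
    exact this)
  refine ⟨F, fun x hx ↦ ?_⟩
  have := hs x
  simp only [t, if_pos hx] at this
  rwa [hF]

end LorentzianMetric

end LorentzAlgebra

/-! ### Future directed curves and their concatenation -/

section FutureCurves

variable {d : ℕ} {M : Type*} [TopologicalSpace M]
  [ChartedSpace (EuclideanSpace ℝ (Fin (d + 1))) M] [IsManifold (𝓡 (d + 1)) ∞ M]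

/-- `γ` tends to `q` along `J` towards the right end of `J`. -/
def HasFutureLimit {X : Type*} [TopologicalSpace X] (γ : ℝ → X) (J : Set ℝ) (q : X) : Prop :=
  ∀ W ∈ 𝓝 q, ∃ a ∈ J, ∀ s ∈ J, a ≤ s → γ s ∈ W

/-- `γ` tends to `q` along `J` towards the left end of `J`. -/
def HasPastLimit {X : Type*} [TopologicalSpace X] (γ : ℝ → X) (J : Set ℝ) (q : X) : Prop :=
  ∀ W ∈ 𝓝 q, ∃ a ∈ J, ∀ s ∈ J, s ≤ a → γ s ∈ W

theorem hasFutureLimit_of_tendsto {X : Type*} [TopologicalSpace X] {γ : ℝ → X} {J : Set ℝ} {q : X}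
    (hJ : J.Nonempty) (h : Tendsto (fun s : J ↦ γ s) atTop (𝓝 q)) : HasFutureLimit γ J q := by
  intro W hW
  have : Nonempty J := hJ.to_subtype
  obtain ⟨a, ha⟩ := Filter.mem_atTop_sets.1 (h hW)
  exact ⟨a, a.2, fun s hs has ↦ ha ⟨s, hs⟩ has⟩

theorem hasPastLimit_of_tendsto {X : Type*} [TopologicalSpace X] {γ : ℝ → X} {J : Set ℝ} {q : X}
    (hJ : J.Nonempty) (h : Tendsto (fun s : J ↦ γ s) atBot (𝓝 q)) : HasPastLimit γ J q := by
  intro W hW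
  have : Nonempty J := hJ.to_subtype
  obtain ⟨a, ha⟩ := Filter.mem_atBot_sets.1 (h hW)
  exact ⟨a, a.2, fun s hs has ↦ ha ⟨s, hs⟩ has⟩

/-- The curve that follows `γ₁` up to the parameter `b` and `γ₂` afterwards. -/
def joinAt {X : Type*} (b : ℝ) (γ₁ γ₂ : ℝ → X) (s : ℝ) : X := if s ≤ b then γ₁ s else γ₂ s

theorem joinAt_of_le {X : Type*} {γ₁ γ₂ : ℝ → X} {b s : ℝ} (h : s ≤ b) : joinAt b γ₁ γ₂ s = γ₁ s := if_pos h

theorem joinAt_of_ge {X : Type*} {γ₁ γ₂ : ℝ → X} {b s : ℝ} (hb : γ₁ b = γ₂ b) (h : b ≤ s) : joinAt b γ₁ γ₂ s = γ₂ s := by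
  rcases h.eq_or_lt with rfl | h
  · rw [joinAt_of_le le_rfl, hb]
  · exact if_neg h.not_ge

/-- The parameter interval of `joinAt b γ₁ γ₂`. -/
def joinDomain (b : ℝ) (J₁ J₂ : Set ℝ) : Set ℝ := (J₁ ∩ Iic b) ∪ (J₂ ∩ Ici b)

namespace LorentzianMetric

variable (g : LorentzianMetric d M) (F : SmoothFlow (EuclideanSpace ℝ (Fin (d + 1))) M)

/-- `α` is smooth near `s`, and its velocity at `s` lies in the timecone of the flow. -/
def IsFutureAt (α : ℝ → M) (s : ℝ) : Prop :=
  (∀ᶠ t in 𝓝 s, ContMDiffAt 𝓘(ℝ, ℝ) (𝓡 (d + 1)) ∞ α t) ∧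
    mfderiv 𝓘(ℝ, ℝ) (𝓡 (d + 1)) α s (1 : ℝ) ∈ g.cone (F.field (α s))

/-- On either side of `s`, the curve `γ` agrees with a smooth curve whose velocity at `s` lies in
the timecone of the flow. -/
def IsPiecewiseFutureAt (γ : ℝ → M) (s : ℝ) : Prop :=
  ∃ α β : ℝ → M, g.IsFutureAt F α s ∧ g.IsFutureAt F β s ∧ γ =ᶠ[𝓝[≤] s] α ∧ γ =ᶠ[𝓝[≥] s] β

/-- `γ` is a future directed timelike curve in `N`, defined on the open interval `J`. -/
structure IsFutureCurve (N : Set M) (γ : ℝ → M) (J : Set ℝ) : Prop where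
  isOpen : IsOpen J
  ordConnected : J.OrdConnected
  nonempty : J.Nonempty
  mapsTo : MapsTo γ J N
  piecewiseFuture : ∀ s ∈ J, g.IsPiecewiseFutureAt F γ s

/-- An inextendible future directed timelike curve in `N`. -/
structure IsInextendibleFutureCurve (N : Set M) (γ : ℝ → M) (J : Set ℝ) : Prop
    extends g.IsFutureCurve F N γ J where
  not_hasFutureLimit : ∀ q ∈ N, ¬ HasFutureLimit γ J q
  not_hasPastLimit : ∀ q ∈ N, ¬ HasPastLimit γ J q

variable {g F} {N : Set M} {γ γ₁ γ₂ : ℝ → M} {J J₁ J₂ : Set ℝ}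

theorem IsFutureAt.contMDiffAt {s : ℝ} (h : g.IsFutureAt F γ s) :
    ContMDiffAt 𝓘(ℝ, ℝ) (𝓡 (d + 1)) ∞ γ s := h.1.self_of_nhds

theorem IsFutureAt.congr {s : ℝ} (h : g.IsFutureAt F γ₁ s) (heq : γ₂ =ᶠ[𝓝 s] γ₁) :
    g.IsFutureAt F γ₂ s := by
  refine ⟨?_, ?_⟩
  · filter_upwards [h.1, heq.eventuallyEq_nhds] with t h1 h2
    exact h1.congr_of_eventuallyEq h2
  · have h1 := heq.mfderiv_eq (I := 𝓘(ℝ, ℝ)) (I' := 𝓡 (d + 1))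
    have h2 := heq.self_of_nhds
    have key : ∀ (x y : M) (_ : x = y) (v : EuclideanSpace ℝ (Fin (d + 1))),
        (v : TangentSpace (𝓡 (d + 1)) x) ∈ g.cone (F.field x) →
        (v : TangentSpace (𝓡 (d + 1)) y) ∈ g.cone (F.field y) := by
      rintro x _ rfl v hv
      exact hv
    rw [h1]
    exact key _ _ h2.symm _ h.2

theorem IsFutureAt.comp_add {s : ℝ} (c : ℝ) (h : g.IsFutureAt F γ (s + c)) :
    g.IsFutureAt F (fun t ↦ γ (t + c)) s := by
  have hadd : ∀ t, ContMDiffAt 𝓘(ℝ, ℝ) 𝓘(ℝ, ℝ) ∞ (fun t : ℝ ↦ t + c) t := fun t ↦ by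
    rw [contMDiffAt_iff_contDiffAt]; fun_prop
  refine ⟨?_, ?_⟩
  · have : Tendsto (fun t : ℝ ↦ t + c) (𝓝 s) (𝓝 (s + c)) := (continuous_add_const c).tendsto s
    filter_upwards [this.eventually h.1] with t ht
    exact ContMDiffAt.comp t (g := γ) ht (hadd t)
  · have h1 : HasMFDerivAt 𝓘(ℝ, ℝ) (𝓡 (d + 1)) γ (s + c)
        (mfderiv 𝓘(ℝ, ℝ) (𝓡 (d + 1)) γ (s + c)) :=
      (h.contMDiffAt.mdifferentiableAt (by simp)).hasMFDerivAt
    have h2 : HasMFDerivAt 𝓘(ℝ, ℝ) 𝓘(ℝ, ℝ) (fun t : ℝ ↦ t + c) s (.id ℝ ℝ) :=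
      ((hasFDerivAt_id s).add_const c).hasMFDerivAt
    have h3 := (h1.comp s h2).mfderiv
    have h4 : mfderiv 𝓘(ℝ, ℝ) (𝓡 (d + 1)) (fun t ↦ γ (t + c)) s (1 : ℝ) =
        mfderiv 𝓘(ℝ, ℝ) (𝓡 (d + 1)) γ (s + c) (1 : ℝ) := DFunLike.congr_fun h3 (1 : ℝ)
    rw [h4]
    exact h.2

theorem IsFutureAt.isPiecewiseFutureAt {s : ℝ} (h : g.IsFutureAt F γ s) :
    g.IsPiecewiseFutureAt F γ s :=
  ⟨γ, γ, h, h, EventuallyEq.rfl, EventuallyEq.rfl⟩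

theorem IsPiecewiseFutureAt.congr {s : ℝ} (h : g.IsPiecewiseFutureAt F γ₁ s)
    (heq : γ₂ =ᶠ[𝓝 s] γ₁) : g.IsPiecewiseFutureAt F γ₂ s := by
  obtain ⟨α, β, hα, hβ, h1, h2⟩ := h
  exact ⟨α, β, hα, hβ, (heq.filter_mono nhdsWithin_le_nhds).trans h1,
    (heq.filter_mono nhdsWithin_le_nhds).trans h2⟩

theorem IsPiecewiseFutureAt.glue {s : ℝ} (h₁ : g.IsPiecewiseFutureAt F γ₁ s)
    (h₂ : g.IsPiecewiseFutureAt F γ₂ s) (hl : γ =ᶠ[𝓝[≤] s] γ₁) (hr : γ =ᶠ[𝓝[≥] s] γ₂) :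
    g.IsPiecewiseFutureAt F γ s := by
  obtain ⟨α, -, hα, -, h1, -⟩ := h₁
  obtain ⟨-, β, -, hβ, -, h2⟩ := h₂
  exact ⟨α, β, hα, hβ, hl.trans h1, hr.trans h2⟩

theorem IsPiecewiseFutureAt.comp_add {s : ℝ} (c : ℝ) (h : g.IsPiecewiseFutureAt F γ (s + c)) :
    g.IsPiecewiseFutureAt F (fun t ↦ γ (t + c)) s := by
  obtain ⟨α, β, hα, hβ, h1, h2⟩ := h
  refine ⟨_, _, hα.comp_add c, hβ.comp_add c, ?_, ?_⟩
  · have : Tendsto (fun t : ℝ ↦ t + c) (𝓝[≤] s) (𝓝[≤] (s + c)) :=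
      (continuous_add_const c).continuousWithinAt.tendsto_nhdsWithin
        fun t ht ↦ by simpa using ht
    exact this.eventually h1
  · have : Tendsto (fun t : ℝ ↦ t + c) (𝓝[≥] s) (𝓝[≥] (s + c)) :=
      (continuous_add_const c).continuousWithinAt.tendsto_nhdsWithin
        fun t ht ↦ by simpa using ht
    exact this.eventually h2

theorem IsPiecewiseFutureAt.continuousAt {s : ℝ} (h : g.IsPiecewiseFutureAt F γ s) :
    ContinuousAt γ s := by
  obtain ⟨α, β, hα, hβ, h1, h2⟩ := h
  rw [continuousAt_iff_continuous_left_right]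
  exact ⟨hα.contMDiffAt.continuousAt.continuousWithinAt.congr_of_eventuallyEq_of_mem h1 self_mem_Iic,
    hβ.contMDiffAt.continuousAt.continuousWithinAt.congr_of_eventuallyEq_of_mem h2 self_mem_Ici⟩

/-- Both one-sided models are smooth on full neighbourhoods of `s`, so only `s` itself can be a
break point nearby. Break points are therefore isolated, hence finite in number on compact
intervals. -/
theorem IsPiecewiseFutureAt.eventually_contMDiffAt {s : ℝ} (h : g.IsPiecewiseFutureAt F γ s) :
    ∀ᶠ t in 𝓝[≠] s, ContMDiffAt 𝓘(ℝ, ℝ) (𝓡 (d + 1)) ∞ γ t := by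
  obtain ⟨α, β, hα, hβ, h1, h2⟩ := h
  rw [← nhdsLT_sup_nhdsGT, eventually_sup]
  constructor
  · have h3 : γ =ᶠ[𝓝[<] s] α := h1.filter_mono (nhdsWithin_mono _ Iio_subset_Iic_self)
    filter_upwards [eventually_eventually_nhdsWithin.2 h3, hα.1.filter_mono nhdsWithin_le_nhds,
      self_mem_nhdsWithin] with t ht1 ht2 ht3
    exact ht2.congr_of_eventuallyEq (by rwa [isOpen_Iio.nhdsWithin_eq ht3] at ht1)
  · have h3 : γ =ᶠ[𝓝[>] s] β := h2.filter_mono (nhdsWithin_mono _ Ioi_subset_Ici_self)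
    filter_upwards [eventually_eventually_nhdsWithin.2 h3, hβ.1.filter_mono nhdsWithin_le_nhds,
      self_mem_nhdsWithin] with t ht1 ht2 ht3
    exact ht2.congr_of_eventuallyEq (by rwa [isOpen_Ioi.nhdsWithin_eq ht3] at ht1)

theorem IsPiecewiseFutureAt.rightVelocity_mem {s : ℝ} (h : g.IsPiecewiseFutureAt F γ s) :
    rightVelocity d γ s ∈ g.cone (F.field (γ s)) := by
  obtain ⟨α, β, hα, hβ, h1, h2⟩ := h
  have e1 : γ s = β s := h2.self_of_nhdsWithin self_mem_Ici
  have e2 := Filter.EventuallyEq.mfderivWithin_eq (I := 𝓘(ℝ, ℝ)) (I' := 𝓡 (d + 1)) h2 e1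
  have e3 := mfderivWithin_eq_mfderiv (I := 𝓘(ℝ, ℝ)) (I' := 𝓡 (d + 1))
    ((uniqueDiffWithinAt_Ici s).uniqueMDiffWithinAt)
    (hβ.contMDiffAt.mdifferentiableAt (by simp))
  have key : ∀ (x y : M) (_ : x = y) (v : EuclideanSpace ℝ (Fin (d + 1))),
      (v : TangentSpace (𝓡 (d + 1)) x) ∈ g.cone (F.field x) →
      (v : TangentSpace (𝓡 (d + 1)) y) ∈ g.cone (F.field y) := by
    rintro x _ rfl v hv
    exact hv
  rw [rightVelocity, e2, e3]
  exact key _ _ e1.symm _ hβ.2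

theorem IsPiecewiseFutureAt.leftVelocity_mem {s : ℝ} (h : g.IsPiecewiseFutureAt F γ s) :
    leftVelocity d γ s ∈ g.cone (F.field (γ s)) := by
  obtain ⟨α, β, hα, hβ, h1, h2⟩ := h
  have e1 : γ s = α s := h1.self_of_nhdsWithin self_mem_Iic
  have e2 := Filter.EventuallyEq.mfderivWithin_eq (I := 𝓘(ℝ, ℝ)) (I' := 𝓡 (d + 1)) h1 e1
  have e3 := mfderivWithin_eq_mfderiv (I := 𝓘(ℝ, ℝ)) (I' := 𝓡 (d + 1))
    ((uniqueDiffWithinAt_Iic s).uniqueMDiffWithinAt)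
    (hα.contMDiffAt.mdifferentiableAt (by simp))
  have key : ∀ (x y : M) (_ : x = y) (v : EuclideanSpace ℝ (Fin (d + 1))),
      (v : TangentSpace (𝓡 (d + 1)) x) ∈ g.cone (F.field x) →
      (v : TangentSpace (𝓡 (d + 1)) y) ∈ g.cone (F.field y) := by
    rintro x _ rfl v hv
    exact hv
  rw [leftVelocity, e2, e3]
  exact key _ _ e1.symm _ hα.2

theorem IsFutureCurve.isPiecewiseSmoothCurveOn (h : g.IsFutureCurve F N γ J) :
    IsPiecewiseSmoothCurveOn d γ J := by
  refine ⟨fun s hs ↦ (h.piecewiseFuture s hs).continuousAt.continuousWithinAt,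
    {s | s ∈ J ∧ ¬ ContMDiffAt 𝓘(ℝ, ℝ) (𝓡 (d + 1)) ∞ γ s}, ?_, ?_⟩
  · intro a ha b hb
    refine isCompact_Icc.induction_on (p := fun S ↦
      ({s | s ∈ J ∧ ¬ ContMDiffAt 𝓘(ℝ, ℝ) (𝓡 (d + 1)) ∞ γ s} ∩ S).Finite) (by simp)
      (fun s t hst ht ↦ ht.subset (inter_subset_inter_right _ hst))
      (fun s t hs ht ↦ by rw [inter_union_distrib_left]; exact hs.union ht) ?_
    intro s hs
    have hsJ : s ∈ J := h.ordConnected.out ha hb hs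
    have := (h.piecewiseFuture s hsJ).eventually_contMDiffAt
    rw [eventually_nhdsWithin_iff] at this
    refine ⟨_, mem_nhdsWithin_of_mem_nhds this, (finite_singleton s).subset ?_⟩
    rintro t ⟨⟨-, h1⟩, h2⟩
    by_contra h3
    exact h1 (h2 h3)
  · intro a b hab hJ hdisj t ht
    rcases ht.1.eq_or_lt with rfl | h1
    · obtain ⟨α, β, -, hβ, -, h2⟩ := h.piecewiseFuture a (hJ ht)
      exact hβ.contMDiffAt.contMDiffWithinAt.congr_of_eventuallyEq
        (h2.filter_mono (nhdsWithin_mono _ Icc_subset_Ici_self)) (h2.self_of_nhdsWithin self_mem_Ici)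
    rcases ht.2.eq_or_lt with rfl | h1'
    · obtain ⟨α, β, hα, -, h2, -⟩ := h.piecewiseFuture t (hJ ht)
      exact hα.contMDiffAt.contMDiffWithinAt.congr_of_eventuallyEq
        (h2.filter_mono (nhdsWithin_mono _ Icc_subset_Iic_self)) (h2.self_of_nhdsWithin self_mem_Iic)
    · by_contra hn
      exact disjoint_left.1 hdisj ⟨h1, h1'⟩ ⟨hJ ht, fun hc ↦ hn hc.contMDiffWithinAt⟩

theorem IsFutureCurve.isTimelikeCurveOn (h : g.IsFutureCurve F N γ J)
    (hF : ∀ x ∈ N, g.IsTimelike (F.field x)) : g.IsTimelikeCurveOn γ J where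
  ordConnected := h.ordConnected
  nontrivial := by
    obtain ⟨s, hs⟩ := h.nonempty
    obtain ⟨ε, hε, hb⟩ := Metric.isOpen_iff.1 h.isOpen s hs
    refine ⟨s, hs, s + ε / 2, hb ?_, by linarith⟩
    rw [Metric.mem_ball, Real.dist_eq, add_sub_cancel_left, abs_of_pos (half_pos hε)]
    exact half_lt_self hε
  piecewiseSmooth := h.isPiecewiseSmoothCurveOn
  timelike_right s hs _ := (h.piecewiseFuture s hs).rightVelocity_mem.1
  timelike_left s hs _ := (h.piecewiseFuture s hs).leftVelocity_mem.1
  sameTimecone s hs _ _ :=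
    ⟨(h.piecewiseFuture s hs).leftVelocity_mem.1, (h.piecewiseFuture s hs).rightVelocity_mem.1,
      g.form_neg_of_mem_cone (hF _ (h.mapsTo hs)) (h.piecewiseFuture s hs).leftVelocity_mem
        (h.piecewiseFuture s hs).rightVelocity_mem⟩

theorem IsInextendibleFutureCurve.isInextendibleTimelikeCurveOn
    (h : g.IsInextendibleFutureCurve F N γ J) (hF : ∀ x ∈ N, g.IsTimelike (F.field x)) :
    g.IsInextendibleTimelikeCurveOn N γ J :=
  ⟨h.toIsFutureCurve.isTimelikeCurveOn hF, h.mapsTo,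
    fun ⟨q, hq, hlim⟩ ↦ h.not_hasFutureLimit q hq (hasFutureLimit_of_tendsto h.nonempty hlim),
    fun ⟨q, hq, hlim⟩ ↦ h.not_hasPastLimit q hq (hasPastLimit_of_tendsto h.nonempty hlim)⟩

theorem IsPiecewiseFutureAt.joinAt {b s : ℝ} (hb : γ₁ b = γ₂ b)
    (h₁ : s ≤ b → g.IsPiecewiseFutureAt F γ₁ s) (h₂ : b ≤ s → g.IsPiecewiseFutureAt F γ₂ s) :
    g.IsPiecewiseFutureAt F (joinAt b γ₁ γ₂) s := by
  rcases lt_trichotomy s b with h | rfl | h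
  · refine (h₁ h.le).congr ?_
    filter_upwards [Iio_mem_nhds h] with t ht
    exact joinAt_of_le (le_of_lt ht)
  · refine (h₁ le_rfl).glue (h₂ le_rfl) ?_ ?_
    · filter_upwards [self_mem_nhdsWithin] with t ht
      exact joinAt_of_le ht
    · filter_upwards [self_mem_nhdsWithin] with t ht
      exact joinAt_of_ge hb ht
  · refine (h₂ h.le).congr ?_
    filter_upwards [Ioi_mem_nhds h] with t ht
    exact joinAt_of_ge hb (le_of_lt ht)

theorem IsFutureCurve.joinAt {b : ℝ} (hJ₁ : IsOpen J₁) (hJ₂ : IsOpen J₂) (hc₁ : J₁.OrdConnected)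
    (hc₂ : J₂.OrdConnected) (hb₁ : b ∈ J₁) (hb₂ : b ∈ J₂) (hb : γ₁ b = γ₂ b)
    (h₁ : ∀ s ∈ J₁, s ≤ b → γ₁ s ∈ N ∧ g.IsPiecewiseFutureAt F γ₁ s)
    (h₂ : ∀ s ∈ J₂, b ≤ s → γ₂ s ∈ N ∧ g.IsPiecewiseFutureAt F γ₂ s) :
    g.IsFutureCurve F N (joinAt b γ₁ γ₂) (joinDomain b J₁ J₂) where
  isOpen := by
    rw [isOpen_iff_mem_nhds]
    intro s hs
    rcases lt_trichotomy s b with h | rfl | h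
    · have : s ∈ J₁ := hs.elim (·.1) fun h' ↦ absurd h'.2 h.not_ge
      filter_upwards [hJ₁.mem_nhds this, Iio_mem_nhds h] with t ht ht'
      exact Or.inl ⟨ht, Iio_subset_Iic_self ht'⟩
    · filter_upwards [hJ₁.mem_nhds hb₁, hJ₂.mem_nhds hb₂] with t ht ht'
      exact (le_total t s).imp (fun h ↦ ⟨ht, h⟩) fun h ↦ ⟨ht', h⟩
    · have : s ∈ J₂ := hs.elim (fun h' ↦ absurd h'.2 h.not_ge) (·.1)
      filter_upwards [hJ₂.mem_nhds this, Ioi_mem_nhds h] with t ht ht'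
      exact Or.inr ⟨ht, Ioi_subset_Ici_self ht'⟩
  ordConnected := by
    refine ⟨fun x hx y hy z hz ↦ ?_⟩
    rcases le_total z b with h | h
    · refine Or.inl ⟨?_, h⟩
      have hx' : x ∈ J₁ := hx.elim (·.1) fun h' ↦ by
        rwa [le_antisymm (hz.1.trans h) h'.2]
      exact hc₁.out hx' hb₁ ⟨hz.1, h⟩
    · refine Or.inr ⟨?_, h⟩
      have hy' : y ∈ J₂ := hy.elim (fun h' ↦ by
        rwa [← le_antisymm (h.trans hz.2) h'.2]) (·.1)
      exact hc₂.out hb₂ hy' ⟨h, hz.2⟩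
  nonempty := ⟨b, Or.inl ⟨hb₁, self_mem_Iic⟩⟩
  mapsTo := by
    rintro s (hs | hs)
    · rw [joinAt_of_le hs.2]; exact (h₁ s hs.1 hs.2).1
    · rw [joinAt_of_ge hb hs.2]; exact (h₂ s hs.1 hs.2).1
  piecewiseFuture s hs := by
    refine IsPiecewiseFutureAt.joinAt hb (fun h ↦ (h₁ s ?_ h).2)
      fun h ↦ (h₂ s ?_ h).2
    · exact hs.elim (·.1) fun h' ↦ by rwa [le_antisymm h h'.2]
    · exact hs.elim (fun h' ↦ by rwa [← le_antisymm h h'.2]) (·.1)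

/-- The joined curve ends like its second piece, so a join whose outer pieces are inextendible flow
lines is inextendible. -/
theorem _root_.HasFutureLimit.of_join {b : ℝ} {q : M} (hb₂ : b ∈ J₂) (hb : γ₁ b = γ₂ b)
    (h : HasFutureLimit (joinAt b γ₁ γ₂) (joinDomain b J₁ J₂) q) : HasFutureLimit γ₂ J₂ q := by
  intro W hW
  obtain ⟨a, ha, haW⟩ := h W hW
  have : max a b ∈ J₂ := by
    rcases le_total a b with h | h
    · rwa [max_eq_right h]
    · rw [max_eq_left h]
      exact ha.elim (fun h' ↦ by rwa [← le_antisymm h h'.2]) (·.1)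
  refine ⟨max a b, this, fun s hs has ↦ ?_⟩
  have hbs := (le_max_right _ _).trans has
  rw [← joinAt_of_ge hb hbs]
  exact haW s (Or.inr ⟨hs, hbs⟩) ((le_max_left _ _).trans has)

theorem _root_.HasPastLimit.of_join {b : ℝ} {q : M} (hb₁ : b ∈ J₁)
    (h : HasPastLimit (joinAt b γ₁ γ₂) (joinDomain b J₁ J₂) q) : HasPastLimit γ₁ J₁ q := by
  intro W hW
  obtain ⟨a, ha, haW⟩ := h W hW
  have : min a b ∈ J₁ := by
    rcases le_total a b with h | h
    · rw [min_eq_left h]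
      exact ha.elim (·.1) fun h' ↦ by rwa [le_antisymm h h'.2]
    · rwa [min_eq_right h]
  refine ⟨min a b, this, fun s hs has ↦ ?_⟩
  have hbs := has.trans (min_le_right _ _)
  rw [← joinAt_of_le (γ₁ := γ₁) (γ₂ := γ₂) hbs]
  exact haW s (Or.inl ⟨hs, hbs⟩) (has.trans (min_le_left _ _))

end LorentzianMetric

end FutureCurves

/-! ### Flow lines as inextendible timelike curves -/

section FlowCurves

variable {d : ℕ} {M : Type*} [TopologicalSpace M]
  [ChartedSpace (EuclideanSpace ℝ (Fin (d + 1))) M] [IsManifold (𝓡 (d + 1)) ∞ M]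

/-- The maximal interval around `b` on which the flow line through `p` at time `b` stays in `N`. -/
def SmoothFlow.domain (F : SmoothFlow (EuclideanSpace ℝ (Fin (d + 1))) M) (N : Set M) (b : ℝ)
    (p : M) : Set ℝ := {s | ∀ r ∈ uIcc b s, F.map (r - b) p ∈ N}

namespace SmoothFlow

variable {F : SmoothFlow (EuclideanSpace ℝ (Fin (d + 1))) M} {N : Set M} {b : ℝ} {p : M}

theorem continuous_curve (F : SmoothFlow (EuclideanSpace ℝ (Fin (d + 1))) M) (b : ℝ) (p : M) :
    Continuous fun s ↦ F.map (s - b) p :=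
  F.continuous_map.comp ((continuous_sub_right b).prodMk continuous_const)

theorem continuous_map_time (F : SmoothFlow (EuclideanSpace ℝ (Fin (d + 1))) M) (t : ℝ) :
    Continuous (F.map t) :=
  F.continuous_map.comp (continuous_const.prodMk continuous_id)

theorem mem_domain_self (hp : p ∈ N) : b ∈ F.domain N b p := by
  intro r hr
  rw [uIcc_self, mem_singleton_iff] at hr
  rwa [hr, sub_self, F.map_zero]

theorem map_mem_of_mem_domain {s : ℝ} (hs : s ∈ F.domain N b p) : F.map (s - b) p ∈ N :=
  hs s right_mem_uIcc

theorem mem_domain_of_le {s : ℝ} (hbs : b ≤ s) :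
    s ∈ F.domain N b p ↔ ∀ r ∈ Icc b s, F.map (r - b) p ∈ N := by
  rw [domain, Set.mem_ofPred_eq, uIcc_of_le hbs]

theorem ordConnected_domain : (F.domain N b p).OrdConnected := by
  refine ⟨fun x hx y hy z hz r hr ↦ ?_⟩
  rcases le_total b z with h | h
  · rw [uIcc_of_le h] at hr
    exact hy r (by rw [uIcc_of_le (h.trans hz.2)]; exact ⟨hr.1, hr.2.trans hz.2⟩)
  · rw [uIcc_of_ge h] at hr
    exact hx r (by rw [uIcc_of_ge (hz.1.trans h)]; exact ⟨hz.1.trans hr.1, hr.2⟩)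

theorem isOpen_domain (hN : IsOpen N) : IsOpen (F.domain N b p) := by
  rw [Metric.isOpen_iff]
  intro s hs
  obtain ⟨ε, hε, hball⟩ := Metric.isOpen_iff.1 (hN.preimage (F.continuous_curve b p)) s
    (map_mem_of_mem_domain hs)
  refine ⟨ε, hε, fun s' hs' r hr ↦ ?_⟩
  rcases uIcc_subset_uIcc_union_uIcc (b := s) hr with h | h
  · exact hs r h
  · have hc : (Metric.ball s ε).OrdConnected := by rw [Real.ball_eq_Ioo]; exact ordConnected_Ioo
    exact hball (hc.uIcc_subset (Metric.mem_ball_self hε) hs' h)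

theorem domain_reverse : F.reverse.domain N (-b) p = -F.domain N b p := by
  ext s
  simp only [domain, Set.mem_neg, Set.mem_ofPred_eq, reverse_map]
  constructor
  · intro h r hr
    have := h (-r) (by
      rw [mem_uIcc] at hr ⊢
      rcases hr with hr | hr
      · right; constructor <;> linarith
      · left; constructor <;> linarith)
    convert this using 2
    ring
  · intro h r hr
    have := h (-r) (by
      rw [mem_uIcc] at hr ⊢
      rcases hr with hr | hr
      · right; constructor <;> linarith
      · left; constructor <;> linarith)
    convert this using 2
    ring

/-- A flow line of a field without zeros in `N` has no limit in `N` at the end of its domain. -/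
theorem not_hasFutureLimit [T2Space M] (hN : IsOpen N) (hF : ∀ x ∈ N, F.field x ≠ 0) (hp : p ∈ N)
    {q : M} (hq : q ∈ N) : ¬ HasFutureLimit (fun s ↦ F.map (s - b) p) (F.domain N b p) q := by
  intro hlim
  have hbJ : b ∈ F.domain N b p := mem_domain_self hp
  -- If the domain is bounded above, the limit is the flow point at the supremum `c`; as it lies in
  -- `N`, the open domain would contain `c` and more. If it is unbounded, the limit is a fixed point
  -- of the flow, where the field would vanish.
  by_cases hbdd : BddAbove (F.domain N b p)
  · set c := sSup (F.domain N b p) with hc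
    have hle : ∀ s ∈ F.domain N b p, s ≤ c := fun s hs ↦ le_csSup hbdd hs
    have hqc : F.map (c - b) p = q := by
      by_contra hne
      obtain ⟨V, W, hV, hW, hcV, hqW, hd⟩ := t2_separation hne
      obtain ⟨a, ha, haW⟩ := hlim W (hW.mem_nhds hqW)
      have hev := (F.continuous_curve b p).continuousAt.preimage_mem_nhds (x := c) (hV.mem_nhds hcV)
      obtain ⟨ε, hε, hball⟩ := Metric.mem_nhds_iff.1 hev
      obtain ⟨s, hs, hsc⟩ := exists_lt_of_lt_csSup ⟨b, hbJ⟩ (show c - ε < sSup _ by linarith)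
      have hm : max s a ∈ F.domain N b p := by
        rcases max_choice s a with h | h <;> rw [h] <;> assumption
      refine disjoint_left.1 hd (hball ?_) (haW _ hm (le_max_right _ _))
      rw [Real.ball_eq_Ioo]
      exact ⟨hsc.trans_le (le_max_left _ _), (hle _ hm).trans_lt (by linarith)⟩
    have hcJ : c ∈ F.domain N b p := by
      rw [mem_domain_of_le (hle b hbJ)]
      intro r hr
      rcases hr.2.eq_or_lt with rfl | hrc
      · rwa [hqc]
      · obtain ⟨s, hs, hrs⟩ := exists_lt_of_lt_csSup ⟨b, hbJ⟩ hrc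
        exact map_mem_of_mem_domain (ordConnected_domain.out hbJ hs ⟨hr.1, hrs.le⟩)
    obtain ⟨ε, hε, hball⟩ := Metric.isOpen_iff.1 (isOpen_domain hN) c hcJ
    have := hle _ (hball (show c + ε / 2 ∈ Metric.ball c ε by
      rw [Real.ball_eq_Ioo]; constructor <;> linarith))
    linarith
  · have hunb : ∀ s ∈ F.domain N b p, ∀ u ≥ 0, s + u ∈ F.domain N b p := by
      intro s hs u hu
      obtain ⟨y, hy, hlt⟩ := not_bddAbove_iff.1 hbdd (s + u)
      exact ordConnected_domain.out hs hy ⟨by linarith, hlt.le⟩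
    have hfix : ∀ u ≥ 0, F.map u q = q := by
      intro u hu
      by_contra hne
      obtain ⟨V, W, hV, hW, huV, hqW, hd⟩ := t2_separation hne
      obtain ⟨a, ha, haW⟩ := hlim _ (inter_mem (hW.mem_nhds hqW)
        ((F.continuous_map_time u).continuousAt.preimage_mem_nhds (hV.mem_nhds huV)))
      refine disjoint_left.1 hd (haW a ha le_rfl).2 ?_
      have := (haW (a + u) (hunb a ha u hu) (by linarith)).1
      simpa only [← F.map_add, show u + (a - b) = a + u - b by ring] using this
    have h1 : (fun t ↦ F.map t q) =ᶠ[𝓝 1] fun _ ↦ q := by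
      filter_upwards [Ioi_mem_nhds (zero_lt_one' ℝ)] with t ht
      exact hfix t (le_of_lt ht)
    have h2 := F.mfderiv_curve q 1
    rw [h1.mfderiv_eq, mfderiv_const, hfix 1 zero_le_one] at h2
    exact hF q hq h2.symm

theorem not_hasPastLimit [T2Space M] (hN : IsOpen N) (hF : ∀ x ∈ N, F.field x ≠ 0) (hp : p ∈ N)
    {q : M} (hq : q ∈ N) : ¬ HasPastLimit (fun s ↦ F.map (s - b) p) (F.domain N b p) q := by
  intro hlim
  refine F.reverse.not_hasFutureLimit (b := -b) hN
    (fun x hx ↦ by rw [reverse_field]; exact neg_ne_zero.2 (hF x hx)) hp hq fun W hW ↦ ?_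
  obtain ⟨a, ha, haW⟩ := hlim W hW
  rw [domain_reverse]
  refine ⟨-a, by simpa using ha, fun s hs has ↦ ?_⟩
  have h1 : F.map (-s - b) p ∈ W := haW (-s) hs (by linarith)
  change F.reverse.map (s - -b) p ∈ W
  rwa [reverse_map, show -(s - -b) = -s - b by ring]

theorem isFutureAt_curve {g : LorentzianMetric d M} {s : ℝ}
    (h : g.IsTimelike (F.field (F.map (s - b) p))) :
    g.IsFutureAt F (fun s ↦ F.map (s - b) p) s := by
  have h0 : g.IsFutureAt F (fun s ↦ F.map s p) (s + -b) := by
    refine ⟨Eventually.of_forall fun t ↦ F.contMDiff_curve p t, ?_⟩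
    rw [F.mfderiv_curve]
    exact ⟨h, h⟩
  exact h0.comp_add (-b)

theorem isInextendibleFutureCurve [T2Space M] {g : LorentzianMetric d M} (hN : IsOpen N)
    (hF : ∀ x ∈ N, g.IsTimelike (F.field x)) (hp : p ∈ N) :
    g.IsInextendibleFutureCurve F N (fun s ↦ F.map (s - b) p) (F.domain N b p) := by
  have hne : ∀ x ∈ N, F.field x ≠ 0 := by
    intro x hx h0
    have := hF x hx
    simp [LorentzianMetric.IsTimelike, h0] at this
  exact { isOpen := isOpen_domain hN
          ordConnected := ordConnected_domain
          nonempty := ⟨b, mem_domain_self hp⟩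
          mapsTo := fun s hs ↦ map_mem_of_mem_domain hs
          piecewiseFuture := fun s hs ↦
            (isFutureAt_curve (hF _ (map_mem_of_mem_domain hs))).isPiecewiseFutureAt
          not_hasFutureLimit := fun q hq ↦ not_hasFutureLimit hN hne hp hq
          not_hasPastLimit := fun q hq ↦ not_hasPastLimit hN hne hp hq }

end SmoothFlow

/-- The velocity map of a `C^1` map from an open subset of a normed space is continuous. -/
theorem continuousOn_mk_mfderiv {G : Type*} [NormedAddCommGroup G] [NormedSpace ℝ G] {f : G → M}
    {U : Set G} (hU : IsOpen U) (hf : ContMDiffOn 𝓘(ℝ, G) (𝓡 (d + 1)) 1 f U) :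
    ContinuousOn (fun p : G × G ↦
      (⟨f p.1, mfderiv 𝓘(ℝ, G) (𝓡 (d + 1)) f p.1 p.2⟩ : TangentBundle (𝓡 (d + 1)) M))
      (U ×ˢ univ) := by
  have : IsManifold (𝓡 (d + 1)) 1 M := IsManifold.of_le (n := ∞) (by simp)
  have h1 := hf.continuousOn_tangentMapWithin le_rfl hU.uniqueMDiffOn
  have h2 : Continuous fun p : G × G ↦ (⟨p.1, p.2⟩ : TangentBundle 𝓘(ℝ, G) G) :=
    (tangentBundleModelSpaceHomeomorph 𝓘(ℝ, G)).symm.continuous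
  refine (h1.comp h2.continuousOn (t := Bundle.TotalSpace.proj ⁻¹' U)
    (fun p hp ↦ hp.1)).congr fun p hp ↦ ?_
  simp only [Function.comp_apply, tangentMapWithin, mfderivWithin_of_isOpen hU hp.1]

end FlowCurves

/-! ### Causality relative to a Cauchy hypersurface -/

section CauchyFlow

variable {d : ℕ} {M : Type*} [TopologicalSpace M]
  [ChartedSpace (EuclideanSpace ℝ (Fin (d + 1))) M] [IsManifold (𝓡 (d + 1)) ∞ M]

theorem SmoothFlow.continuous_mk_field (F : SmoothFlow (EuclideanSpace ℝ (Fin (d + 1))) M) :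
    Continuous fun x ↦ (⟨x, F.field x⟩ : TangentBundle (𝓡 (d + 1)) M) :=
  F.contMDiff_field.continuous

namespace LorentzianMetric

variable {g : LorentzianMetric d M} {F : SmoothFlow (EuclideanSpace ℝ (Fin (d + 1))) M}
  {N S : Set M} {γ α η : ℝ → M} {J : Set ℝ}

/-- Timelikeness of the derivative of a smooth map in a given direction is an open condition. -/
theorem eventually_mfderiv_mem_cone {G : Type*} [NormedAddCommGroup G] [NormedSpace ℝ G] {f : G → M}
    {p v : G} (hf : ∀ᶠ q in 𝓝 p, ContMDiffAt 𝓘(ℝ, G) (𝓡 (d + 1)) ∞ f q)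
    (h : mfderiv 𝓘(ℝ, G) (𝓡 (d + 1)) f p v ∈ g.cone (F.field (f p))) :
    ∀ᶠ q : G × G in 𝓝 (p, v),
      mfderiv 𝓘(ℝ, G) (𝓡 (d + 1)) f q.1 q.2 ∈ g.cone (F.field (f q.1)) := by
  obtain ⟨U, hU, hUo, hpU⟩ := eventually_nhds_iff.1 hf
  have h1 := continuousOn_mk_mfderiv (f := f) hUo
    fun t ht ↦ ((hU t ht).of_le (by simp)).contMDiffWithinAt
  have h2 := h1.continuousAt ((hUo.prod isOpen_univ).mem_nhds (⟨hpU, mem_univ _⟩ :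
      (p, v) ∈ U ×ˢ univ))
  have h3 : ContinuousAt (fun q : G × G ↦
      (⟨f q.1, F.field (f q.1)⟩ : TangentBundle (𝓡 (d + 1)) M)) (p, v) :=
    F.continuous_mk_field.continuousAt.comp
      (f := fun q : G × G ↦ f q.1) (hf.self_of_nhds.continuousAt.comp continuousAt_fst)
  filter_upwards [(g.continuousAt_form h2 h2).eventually_lt_const h.1,
    (g.continuousAt_form h2 h3).eventually_lt_const h.2] with t ht2 ht3
  exact ⟨ht2, ht3⟩

theorem IsFutureAt.eventually {s : ℝ} (h : g.IsFutureAt F α s) :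
    ∀ᶠ t in 𝓝 s, g.IsFutureAt F α t := by
  have h1 : ContinuousAt (fun t : ℝ ↦ (t, (1 : ℝ))) s := by fun_prop
  filter_upwards [eventually_eventually_nhds.2 h.1,
    h1.eventually (eventually_mfderiv_mem_cone h.1 h.2)] with t ht1 ht2
  exact ⟨ht1, ht2⟩

omit [IsManifold (𝓡 (d + 1)) ∞ M] in
/-- The chain rule for the velocity of the image of a curve. -/
theorem mfderiv_comp_of_hasDerivAt {G : Type*} [NormedAddCommGroup G] [NormedSpace ℝ G] {f : G → M}
    {L : ℝ → G} {v : G} {s : ℝ} (hL : HasDerivAt L v s)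
    (hf : ContMDiffAt 𝓘(ℝ, G) (𝓡 (d + 1)) ∞ f (L s)) :
    mfderiv 𝓘(ℝ, ℝ) (𝓡 (d + 1)) (fun t ↦ f (L t)) s (1 : ℝ) =
      mfderiv 𝓘(ℝ, G) (𝓡 (d + 1)) f (L s) v := by
  have h1 : HasMFDerivAt 𝓘(ℝ, G) (𝓡 (d + 1)) f (L s) (mfderiv 𝓘(ℝ, G) (𝓡 (d + 1)) f (L s)) :=
    (hf.mdifferentiableAt (by simp)).hasMFDerivAt
  have h3 := (h1.comp s hL.hasFDerivAt.hasMFDerivAt).mfderiv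
  have h4 : mfderiv 𝓘(ℝ, ℝ) (𝓡 (d + 1)) (fun t ↦ f (L t)) s (1 : ℝ) =
      mfderiv 𝓘(ℝ, G) (𝓡 (d + 1)) f (L s) ((1 : ℝ) • v) := DFunLike.congr_fun h3 (1 : ℝ)
  rw [h4, one_smul]

theorem _root_.hasDerivAt_of_eq_line {G : Type*} [NormedAddCommGroup G] [NormedSpace ℝ G]
    {L : ℝ → G} {v : G} {s : ℝ} (hL : ∀ t, L t = L s + (t - s) • v) : HasDerivAt L v s := by
  rw [show L = fun t ↦ L s + (t - s) • v from funext hL]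
  simpa using (((hasDerivAt_id s).sub_const s).smul_const v).const_add (L s)

/-- The image of a straight line under a smooth map is a future curve if its velocity is. -/
theorem isFutureAt_line {G : Type*} [NormedAddCommGroup G] [NormedSpace ℝ G] {f : G → M}
    {L : ℝ → G} {v : G} {s : ℝ} (hL : ∀ t, L t = L s + (t - s) • v)
    (hf : ∀ᶠ q in 𝓝 (L s), ContMDiffAt 𝓘(ℝ, G) (𝓡 (d + 1)) ∞ f q)
    (h : mfderiv 𝓘(ℝ, G) (𝓡 (d + 1)) f (L s) v ∈ g.cone (F.field (f (L s)))) :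
    g.IsFutureAt F (fun t ↦ f (L t)) s := by
  have hL' : ContDiff ℝ ∞ L := by
    rw [show L = fun t ↦ L s + (t - s) • v from funext hL]
    fun_prop
  refine ⟨?_, ?_⟩
  · filter_upwards [hL'.continuous.continuousAt.eventually hf] with t ht
    exact ContMDiffAt.comp t (g := f) ht hL'.contMDiff.contMDiffAt
  · rw [mfderiv_comp_of_hasDerivAt (hasDerivAt_of_eq_line hL) hf.self_of_nhds]
    exact h

variable (g F N S) in
/-- `S` is a Cauchy hypersurface of the open set `N`, and the flow `F` is timelike on `N`. -/
structure IsCauchyFlow : Prop where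
  isOpen : IsOpen N
  timelike : ∀ x ∈ N, g.IsTimelike (F.field x)
  cauchy : g.IsCauchyHypersurface N S

namespace IsCauchyFlow

theorem reverse (h : g.IsCauchyFlow F N S) : g.IsCauchyFlow F.reverse N S where
  isOpen := h.isOpen
  cauchy := h.cauchy
  timelike x hx := by
    have := h.timelike x hx
    rw [IsTimelike] at this ⊢
    rw [SmoothFlow.reverse_field]
    simpa using this

theorem existsUnique (h : g.IsCauchyFlow F N S) (hγ : g.IsInextendibleFutureCurve F N γ J) :
    ∃! s, s ∈ J ∧ γ s ∈ S :=
  h.cauchy.meets_once J γ (hγ.isInextendibleTimelikeCurveOn h.timelike)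

variable [T2Space M]

theorem flowCurve (h : g.IsCauchyFlow F N S) {p : M} (hp : p ∈ N) (b : ℝ) :
    g.IsInextendibleFutureCurve F N (fun s ↦ F.map (s - b) p) (F.domain N b p) :=
  SmoothFlow.isInextendibleFutureCurve h.isOpen h.timelike hp

/-- A flow line that starts on `S` does not return to `S` while it stays in `N`. -/
theorem map_notMem (h : g.IsCauchyFlow F N S) {x : M} (hx : x ∈ S) {t : ℝ} (ht : 0 < t)
    (hN : ∀ r ∈ Icc 0 t, F.map r x ∈ N) : F.map t x ∉ S := by
  intro htS
  refine ht.ne' ((h.existsUnique (h.flowCurve (h.cauchy.subset hx) 0)).unique (y₁ := t) (y₂ := 0)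
    ⟨?_, ?_⟩ ⟨SmoothFlow.mem_domain_self (h.cauchy.subset hx), ?_⟩)
  · rw [SmoothFlow.mem_domain_of_le ht.le]
    simpa using hN
  · simpa using htS
  · simpa [F.map_zero] using hx

/-- No timelike curve stays in a Cauchy hypersurface. -/
theorem not_eventually_mem (h : g.IsCauchyFlow F N S) {s : ℝ} (hα : g.IsFutureAt F α s) :
    ¬ ∀ᶠ t in 𝓝 s, α t ∈ S := by
  intro hev
  obtain ⟨ε, hε, hball⟩ := Metric.eventually_nhds_iff_ball.1 (hev.and hα.eventually)
  have hord : (Metric.ball s ε).OrdConnected := by rw [Real.ball_eq_Ioo]; exact ordConnected_Ioo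
  set b := s + ε / 2
  set a := s - ε / 2
  have hab : a < b := by simp only [a, b]; linarith
  have hb : b ∈ Metric.ball s ε := by
    rw [Metric.mem_ball, Real.dist_eq, abs_lt]; constructor <;> simp only [b] <;> linarith
  have ha : a ∈ Metric.ball s ε := by
    rw [Metric.mem_ball, Real.dist_eq, abs_lt]; constructor <;> simp only [a] <;> linarith
  have hbN := h.cauchy.subset (hball b hb).1
  have haN := h.cauchy.subset (hball a ha).1
  -- The piece of `α` between `a` and `b` is prolonged by flow lines at both ends. The result is an
  -- inextendible timelike curve that meets `S` at `a` and again at `b`.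
  have f2 := h.flowCurve hbN b
  have f1 := h.flowCurve haN a
  have eb : α b = (fun s ↦ F.map (s - b) (α b)) b := by simp [F.map_zero]
  have ea : (fun s ↦ F.map (s - a) (α a)) a = α a := by simp [F.map_zero]
  have ea' : (fun s ↦ F.map (s - a) (α a)) a = joinAt b α (fun s ↦ F.map (s - b) (α b)) a := by
    rw [joinAt_of_le hab.le, ea]
  have j1 := IsFutureCurve.joinAt Metric.isOpen_ball f2.isOpen hord f2.ordConnected hb
    (SmoothFlow.mem_domain_self hbN) eb
    (fun t ht _ ↦ ⟨h.cauchy.subset (hball t ht).1, (hball t ht).2.isPiecewiseFutureAt⟩)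
    fun t ht _ ↦ ⟨f2.mapsTo ht, f2.piecewiseFuture t ht⟩
  have j2 := IsFutureCurve.joinAt f1.isOpen j1.isOpen f1.ordConnected j1.ordConnected
    (SmoothFlow.mem_domain_self haN) (Or.inl ⟨ha, hab.le⟩) ea'
    (fun t ht _ ↦ ⟨f1.mapsTo ht, f1.piecewiseFuture t ht⟩)
    fun t ht _ ↦ ⟨j1.mapsTo ht, j1.piecewiseFuture t ht⟩
  have j3 : g.IsInextendibleFutureCurve F N _ _ :=
    ⟨j2, fun q hq hl ↦ f2.not_hasFutureLimit q hq
        (.of_join (SmoothFlow.mem_domain_self hbN) eb (.of_join (Or.inl ⟨ha, hab.le⟩) ea' hl)),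
      fun q hq hl ↦ f1.not_hasPastLimit q hq (.of_join (SmoothFlow.mem_domain_self haN) hl)⟩
  refine hab.ne ((h.existsUnique j3).unique ⟨Or.inl ⟨SmoothFlow.mem_domain_self haN, self_mem_Iic⟩, ?_⟩
    ⟨Or.inr ⟨Or.inl ⟨hb, self_mem_Iic⟩, hab.le⟩, ?_⟩)
  · rw [joinAt_of_le le_rfl]
    have := (hball a ha).1
    rwa [← ea] at this
  · rw [joinAt_of_ge ea' hab.le, joinAt_of_le le_rfl]
    exact (hball b hb).1

/-- A future curve that avoids `S` and ends in the future of `S` stays in `N`. -/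
theorem mem_of_avoids (h : g.IsCauchyFlow F N S) {x : M} (hx : x ∈ S) {t : ℝ} (ht : 0 < t)
    (hN : ∀ r ∈ Icc 0 t, F.map r x ∈ N) {a b : ℝ} (hη : ∀ s ∈ Icc a b, g.IsPiecewiseFutureAt F η s)
    (hηS : ∀ s ∈ Icc a b, η s ∉ S) (hb : η b = F.map t x) : ∀ s ∈ Icc a b, η s ∈ N := by
  by_contra hcon
  push Not at hcon
  obtain ⟨s₁, hs₁, hs₁N⟩ := hcon
  have hbN : η b ∈ N := hb ▸ hN t ⟨ht.le, le_rfl⟩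
  have hcont : ContinuousOn η (Icc a b) := fun s hs ↦ (hη s hs).continuousAt.continuousWithinAt
  have hcpt : IsCompact (Icc a b ∩ η ⁻¹' Nᶜ) :=
    isCompact_Icc.of_isClosed_subset
      (hcont.preimage_isClosed_of_isClosed isClosed_Icc h.isOpen.isClosed_compl) inter_subset_left
  -- Let `c` be the last parameter outside `N`. The curve `η` after `c`, continued by the flow line
  -- from `η b`, is inextendible in `N`, because its only possible past limit is `η c`. The first
  -- piece avoids `S` by assumption. The second does too, since its flow line has already met `S` at
  -- `x`.
  obtain ⟨c, ⟨hc, hcN⟩, hmax⟩ := hcpt.exists_isGreatest ⟨s₁, hs₁, hs₁N⟩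
  have hcb : c < b := hc.2.lt_of_ne fun h' ↦ hcN (h' ▸ hbN)
  have hmem : ∀ s ∈ Ioi c, s ≤ b → η s ∈ N := by
    intro s hs hsb
    by_contra hsN
    exact (hmax ⟨⟨hc.1.trans (le_of_lt hs), hsb⟩, hsN⟩).not_gt hs
  have f2 := h.flowCurve hbN b
  have eb : η b = (fun s ↦ F.map (s - b) (η b)) b := by simp [F.map_zero]
  have j := IsFutureCurve.joinAt isOpen_Ioi f2.isOpen ordConnected_Ioi f2.ordConnected hcb
    (SmoothFlow.mem_domain_self hbN) eb
    (fun s hs hsb ↦ ⟨hmem s hs hsb, hη s ⟨hc.1.trans (le_of_lt hs), hsb⟩⟩)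
    fun t ht _ ↦ ⟨f2.mapsTo ht, f2.piecewiseFuture t ht⟩
  have hpast : ∀ q ∈ N, ¬ HasPastLimit (joinAt b η fun s ↦ F.map (s - b) (η b))
      (joinDomain b (Ioi c) (F.domain N b (η b))) q := by
    intro q hq hl
    have hl' : HasPastLimit η (Ioi c) q := .of_join hcb hl
    have hqc : η c = q := by
      by_contra hne
      obtain ⟨V, W, hV, hW, hcV, hqW, hd⟩ := t2_separation hne
      obtain ⟨e, he, heW⟩ := hl' W (hW.mem_nhds hqW)
      have h1 := (hη c hc).continuousAt.preimage_mem_nhds (hV.mem_nhds hcV)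
      have h2 : ∀ᶠ s in 𝓝[>] c, s ∈ Ioc c e ∧ η s ∈ V :=
        Filter.Eventually.and (Ioc_mem_nhdsGT (mem_Ioi.1 he)) (mem_nhdsWithin_of_mem_nhds h1)
      obtain ⟨s, ⟨hs1, hs2⟩, hs3⟩ := h2.exists
      exact disjoint_left.1 hd hs3 (heW s hs1 hs2)
    exact hcN (hqc ▸ hq)
  obtain ⟨s, ⟨hsJ, hsS⟩, -⟩ := h.existsUnique ⟨j, fun q hq hl ↦ f2.not_hasFutureLimit q hq
    (.of_join (SmoothFlow.mem_domain_self hbN) eb hl), hpast⟩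
  rcases hsJ with ⟨h1, h2⟩ | ⟨h1, h2⟩
  · rw [joinAt_of_le h2] at hsS
    exact hηS s ⟨hc.1.trans (le_of_lt h1), h2⟩ hsS
  · rw [joinAt_of_ge eb h2] at hsS
    rw [SmoothFlow.mem_domain_of_le h2] at h1
    simp only [hb, ← F.map_add] at h1 hsS
    refine h.map_notMem hx (t := s - b + t) (by simp only [mem_Ici] at h2; linarith)
      (fun r hr ↦ ?_) hsS
    rcases le_total r t with hrt | hrt
    · exact hN r ⟨hr.1, hrt⟩
    · have := h1 (r - t + b) ⟨by linarith, by linarith [hr.2]⟩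
      simpa using this

/-- The complement of `S` in `N` contains no closed timelike curves. -/
theorem not_closed (h : g.IsCauchyFlow F N S) {a b : ℝ} (hab : a < b)
    (hη : ∀ s ∈ Icc a b, g.IsPiecewiseFutureAt F η s) (hηN : ∀ s ∈ Icc a b, η s ∈ N)
    (hηS : ∀ s ∈ Icc a b, η s ∉ S) : η a ≠ η b := by
  intro heq
  have hP : 0 < b - a := sub_pos.2 hab
  -- The loop is run through periodically. A periodic curve with a limit is constant, which timelike
  -- velocity excludes, so `γ` is inextendible and would have to meet `S`.
  set γ : ℝ → M := fun s ↦ η (toIcoMod hP a s) with hγ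
  have hmod : ∀ s, toIcoMod hP a s ∈ Ico a b := fun s ↦ by
    simpa using toIcoMod_mem_Ico hP a s
  have hper : ∀ s, ∀ n : ℕ, γ (s + n * (b - a)) = γ s := by
    intro s n
    simp only [hγ]
    rw [← nsmul_eq_mul, toIcoMod_add_nsmul]
  have hper' : ∀ s, ∀ n : ℕ, γ (s - n * (b - a)) = γ s := by
    intro s n
    simp only [hγ]
    rw [← nsmul_eq_mul, toIcoMod_sub_nsmul]
  have hloc : ∀ s, ∀ k : ℤ, s + k * (b - a) ∈ Icc a b → γ s = η (s + k * (b - a)) := by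
    intro s k hs
    have : γ s = γ (s + k * (b - a)) := by
      simp only [hγ]
      rw [← zsmul_eq_mul, toIcoMod_add_zsmul]
    rw [this]
    rcases hs.2.eq_or_lt with h' | h'
    · rw [h', ← heq]
      simp only [hγ]
      congr 1
      rw [toIcoMod_eq_iff]
      refine ⟨⟨le_rfl, by linarith⟩, 1, by simp⟩
    · simp only [hγ]
      congr 1
      rw [toIcoMod_eq_self]
      exact ⟨hs.1, by linarith⟩
  have hfut : ∀ s, g.IsPiecewiseFutureAt F γ s := by
    intro s
    set k : ℤ := -toIcoDiv hP a s with hk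
    have hs : s + k * (b - a) ∈ Ico a b := by
      have := hmod s
      rwa [toIcoMod, zsmul_eq_mul, sub_eq_add_neg, ← neg_mul, ← Int.cast_neg] at this
    have hc : ∀ k : ℤ, ContinuousAt (fun t : ℝ ↦ t + k * (b - a)) s := fun k ↦ by fun_prop
    have hright : γ =ᶠ[𝓝[≥] s] fun t ↦ η (t + k * (b - a)) := by
      filter_upwards [mem_nhdsWithin_of_mem_nhds ((hc k).preimage_mem_nhds (Iio_mem_nhds hs.2)),
        self_mem_nhdsWithin] with t ht hts
      exact hloc t k ⟨by linarith [hs.1, mem_Ici.1 hts], le_of_lt ht⟩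
    -- At a seam the left half is read off from the end of the previous round, hence the shift by `k
    -- + 1` instead of `k`.
    rcases hs.1.eq_or_lt with h' | h'
    · have hs' : s + (k + 1 : ℤ) * (b - a) = b := by push_cast; linarith
      have hleft : γ =ᶠ[𝓝[≤] s] fun t ↦ η (t + (k + 1 : ℤ) * (b - a)) := by
        filter_upwards [mem_nhdsWithin_of_mem_nhds ((hc (k + 1)).preimage_mem_nhds
          (Ioi_mem_nhds (hab.trans_eq hs'.symm))), self_mem_nhdsWithin] with t ht hts
        exact hloc t (k + 1) ⟨le_of_lt ht, by linarith [mem_Iic.1 hts]⟩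
      exact IsPiecewiseFutureAt.glue (IsPiecewiseFutureAt.comp_add _ (hη _ (by
        rw [hs']; exact right_mem_Icc.2 hab.le)))
        (IsPiecewiseFutureAt.comp_add _ (hη _ ⟨hs.1, hs.2.le⟩)) hleft hright
    · have hleft : γ =ᶠ[𝓝[≤] s] fun t ↦ η (t + k * (b - a)) := by
        filter_upwards [mem_nhdsWithin_of_mem_nhds ((hc k).preimage_mem_nhds (Ioi_mem_nhds h')),
          self_mem_nhdsWithin] with t ht hts
        exact hloc t k ⟨le_of_lt ht, by linarith [hs.2, mem_Iic.1 hts]⟩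
      have := IsPiecewiseFutureAt.comp_add _ (hη _ ⟨hs.1, hs.2.le⟩)
      exact IsPiecewiseFutureAt.glue this this hleft hright
  have hconst : ∀ q, (∀ s, γ s = q) → False := by
    intro q hq
    have h1 := (hfut a).rightVelocity_mem.1
    have h2 : γ = fun _ ↦ q := funext hq
    have h3 : mfderivWithin 𝓘(ℝ, ℝ) (𝓡 (d + 1)) (fun _ : ℝ ↦ q) (Ici a) a = 0 :=
      mfderivWithin_const
    rw [h2, rightVelocity, h3] at h1
    have h4 : g.form q (0 : TangentSpace (𝓡 (d + 1)) q) (0 : TangentSpace (𝓡 (d + 1)) q) < 0 := h1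
    simp at h4
  have hcurve : g.IsInextendibleFutureCurve F N γ univ :=
    { isOpen := isOpen_univ
      ordConnected := ordConnected_univ
      nonempty := univ_nonempty
      mapsTo := fun s _ ↦ hηN _ (Ico_subset_Icc_self (hmod s))
      piecewiseFuture := fun s _ ↦ hfut s
      not_hasFutureLimit := by
        intro q _ hl
        refine hconst q fun s ↦ ?_
        by_contra hne
        obtain ⟨A, -, hA⟩ := hl {γ s}ᶜ (isOpen_compl_singleton.mem_nhds fun h' ↦ hne h'.symm)
        obtain ⟨n, hn⟩ := exists_nat_ge ((A - s) / (b - a))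
        rw [div_le_iff₀ hP] at hn
        exact hA (s + n * (b - a)) trivial (by linarith) (hper s n)
      not_hasPastLimit := by
        intro q _ hl
        refine hconst q fun s ↦ ?_
        by_contra hne
        obtain ⟨A, -, hA⟩ := hl {γ s}ᶜ (isOpen_compl_singleton.mem_nhds fun h' ↦ hne h'.symm)
        obtain ⟨n, hn⟩ := exists_nat_ge ((s - A) / (b - a))
        rw [div_le_iff₀ hP] at hn
        exact hA (s - n * (b - a)) trivial (by linarith) (hper' s n) }
  obtain ⟨s, ⟨-, hs⟩, -⟩ := h.existsUnique hcurve
  exact hηS _ (Ico_subset_Icc_self (hmod s)) hs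

/-- A future curve that avoids `S` does not lead back along a flow line that starts on `S`. -/
theorem not_backward (h : g.IsCauchyFlow F N S) {x : M} (hx : x ∈ S) {t₁ t₂ : ℝ} (ht₁ : 0 < t₁)
    (ht : t₁ < t₂) (hN : ∀ r ∈ Icc 0 t₂, F.map r x ∈ N) {a b : ℝ} (hab : a < b)
    (hη : ∀ s ∈ Icc a b, g.IsPiecewiseFutureAt F η s) (hηS : ∀ s ∈ Icc a b, η s ∉ S)
    (hb : η b = F.map t₁ x) : η a ≠ F.map t₂ x := by
  intro ha
  have hηN := h.mem_of_avoids hx ht₁ (fun r hr ↦ hN r ⟨hr.1, hr.2.trans ht.le⟩) hη hηS hb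
  have eb : η b = (fun s ↦ F.map (s - b) (η b)) b := by simp [F.map_zero]
  -- Flowing on from `η b = F.map t₁ x` for the time `t₂ - t₁` leads back to `η a`, which turns `η`
  -- into a loop in `N` that misses `S`.
  set c := b + (t₂ - t₁) with hc
  have hmem : ∀ s ∈ Icc b c, F.map (s - b) (η b) ∈ N ∧ F.map (s - b) (η b) ∉ S := by
    intro s hs
    rw [hb, ← F.map_add]
    refine ⟨hN _ ⟨by linarith [hs.1], by linarith [hs.2]⟩,
      h.map_notMem hx (by linarith [hs.1]) fun r hr ↦ hN r ⟨hr.1, by linarith [hr.2, hs.2]⟩⟩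
  refine h.not_closed (η := joinAt b η fun s ↦ F.map (s - b) (η b)) (a := a) (b := c)
    (by linarith) (fun s hs ↦ ?_) (fun s hs ↦ ?_) (fun s hs ↦ ?_) ?_
  · refine IsPiecewiseFutureAt.joinAt eb (fun h' ↦ hη s ⟨hs.1, h'⟩) fun h' ↦ ?_
    exact (SmoothFlow.isFutureAt_curve (h.timelike _ (hmem s ⟨h', hs.2⟩).1)).isPiecewiseFutureAt
  · rcases le_total s b with h' | h'
    · rw [joinAt_of_le h']; exact hηN s ⟨hs.1, h'⟩
    · rw [joinAt_of_ge eb h']; exact (hmem s ⟨h', hs.2⟩).1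
  · rcases le_total s b with h' | h'
    · rw [joinAt_of_le h']; exact hηS s ⟨hs.1, h'⟩
    · rw [joinAt_of_ge eb h']; exact (hmem s ⟨h', hs.2⟩).2
  · rw [joinAt_of_le hab.le, joinAt_of_ge eb (by linarith), ha, hb, ← F.map_add]
    congr 1
    linarith

end IsCauchyFlow
end LorentzianMetric
end CauchyFlow

/-! ### Local barrier functions for the initial hypersurface -/

section Barrier

variable {d : ℕ} {M : Type*} [TopologicalSpace M]
  [ChartedSpace (EuclideanSpace ℝ (Fin (d + 1))) M] [IsManifold (𝓡 (d + 1)) ∞ M]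
  {g : LorentzianMetric d M} {F : SmoothFlow (EuclideanSpace ℝ (Fin (d + 1))) M} {N S : Set M}

/-- A smooth function near `z` that increases along `F` and vanishes on `S`. -/
structure IsBarrierAt (F : SmoothFlow (EuclideanSpace ℝ (Fin (d + 1))) M) (S : Set M) (φ : M → ℝ)
    (z : M) : Prop where
  smooth : ∀ᶠ x in 𝓝 z, ContMDiffAt (𝓡 (d + 1)) 𝓘(ℝ, ℝ) ∞ φ x
  pos : (0 : ℝ) < mfderiv (𝓡 (d + 1)) 𝓘(ℝ, ℝ) φ z (F.field z)
  eq_zero : ∀ᶠ x in 𝓝 z, x ∈ S → φ x = 0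

/-- By Hahn–Banach a continuous linear functional takes the value `1` on the derivative of `G` along
the flow; composing `G` with it gives the barrier. -/
theorem exists_isBarrierAt_of_map {V : Type*} [NormedAddCommGroup V] [NormedSpace ℝ V] {G : M → V}
    {z : M} (hG : ∀ᶠ x in 𝓝 z, ContMDiffAt (𝓡 (d + 1)) 𝓘(ℝ, V) ∞ G x)
    (hne : mfderiv (𝓡 (d + 1)) 𝓘(ℝ, V) G z (F.field z) ≠ 0)
    (h0 : ∀ᶠ x in 𝓝 z, x ∈ S → G x = 0) : ∃ φ, IsBarrierAt F S φ z := by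
  have hne' : (show V from mfderiv (𝓡 (d + 1)) 𝓘(ℝ, V) G z (F.field z)) ≠ 0 := hne
  obtain ⟨l, hl⟩ := SeparatingDual.exists_eq_one (R := ℝ) hne'
  refine ⟨fun x ↦ l (G x), ?_, ?_, ?_⟩
  · filter_upwards [hG] with x hx
    have h1 : ContMDiffAt 𝓘(ℝ, V) 𝓘(ℝ, ℝ) ∞ l (G x) := l.contDiff.contMDiff.contMDiffAt
    exact h1.comp x hx
  · have h1 : HasMFDerivAt (𝓡 (d + 1)) 𝓘(ℝ, V) G z (mfderiv (𝓡 (d + 1)) 𝓘(ℝ, V) G z) :=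
      (hG.self_of_nhds.mdifferentiableAt (by simp)).hasMFDerivAt
    have h2 : HasMFDerivAt 𝓘(ℝ, V) 𝓘(ℝ, ℝ) l (G z) l := l.hasFDerivAt.hasMFDerivAt
    have h3 := (h2.comp z h1).mfderiv
    have h4 : mfderiv (𝓡 (d + 1)) 𝓘(ℝ, ℝ) (fun x ↦ l (G x)) z (F.field z) =
      l (mfderiv (𝓡 (d + 1)) 𝓘(ℝ, V) G z (F.field z)) := DFunLike.congr_fun h3 _
    rw [h4]
    exact hl.symm ▸ one_pos
  · filter_upwards [h0] with x hx hxS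
    simp [hx hxS]

/-- Away from the closure of `S` the vanishing condition is void, so the chart itself, whose
derivative does not kill the field, can be used as `G`. -/
theorem exists_isBarrierAt_of_notMem_closure {z : M} (hz : F.field z ≠ 0) (hzS : z ∉ closure S) :
    ∃ φ, IsBarrierAt F S φ z := by
  have hs : z ∈ (chartAt (EuclideanSpace ℝ (Fin (d + 1))) z).source := mem_chart_source _ z
  have : IsManifold (𝓡 (d + 1)) 1 M := IsManifold.of_le (n := ∞) (by simp)
  refine exists_isBarrierAt_of_map (G := chartAt (EuclideanSpace ℝ (Fin (d + 1))) z) ?_ ?_ ?_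
  · filter_upwards [(chartAt (EuclideanSpace ℝ (Fin (d + 1))) z).open_source.mem_nhds hs] with x hx
    exact contMDiffAt_of_mem_maximalAtlas (IsManifold.chart_mem_maximalAtlas z) hx
  · intro h0
    exact hz ((mdifferentiable_chart z).mfderiv_injective hs (h0.trans (map_zero _).symm))
  · filter_upwards [isClosed_closure.isOpen_compl.mem_nhds hzS] with x hx hxS
    exact absurd (subset_closure hxS) hx

/-- In a slice chart, a vector killed by the transverse coordinates is tangent to the slice. This
turns a failure of transversality into a direction in the parameter space. -/
theorem exists_mfderiv_eq_of_slice {E' V : Type*} [NormedAddCommGroup E'] [NormedSpace ℝ E']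
    [NormedAddCommGroup V] [NormedSpace ℝ V] {f : E' → M} {y : E'}
    (hf : MDifferentiableAt 𝓘(ℝ, E') (𝓡 (d + 1)) f y)
    {c : OpenPartialHomeomorph M (EuclideanSpace ℝ (Fin (d + 1)))}
    (hc : c ∈ IsManifold.maximalAtlas (𝓡 (d + 1)) ∞ M) (hy : f y ∈ c.source)
    (e : (E' × V) ≃L[ℝ] EuclideanSpace ℝ (Fin (d + 1))) (hcf : ∀ᶠ x in 𝓝 y, c (f x) = e (x, 0))
    (v : TangentSpace (𝓡 (d + 1)) (f y))
    (h0 : mfderiv (𝓡 (d + 1)) 𝓘(ℝ, V) (fun x ↦ (e.symm (c x)).2) (f y) v = 0) :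
    ∃ w : E', mfderiv 𝓘(ℝ, E') (𝓡 (d + 1)) f y w = v := by
  have : IsManifold (𝓡 (d + 1)) 1 M := IsManifold.of_le (n := ∞) (by simp)
  have hc1 : c.MDifferentiable (𝓡 (d + 1)) (𝓡 (d + 1)) :=
    ⟨(contMDiffOn_of_mem_maximalAtlas hc).mdifferentiableOn (by simp),
      (contMDiffOn_symm_of_mem_maximalAtlas hc).mdifferentiableOn (by simp)⟩
  have h1 := (hc1.mdifferentiableAt hy).hasMFDerivAt
  set l : EuclideanSpace ℝ (Fin (d + 1)) →L[ℝ] V := (ContinuousLinearMap.snd ℝ E' V).comp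
    (e.symm : EuclideanSpace ℝ (Fin (d + 1)) →L[ℝ] E' × V) with hl
  have h2 : HasMFDerivAt (𝓡 (d + 1)) 𝓘(ℝ, V) l (c (f y)) l := l.hasFDerivAt.hasMFDerivAt
  obtain ⟨v', hv'⟩ : ∃ v' : EuclideanSpace ℝ (Fin (d + 1)),
    v' = mfderiv (𝓡 (d + 1)) (𝓡 (d + 1)) c (f y) v := ⟨_, rfl⟩
  have h3 : l v' = 0 := by
    rw [hv']
    exact (DFunLike.congr_fun (h2.comp (f y) h1).mfderiv v).symm.trans h0
  set w := (e.symm v').1 with hw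
  refine ⟨w, ?_⟩
  apply hc1.mfderiv_injective hy
  set k : E' →L[ℝ] EuclideanSpace ℝ (Fin (d + 1)) :=
    (e : E' × V →L[ℝ] EuclideanSpace ℝ (Fin (d + 1))).comp (ContinuousLinearMap.inl ℝ E' V) with hk
  have h4 : HasMFDerivAt 𝓘(ℝ, E') (𝓡 (d + 1)) k y k := k.hasFDerivAt.hasMFDerivAt
  have h5 : HasMFDerivAt 𝓘(ℝ, E') (𝓡 (d + 1)) (c ∘ f) y k := h4.congr_of_eventuallyEq hcf
  have h6 := DFunLike.congr_fun (hasMFDerivAt_unique (h1.comp y hf.hasMFDerivAt) h5) w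
  refine h6.trans (Eq.trans ?_ hv')
  change e (w, 0) = v'
  rw [← ContinuousLinearEquiv.eq_symm_apply]
  exact Prod.ext rfl h3.symm

/-- The transverse slice coordinates of `ψ` at `u₀` vanish on `S`. If the flow were tangent to the
image at `ψ u₀`, the image of the same parameter direction would still be timelike at nearby points
of `B`, and a short line there would be a future curve inside `S`, against `not_eventually_mem`. The
point `u₀` may lie on the boundary of `B` because `ψ` is defined beyond it. -/
theorem exists_isBarrierAt_of_embedding [T2Space M] (h : g.IsCauchyFlow F N S)
    {U : TopologicalSpace.Opens (EuclideanSpace ℝ (Fin d))} {ψ : U → M}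
    (hψ : Manifold.IsSmoothEmbedding (𝓡 d) (𝓡 (d + 1)) ∞ ψ) {B : Set U} (hB : IsOpen B)
    (hS : S = ψ '' B) {u₀ : U} (hu₀ : u₀ ∈ closure B) (hF : g.IsTimelike (F.field (ψ u₀))) :
    ∃ φ, IsBarrierAt F S φ (ψ u₀) := by
  have hi := hψ.isImmersion.isImmersionAt u₀
  set D := hi.domChart with hD
  set c := hi.codChart with hc
  have hcm := hi.codChart_mem_maximalAtlas
  have hDm := hi.domChart_mem_maximalAtlas
  have hu₀D : u₀ ∈ D.source := hi.mem_domChart_source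
  have hcs : ψ u₀ ∈ c.source := hi.mem_codChart_source
  have hw : ∀ y ∈ D.target, c (ψ (D.symm y)) = hi.equiv (y, 0) := by
    intro y hy
    have hy' : y ∈ (D.extend (𝓡 d)).target := by simpa using hy
    have := hi.writtenInCharts hy'
    simpa using this
  set f : EuclideanSpace ℝ (Fin d) → M := fun y ↦ ψ (D.symm y) with hf
  have hfs : ∀ y ∈ D.target, ContMDiffAt (𝓡 d) (𝓡 (d + 1)) ∞ f y := by
    intro y hy
    have h1 : ContMDiffAt (𝓡 d) (𝓡 (d + 1)) ∞ ψ (D.symm y) := hψ.contMDiff _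
    exact h1.comp y (contMDiffAt_symm_of_mem_maximalAtlas hDm hy)
  have hy₀ : D u₀ ∈ D.target := D.map_source hu₀D
  have hfy₀ : f (D u₀) = ψ u₀ := by simp only [hf, D.left_inv hu₀D]
  refine exists_isBarrierAt_of_map (G := fun x ↦ (hi.equiv.symm (c x)).2) ?_ ?_ ?_
  · filter_upwards [c.open_source.mem_nhds hcs] with x hx
    have h1 : ContMDiffAt (𝓡 (d + 1)) 𝓘(ℝ, hi.complement) ∞
        (fun y ↦ (hi.equiv.symm y).2) (c x) := by
      rw [contMDiffAt_iff_contDiffAt]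
      exact contDiff_snd.contDiffAt.comp _ hi.equiv.symm.contDiff.contDiffAt
    exact h1.comp x (contMDiffAt_of_mem_maximalAtlas hcm hx)
  · intro h0
    rw [← hfy₀] at h0 hF hcs
    obtain ⟨w, hw⟩ := exists_mfderiv_eq_of_slice ((hfs _ hy₀).mdifferentiableAt (by simp)) hcm hcs
      hi.equiv (by filter_upwards [D.open_target.mem_nhds hy₀] with y hy using hw y hy) _ h0
    have hev : ∀ y ∈ D.target, ∀ᶠ y in 𝓝 y, ContMDiffAt (𝓡 d) (𝓡 (d + 1)) ∞ f y := fun y hy ↦ by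
      filter_upwards [D.open_target.mem_nhds hy] with y hy using hfs y hy
    have h1 : ∀ᶠ y in 𝓝 (D u₀), mfderiv (𝓡 d) (𝓡 (d + 1)) f y w ∈ g.cone (F.field (f y)) := by
      have hc1 : ContinuousAt (fun y : EuclideanSpace ℝ (Fin d) ↦ (y, w)) (D u₀) := by fun_prop
      exact hc1.eventually (LorentzianMetric.eventually_mfderiv_mem_cone (hev _ hy₀)
        (by rw [hw]; exact ⟨hF, hF⟩))
    obtain ⟨u₁, hu₁B, hu₁, hu₁D⟩ := ((mem_closure_iff_frequently.1 hu₀).and_eventually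
      (((D.continuousAt hu₀D).eventually h1).and (D.open_source.mem_nhds hu₀D))).exists
    have hy₁ : D u₁ ∈ D.target := D.map_source hu₁D
    set L : ℝ → EuclideanSpace ℝ (Fin d) := fun t ↦ D u₁ + t • w with hL
    have hL0 : L 0 = D u₁ := by simp [hL]
    have h2 : g.IsFutureAt F (fun t ↦ f (L t)) 0 :=
      LorentzianMetric.isFutureAt_line (v := w) (fun t ↦ by simp [hL])
        (by rw [hL0]; exact hev _ hy₁) (by rw [hL0]; exact hu₁)
    refine h.not_eventually_mem h2 ?_
    have h3 : ContinuousAt L 0 := by fun_prop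
    have h4 : ∀ᶠ y in 𝓝 (L 0), D.symm y ∈ B := by
      rw [hL0]
      refine (D.continuousAt_symm hy₁).eventually (hB.mem_nhds ?_)
      rwa [D.left_inv hu₁D]
    filter_upwards [h3.eventually h4] with t ht
    rw [hS]
    exact mem_image_of_mem ψ ht
  -- As `ψ` is a topological embedding, points of `S` near `ψ u₀` come from parameters near `u₀`; no
  -- other sheet of `S` approaches.
  · obtain ⟨V, hV, hVD⟩ := (hψ.isEmbedding.isInducing.nhds_eq_comap u₀ ▸
      D.open_source.mem_nhds hu₀D : D.source ∈ comap ψ (𝓝 (ψ u₀)))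
    filter_upwards [hV] with x hx hxS
    rw [hS] at hxS
    obtain ⟨u, -, rfl⟩ := hxS
    have huD : u ∈ D.source := hVD hx
    have := hw (D u) (D.map_source huD)
    rw [D.left_inv huD] at this
    simp [this]

theorem exists_isBarrierAt [T2Space M] (h : g.IsCauchyFlow F N S)
    {U : TopologicalSpace.Opens (EuclideanSpace ℝ (Fin d))} {ψ : U → M}
    (hψ : Manifold.IsSmoothEmbedding (𝓡 d) (𝓡 (d + 1)) ∞ ψ) {B : Set U} (hB : IsOpen B)
    (hBc : IsCompact (closure B)) (hS : S = ψ '' B) {z : M} (hF : g.IsTimelike (F.field z)) :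
    ∃ φ, IsBarrierAt F S φ z := by
  by_cases hz : z ∈ closure S
  · have h1 : closure S ⊆ ψ '' closure B := by
      rw [hS]
      exact closure_minimal (image_mono subset_closure)
        (hBc.image hψ.isEmbedding.continuous).isClosed
    obtain ⟨u₀, hu₀, rfl⟩ := h1 hz
    exact exists_isBarrierAt_of_embedding h hψ hB hS hu₀ hF
  · refine exists_isBarrierAt_of_notMem_closure (fun h0 ↦ ?_) hz
    simp [LorentzianMetric.IsTimelike, h0] at hF

end Barrier

/-! ### A uniform bound on the time spent in `N` -/

section TimeBound

variable {d : ℕ} {M : Type*} [TopologicalSpace M]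
  [ChartedSpace (EuclideanSpace ℝ (Fin (d + 1))) M] [IsManifold (𝓡 (d + 1)) ∞ M]
  {g : LorentzianMetric d M} {F : SmoothFlow (EuclideanSpace ℝ (Fin (d + 1))) M} {N S : Set M}

/-- The flow through the points with chart coordinates `p.2.1`, displaced by `p.2.2` in the chart. -/
def displacedFlow (F : SmoothFlow (EuclideanSpace ℝ (Fin (d + 1))) M) (z : M)
    (p : ℝ × EuclideanSpace ℝ (Fin (d + 1)) × EuclideanSpace ℝ (Fin (d + 1))) : M :=
  (chartAt (EuclideanSpace ℝ (Fin (d + 1))) z).symm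
    (chartAt (EuclideanSpace ℝ (Fin (d + 1))) z
      (F.map p.1 ((chartAt (EuclideanSpace ℝ (Fin (d + 1))) z).symm p.2.1)) + p.2.2)

theorem eventually_displacedFlow (F : SmoothFlow (EuclideanSpace ℝ (Fin (d + 1))) M) (z : M) :
    ∀ᶠ p in 𝓝 ((0 : ℝ), chartAt (EuclideanSpace ℝ (Fin (d + 1))) z z,
      (0 : EuclideanSpace ℝ (Fin (d + 1)))),
      F.map p.1 ((chartAt (EuclideanSpace ℝ (Fin (d + 1))) z).symm p.2.1) ∈
        (chartAt (EuclideanSpace ℝ (Fin (d + 1))) z).source ∧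
      ContMDiffAt 𝓘(ℝ, ℝ × EuclideanSpace ℝ (Fin (d + 1)) × EuclideanSpace ℝ (Fin (d + 1)))
        (𝓡 (d + 1)) ∞ (displacedFlow F z) p := by
  set c := chartAt (EuclideanSpace ℝ (Fin (d + 1))) z with hc
  have hz : z ∈ c.source := mem_chart_source _ z
  have hcm : c ∈ IsManifold.maximalAtlas (𝓡 (d + 1)) ∞ M := IsManifold.chart_mem_maximalAtlas z
  have h1 : ∀ p : ℝ × EuclideanSpace ℝ (Fin (d + 1)) × EuclideanSpace ℝ (Fin (d + 1)),
      p.2.1 ∈ c.target →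
      ContMDiffAt 𝓘(ℝ, ℝ × EuclideanSpace ℝ (Fin (d + 1)) × EuclideanSpace ℝ (Fin (d + 1)))
        (𝓡 (d + 1)) ∞ (fun p ↦ F.map p.1 (c.symm p.2.1)) p := by
    intro p hp
    have e1 : ContMDiffAt (𝓡 (d + 1)) (𝓡 (d + 1)) ∞ c.symm p.2.1 :=
      contMDiffAt_symm_of_mem_maximalAtlas hcm hp
    have e2 : ContMDiffAt 𝓘(ℝ, ℝ × EuclideanSpace ℝ (Fin (d + 1)) × EuclideanSpace ℝ (Fin (d + 1)))
        (𝓡 (d + 1)) ∞ (fun p : ℝ × EuclideanSpace ℝ (Fin (d + 1)) ×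
          EuclideanSpace ℝ (Fin (d + 1)) ↦ p.2.1) p := by
      rw [contMDiffAt_iff_contDiffAt]; fun_prop
    have e3 : ContMDiffAt 𝓘(ℝ, ℝ × EuclideanSpace ℝ (Fin (d + 1)) × EuclideanSpace ℝ (Fin (d + 1)))
        𝓘(ℝ, ℝ) ∞ (fun p : ℝ × EuclideanSpace ℝ (Fin (d + 1)) ×
          EuclideanSpace ℝ (Fin (d + 1)) ↦ p.1) p := by
      rw [contMDiffAt_iff_contDiffAt]; fun_prop
    exact (F.contMDiff_map.contMDiffAt (x := (p.1, c.symm p.2.1))).comp p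
      (e3.prodMk (e1.comp p e2))
  have h2 : ∀ p : ℝ × EuclideanSpace ℝ (Fin (d + 1)) × EuclideanSpace ℝ (Fin (d + 1)),
      p.2.1 ∈ c.target → F.map p.1 (c.symm p.2.1) ∈ c.source →
      ContMDiffAt 𝓘(ℝ, ℝ × EuclideanSpace ℝ (Fin (d + 1)) × EuclideanSpace ℝ (Fin (d + 1)))
        (𝓡 (d + 1)) ∞ (fun p ↦ c (F.map p.1 (c.symm p.2.1)) + p.2.2) p := by
    intro p hp hp'
    have e1 : ContMDiffAt (𝓡 (d + 1)) (𝓡 (d + 1)) ∞ c (F.map p.1 (c.symm p.2.1)) :=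
      contMDiffAt_of_mem_maximalAtlas hcm hp'
    have e2 := e1.comp p (h1 p hp)
    rw [contMDiffAt_iff_contDiffAt] at e2 ⊢
    exact e2.add (by fun_prop)
  have hy₀ : c z ∈ c.target := c.map_source hz
  have e0 : F.map 0 (c.symm (c z)) = z := by rw [c.left_inv hz, F.map_zero]
  have hc1 : ContinuousAt (fun p : ℝ × EuclideanSpace ℝ (Fin (d + 1)) ×
      EuclideanSpace ℝ (Fin (d + 1)) ↦ p.2.1) (0, c z, 0) := by fun_prop
  have hs : F.map 0 (c.symm (c z)) ∈ c.source := by rwa [e0]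
  filter_upwards [hc1.eventually (c.open_target.mem_nhds hy₀),
    (h1 (0, c z, 0) hy₀).continuousAt.eventually (c.open_source.mem_nhds hs),
    (h2 (0, c z, 0) hy₀ hs).continuousAt.eventually (c.open_target.mem_nhds (by
      simp only [e0, add_zero]; exact hy₀))] with p hp1 hp2 hp3
  have e1 : ContMDiffAt (𝓡 (d + 1)) (𝓡 (d + 1)) ∞ c.symm (c (F.map p.1 (c.symm p.2.1)) + p.2.2) :=
    contMDiffAt_symm_of_mem_maximalAtlas hcm hp3
  exact ⟨hp2, e1.comp p (h2 p hp1 hp2)⟩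

/-- Near a barrier, future curves along which the barrier function increases connect nearby points
to the future and to the past of each other. -/
theorem IsBarrierAt.exists_connections {φ : M → ℝ} {z : M} (hφ : IsBarrierAt F S φ z)
    (hF : g.IsTimelike (F.field z)) : ∃ δ > 0, δ ≤ 1 / 2 ∧ ∃ U ∈ 𝓝 z, ∀ c ∈ U, ∀ c' ∈ U,
      (0 < φ c' → ∃ η : ℝ → M, (∀ s ∈ Icc 0 δ, g.IsPiecewiseFutureAt F η s ∧ η s ∉ S) ∧
        η 0 = c' ∧ η δ = F.map δ c) ∧
      (φ c' ≤ 0 → c' ∉ S → ∃ η : ℝ → M,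
        (∀ s ∈ Icc 0 δ, g.IsPiecewiseFutureAt F η s ∧ η s ∉ S) ∧
        η 0 = F.map (-δ) c ∧ η δ = c') := by
  set c := chartAt (EuclideanSpace ℝ (Fin (d + 1))) z with hc
  have hz : z ∈ c.source := mem_chart_source _ z
  set f := displacedFlow F z with hf
  set p₀ : ℝ × EuclideanSpace ℝ (Fin (d + 1)) × EuclideanSpace ℝ (Fin (d + 1)) := (0, c z, 0)
    with hp₀
  set v₀ : ℝ × EuclideanSpace ℝ (Fin (d + 1)) × EuclideanSpace ℝ (Fin (d + 1)) := (1, 0, 0)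
    with hv₀
  have hev := eventually_displacedFlow F z
  have hfs : ∀ᶠ p in 𝓝 p₀, ContMDiffAt 𝓘(ℝ, ℝ × EuclideanSpace ℝ (Fin (d + 1)) ×
      EuclideanSpace ℝ (Fin (d + 1))) (𝓡 (d + 1)) ∞ f p := hev.mono fun _ h ↦ h.2
  have hfp₀ : f p₀ = z := by
    simp only [hf, hp₀, displacedFlow, add_zero, ← hc]
    rw [c.left_inv hz, F.map_zero, c.left_inv hz]
  set L₀ : ℝ → ℝ × EuclideanSpace ℝ (Fin (d + 1)) × EuclideanSpace ℝ (Fin (d + 1)) :=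
    fun t ↦ (t, c z, 0) with hL₀
  have hL₀' : ∀ t, L₀ t = L₀ 0 + (t - 0) • v₀ := fun t ↦ by simp [hL₀, hv₀]
  have hfL₀ : (fun t ↦ f (L₀ t)) =ᶠ[𝓝 0] fun t ↦ F.map t z := by
    have hcont : ContinuousAt L₀ 0 := by fun_prop
    filter_upwards [hcont.eventually hev] with t ht
    have h1 := ht.1
    simp only [hL₀, ← hc] at h1
    simp only [hf, hL₀, displacedFlow, add_zero, ← hc]
    rw [c.left_inv h1, c.left_inv hz]
  have hcone : mfderiv 𝓘(ℝ, ℝ × EuclideanSpace ℝ (Fin (d + 1)) × EuclideanSpace ℝ (Fin (d + 1)))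
      (𝓡 (d + 1)) f p₀ v₀ ∈ g.cone (F.field (f p₀)) := by
    have h1 : g.IsFutureAt F (fun t ↦ F.map (t - 0) z) 0 := SmoothFlow.isFutureAt_curve (by
      rwa [sub_self, F.map_zero])
    simp only [sub_zero] at h1
    have h2 := (h1.congr hfL₀).2
    rw [LorentzianMetric.mfderiv_comp_of_hasDerivAt (hasDerivAt_of_eq_line hL₀') hfs.self_of_nhds] at h2
    exact h2
  set k : ℝ × EuclideanSpace ℝ (Fin (d + 1)) × EuclideanSpace ℝ (Fin (d + 1)) → ℝ :=
    fun p ↦ φ (f p) with hk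
  have hfc : ContinuousAt f p₀ := hfs.self_of_nhds.continuousAt
  have hks : ∀ᶠ p in 𝓝 p₀, ContDiffAt ℝ ∞ k p := by
    filter_upwards [hfs, hfc.eventually (by rw [hfp₀]; exact hφ.smooth)] with p h1 h2
    exact (h2.comp p h1).contDiffAt
  have hkpos : 0 < fderiv ℝ k p₀ v₀ := by
    have hφ' : IsBarrierAt F S φ (F.map 0 z) := by rwa [F.map_zero]
    have h1 := (hφ'.smooth.self_of_nhds.mdifferentiableAt (by simp)).hasMFDerivAt.comp (0 : ℝ)
      (F.isMIntegralCurve z 0)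
    obtain ⟨D, h2, hD⟩ : ∃ D : ℝ →L[ℝ] ℝ, HasFDerivAt (fun t ↦ φ (F.map t z)) D 0 ∧
        D 1 = mfderiv (𝓡 (d + 1)) 𝓘(ℝ, ℝ) φ (F.map 0 z) ((1 : ℝ) • F.field (F.map 0 z)) :=
      ⟨_, h1.hasFDerivAt, rfl⟩
    have h3 : HasDerivAt L₀ v₀ 0 := hasDerivAt_of_eq_line hL₀'
    have h4 : HasDerivAt (fun t ↦ k (L₀ t)) (fderiv ℝ k p₀ v₀) 0 :=
      HasFDerivAt.comp_hasDerivAt (f := L₀) 0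
        (hks.self_of_nhds.differentiableAt (by simp)).hasFDerivAt h3
    have h5 : (fun t ↦ k (L₀ t)) =ᶠ[𝓝 0] fun t ↦ φ (F.map t z) := by
      filter_upwards [hfL₀] with t ht
      simp only [hk]
      exact congrArg φ ht
    have h6 := h2.unique (h4.congr_of_eventuallyEq h5.symm).hasFDerivAt
    have h7 : fderiv ℝ k p₀ v₀ = D 1 := by rw [h6]; simp
    rw [h7, hD, one_smul]
    exact hφ'.pos
  have hkc : ContinuousAt (fun q : (ℝ × EuclideanSpace ℝ (Fin (d + 1)) ×
      EuclideanSpace ℝ (Fin (d + 1))) × (ℝ × EuclideanSpace ℝ (Fin (d + 1)) ×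
      EuclideanSpace ℝ (Fin (d + 1))) ↦ fderiv ℝ k q.1 q.2) (p₀, v₀) := by
    have h1 : ContinuousAt (fderiv ℝ k) p₀ :=
      (hks.self_of_nhds.fderiv_right (m := 0) (by simp)).continuousAt
    exact ContinuousAt.clm_apply (ContinuousAt.comp (f := Prod.fst) h1 continuousAt_fst)
      continuousAt_snd
  -- Open conditions at the undisplaced flow line with velocity `v₀`: on a ball around it, straight
  -- lines map to future curves along which `φ` increases.
  have hall := ((LorentzianMetric.eventually_mfderiv_mem_cone hfs hcone).and
    (hkc.eventually_const_lt hkpos)).and ((continuousAt_fst (p := (p₀, v₀))).eventually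
    ((hev.and hks).and ((eventually_eventually_nhds.2 hfs).and
      (hfc.eventually (by rw [hfp₀]; exact hφ.eq_zero)))))
  obtain ⟨ε, hε, hball⟩ := Metric.eventually_nhds_iff_ball.1 hall
  have key : ∀ (L : ℝ → ℝ × EuclideanSpace ℝ (Fin (d + 1)) × EuclideanSpace ℝ (Fin (d + 1)))
      (v : ℝ × EuclideanSpace ℝ (Fin (d + 1)) × EuclideanSpace ℝ (Fin (d + 1))) (δ : ℝ),
      (∀ s t, L t = L s + (t - s) • v) → (∀ s ∈ Icc 0 δ, (L s, v) ∈ Metric.ball (p₀, v₀) ε) →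
      StrictMonoOn (fun s ↦ φ (f (L s))) (Icc 0 δ) ∧ ∀ s ∈ Icc 0 δ,
        g.IsPiecewiseFutureAt F (fun s ↦ f (L s)) s ∧ (f (L s) ∈ S → φ (f (L s)) = 0) := by
    intro L v δ hL hmem
    have hderiv : ∀ s ∈ Icc 0 δ, HasDerivAt (fun s ↦ φ (f (L s))) (fderiv ℝ k (L s) v) s := by
      intro s hs
      obtain ⟨-, ⟨-, h2⟩, -⟩ := hball _ (hmem s hs)
      have h3 : HasDerivAt L v s := hasDerivAt_of_eq_line (hL s)
      exact HasFDerivAt.comp_hasDerivAt (f := L) s (h2.differentiableAt (by simp)).hasFDerivAt h3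
    refine ⟨strictMonoOn_of_deriv_pos (convex_Icc 0 δ)
      (fun s hs ↦ (hderiv s hs).continuousAt.continuousWithinAt) fun s hs ↦ ?_, fun s hs ↦ ?_⟩
    · rw [interior_Icc] at hs
      have hs' := Ioo_subset_Icc_self hs
      rw [(hderiv s hs').deriv]
      exact (hball _ (hmem s hs')).1.2
    · obtain ⟨⟨h1, -⟩, -, h2, h3⟩ := hball _ (hmem s hs)
      exact ⟨(LorentzianMetric.isFutureAt_line (hL s) h2 h1).isPiecewiseFutureAt, h3⟩
  -- The bound `1 / 2` keeps a time shift by `δ` below the gap of at least `1` between the passages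
  -- compared in `sign_ne`.
  set δ := min (ε / 2) (1 / 2) with hδ
  have hδ0 : 0 < δ := lt_min (half_pos hε) one_half_pos
  have hδε : δ < ε := (min_le_left _ _).trans_lt (half_lt_self hε)
  have hδ1 : δ ≤ 1 / 2 := min_le_right _ _
  have hρ : 0 < ε * δ / 2 := by positivity
  have hin : ∀ (t a : ℝ) (y w : EuclideanSpace ℝ (Fin (d + 1))), |t| ≤ δ →
      dist y (c z) < ε * δ / 2 → ‖w‖ < ε * δ → |a| ≤ 1 →
      (((t, y, a • w), (1, 0, (1 / δ) • w)) : (ℝ × EuclideanSpace ℝ (Fin (d + 1)) ×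
        EuclideanSpace ℝ (Fin (d + 1))) × (ℝ × EuclideanSpace ℝ (Fin (d + 1)) ×
        EuclideanSpace ℝ (Fin (d + 1)))) ∈ Metric.ball (p₀, v₀) ε := by
    intro t a y w ht hy hw ha
    have e1 : ε * δ < ε := by nlinarith
    have e2 : ‖a • w‖ < ε := by
      rw [norm_smul, Real.norm_eq_abs]
      nlinarith [norm_nonneg w]
    have e3 : ‖(1 / δ) • w‖ < ε := by
      rw [norm_smul, Real.norm_eq_abs, abs_of_pos (one_div_pos.2 hδ0), one_div_mul_eq_div,
        div_lt_iff₀ hδ0]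
      exact hw
    rw [Metric.mem_ball]
    simp only [hp₀, hv₀, Prod.dist_eq, max_lt_iff, dist_zero_right, dist_self]
    refine ⟨⟨?_, by linarith, e2⟩, hε, hε, e3⟩
    rw [Real.norm_eq_abs]
    linarith
  -- Two points of this neighbourhood differ by less than `ε * δ` in the chart, so removing the
  -- difference over a time `δ` tilts the velocity by less than `ε`.
  refine ⟨δ, hδ0, hδ1, c.source ∩ c ⁻¹' Metric.ball (c z) (ε * δ / 2),
    inter_mem (c.open_source.mem_nhds hz) ((c.continuousAt hz).preimage_mem_nhds
      (Metric.ball_mem_nhds _ hρ)), ?_⟩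
  rintro x ⟨hxs, hx⟩ x' ⟨hx's, hx'⟩
  have hxx' : ‖c x' - c x‖ < ε * δ := by
    rw [← dist_eq_norm]
    have := dist_triangle_right (c x') (c x) (c z)
    have h1 : dist (c x') (c z) < ε * δ / 2 := hx'
    have h2 : dist (c x) (c z) < ε * δ / 2 := hx
    linarith
  have hsrc : ∀ t, |t| ≤ δ → F.map t x ∈ c.source := by
    intro t ht
    have := (hball _ (hin t 0 (c x) (c x' - c x) ht hx hxx' (by simp))).2.1.1.1
    rwa [← hc, c.left_inv hxs] at this
  have hf1 : ∀ t, |t| ≤ δ → f (t, c x, 0) = F.map t x := by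
    intro t ht
    simp only [hf, displacedFlow, ← hc, add_zero]
    rw [c.left_inv hxs, c.left_inv (hsrc t ht)]
  have hf2 : f (0, c x, c x' - c x) = x' := by
    simp only [hf, displacedFlow, ← hc]
    rw [c.left_inv hxs, F.map_zero, add_sub_cancel, c.left_inv hx's]
  constructor
  · intro hpos
    -- The displacement shrinks from `c x' - c x` to zero, leading from `x'` to the flow line of
    -- `x`. Here `φ` is positive at the start and increases, so `S` is avoided.
    set L : ℝ → ℝ × EuclideanSpace ℝ (Fin (d + 1)) × EuclideanSpace ℝ (Fin (d + 1)) :=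
      fun s ↦ (s, c x, (s / δ - 1) • (c x - c x')) with hL
    obtain ⟨hmono, hfut⟩ := key L (1, 0, (1 / δ) • (c x - c x')) δ (fun s t ↦ by
      simp only [hL, Prod.smul_mk, Prod.mk_add_mk, smul_zero, add_zero, smul_smul, ← add_smul]
      refine Prod.ext (by simp) (Prod.ext rfl ?_)
      congr 1
      field_simp
      ring_nf) fun s hs ↦ by
        refine hin s (s / δ - 1) (c x) (c x - c x') ?_ hx (by rwa [norm_sub_rev]) ?_
        · rw [abs_of_nonneg hs.1]; exact hs.2
        · have h1 : s / δ ≤ 1 := (div_le_one hδ0).2 hs.2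
          have h2 : 0 ≤ s / δ := div_nonneg hs.1 hδ0.le
          rw [abs_le]; constructor <;> linarith
    have e0 : f (L 0) = x' := by
      rw [← hf2]; simp only [hL, zero_div, zero_sub, neg_smul, one_smul, neg_sub]
    refine ⟨fun s ↦ f (L s), fun s hs ↦ ⟨(hfut s hs).1, fun hS ↦ ?_⟩, e0, ?_⟩
    · have h1 := (hfut s hs).2 hS
      have h2 := hmono.monotoneOn (left_mem_Icc.2 hδ0.le) hs hs.1
      simp only [h1, e0] at h2
      linarith
    · rw [← hf1 δ (abs_of_pos hδ0).le]; simp only [hL, div_self hδ0.ne', sub_self, zero_smul]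
  · intro hneg hS'
    -- The displacement grows from zero to `c x' - c x`. Here `φ` is negative before the end point,
    -- and the end point is off `S` by assumption.
    set L : ℝ → ℝ × EuclideanSpace ℝ (Fin (d + 1)) × EuclideanSpace ℝ (Fin (d + 1)) :=
      fun s ↦ (s - δ, c x, (s / δ) • (c x' - c x)) with hL
    obtain ⟨hmono, hfut⟩ := key L (1, 0, (1 / δ) • (c x' - c x)) δ (fun s t ↦ by
      simp only [hL, Prod.smul_mk, Prod.mk_add_mk, smul_zero, add_zero, smul_smul, ← add_smul]
      refine Prod.ext (by simp) (Prod.ext rfl ?_)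
      congr 1
      field_simp
      ring_nf) fun s hs ↦ by
        refine hin (s - δ) (s / δ) (c x) (c x' - c x) ?_ hx hxx' ?_
        · rw [abs_le]; constructor <;> linarith [hs.1, hs.2]
        · have h1 : s / δ ≤ 1 := (div_le_one hδ0).2 hs.2
          have h2 : 0 ≤ s / δ := div_nonneg hs.1 hδ0.le
          rw [abs_le]; constructor <;> linarith
    have e0 : f (L δ) = x' := by
      rw [← hf2]; simp only [hL, div_self hδ0.ne', sub_self, one_smul]
    refine ⟨fun s ↦ f (L s), fun s hs ↦ ⟨(hfut s hs).1, fun hS ↦ ?_⟩, ?_, e0⟩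
    · have h1 := (hfut s hs).2 hS
      rcases hs.2.eq_or_lt with rfl | hlt
      · exact hS' (e0 ▸ hS)
      · have h2 := hmono hs (right_mem_Icc.2 hδ0.le) hlt
        simp only [h1, e0] at h2
        linarith
    · rw [← hf1 (-δ) (by rw [abs_neg, abs_of_pos hδ0])]
      simp only [hL, zero_div, zero_sub, zero_smul]

namespace LorentzianMetric.IsCauchyFlow

variable [T2Space M]

/-- If both signs are positive, a connection leads from `F.map t₂ x` to the flow line shortly after
`t₁`; otherwise one leads from shortly before `t₂` to `F.map t₁ x`. Both run back along the flow
line off `S`, which `not_backward` forbids. -/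
theorem sign_ne (h : g.IsCauchyFlow F N S) {φ : M → ℝ} {z : M} (hφ : IsBarrierAt F S φ z)
    (hF : g.IsTimelike (F.field z)) : ∃ U ∈ 𝓝 z, ∀ x ∈ S, ∀ t₁ t₂ : ℝ, 0 < t₁ → t₁ + 1 ≤ t₂ →
      (∀ r ∈ Icc 0 t₂, F.map r x ∈ N) → F.map t₁ x ∈ U → F.map t₂ x ∈ U →
      ¬ (0 < φ (F.map t₁ x) ↔ 0 < φ (F.map t₂ x)) := by
  obtain ⟨δ, hδ, hδ1, U, hU, hconn⟩ := hφ.exists_connections hF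
  refine ⟨U, hU, fun x hx t₁ t₂ ht₁ ht hN h1 h2 hiff ↦ ?_⟩
  by_cases hpos : 0 < φ (F.map t₂ x)
  · obtain ⟨η, hη, h0, hd⟩ := (hconn _ h1 _ h2).1 hpos
    rw [← F.map_add] at hd
    exact h.not_backward hx (by linarith) (by linarith) hN hδ (fun s hs ↦ (hη s hs).1)
      (fun s hs ↦ (hη s hs).2) hd h0
  · obtain ⟨η, hη, h0, hd⟩ := (hconn _ h2 _ h1).2 (not_lt.1 fun h' ↦ hpos (hiff.1 h'))
      (h.map_notMem hx ht₁ fun r hr ↦ hN r ⟨hr.1, by linarith [hr.2]⟩)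
    rw [← F.map_add] at h0
    exact h.not_backward hx ht₁ (by linarith) (fun r hr ↦ hN r ⟨hr.1, by linarith [hr.2]⟩) hδ
      (fun s hs ↦ (hη s hs).1) (fun s hs ↦ (hη s hs).2) hd h0

/-- The flow lines from `S` leave `N` after a bounded time. -/
theorem exists_time_bound (h : g.IsCauchyFlow F N S) (hN : IsCompact (closure N))
    (hF : ∀ z ∈ closure N, g.IsTimelike (F.field z))
    (hφ : ∀ z ∈ closure N, ∃ φ, IsBarrierAt F S φ z) :
    ∃ T₀ : ℝ, ∀ x ∈ S, ∀ T, (∀ r ∈ Icc 0 T, F.map r x ∈ N) → T ≤ T₀ := by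
  classical
  choose! φ hφ using hφ
  have := fun z hz ↦ h.sign_ne (hφ z hz) (hF z hz)
  choose! U hU hUsign using this
  obtain ⟨Z, hZ, hcov⟩ := hN.elim_nhds_subcover U hU
  -- Pigeonhole on the times `1, …, 2 * Z.card + 1`: each is given one of `Z.card` neighbourhoods
  -- and a sign, so two of them share both. Time `0` is left out because the point there lies on
  -- `S`.
  refine ⟨2 * Z.card + 1, fun x hx T hT ↦ ?_⟩
  by_contra! hlt
  have hmem : ∀ j ∈ Finset.Icc 1 (2 * Z.card + 1), F.map (j : ℝ) x ∈ N := by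
    intro j hj
    rw [Finset.mem_Icc] at hj
    refine hT _ ⟨by positivity, le_trans ?_ hlt.le⟩
    exact_mod_cast hj.2
  have hsel : ∀ j ∈ Finset.Icc 1 (2 * Z.card + 1), ∃ z ∈ Z, F.map (j : ℝ) x ∈ U z := by
    intro j hj
    simpa using hcov (subset_closure (hmem j hj))
  have : Nonempty M := ⟨x⟩
  choose! ζ hζ hζU using hsel
  obtain ⟨i, hi, j, hj, hne, heq⟩ := Finset.exists_ne_map_eq_of_card_lt_of_maps_to
    (s := Finset.Icc 1 (2 * Z.card + 1)) (t := Z ×ˢ (Finset.univ : Finset Bool))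
    (f := fun j ↦ (ζ j, decide (0 < φ (ζ j) (F.map (j : ℝ) x)))) (by
      rw [Finset.card_product]; simp; omega) (fun j hj ↦ by
      simpa using ⟨hζ j hj, lt_or_ge _ _⟩)
  have main : ∀ i ∈ Finset.Icc 1 (2 * Z.card + 1), ∀ j ∈ Finset.Icc 1 (2 * Z.card + 1), i < j →
      (ζ i, decide (0 < φ (ζ i) (F.map (i : ℝ) x))) =
        (ζ j, decide (0 < φ (ζ j) (F.map (j : ℝ) x))) → False := by
    intro i hi j hj hij heq
    rw [Prod.mk.injEq, decide_eq_decide] at heq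
    obtain ⟨e1, e2⟩ := heq
    rw [← e1] at e2
    have hj' := Finset.mem_Icc.1 hj
    have hi' := Finset.mem_Icc.1 hi
    refine hUsign (ζ i) (hZ _ (hζ i hi)) x hx i j (by exact_mod_cast hi'.1) (by exact_mod_cast hij)
      (fun r hr ↦ hT r ⟨hr.1, hr.2.trans (le_trans ?_ hlt.le)⟩) (hζU i hi) (e1 ▸ hζU j hj) e2
    exact_mod_cast hj'.2
  rcases hne.lt_or_gt with h' | h'
  · exact main i hi j hj h' heq
  · exact main j hj i hi h' heq.symm

end LorentzianMetric.IsCauchyFlow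
end TimeBound

/-! ### Smoothness of the hitting time -/

section HittingTime

variable {d : ℕ} {M : Type*} [TopologicalSpace M]
  [ChartedSpace (EuclideanSpace ℝ (Fin (d + 1))) M] [IsManifold (𝓡 (d + 1)) ∞ M]
  {g : LorentzianMetric d M} {F : SmoothFlow (EuclideanSpace ℝ (Fin (d + 1))) M} {N S : Set M}

/-- Rescaling to the fixed compact interval `[0, 1]` lets the tube lemma show openness jointly in
time and starting point. -/
theorem SmoothFlow.mem_domain_zero_iff {t : ℝ} {x : M} :
    t ∈ F.domain N 0 x ↔ ∀ r ∈ Icc (0 : ℝ) 1, F.map (r * t) x ∈ N := by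
  constructor
  · intro h r hr
    have := h (r * t) (by
      rw [mem_uIcc]
      rcases le_total 0 t with ht | ht
      · left; constructor <;> nlinarith [hr.1, hr.2]
      · right; constructor <;> nlinarith [hr.1, hr.2])
    rwa [sub_zero] at this
  · intro h r hr
    rw [sub_zero]
    rcases eq_or_ne t 0 with rfl | ht
    · rw [uIcc_self, mem_singleton_iff] at hr
      have := h 0 (by simp)
      rwa [zero_mul, ← hr] at this
    · have := h (r / t) (by
        rw [mem_uIcc] at hr
        rcases hr with hr | hr
        · have h0 : 0 < t := (hr.1.trans hr.2).lt_of_ne' ht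
          exact ⟨div_nonneg hr.1 h0.le, (div_le_one h0).2 hr.2⟩
        · have h0 : t < 0 := (hr.1.trans hr.2).lt_of_ne ht
          exact ⟨div_nonneg_of_nonpos hr.2 h0.le, (div_le_one_of_neg h0).2 hr.1⟩)
      rwa [div_mul_cancel₀ _ ht] at this

theorem SmoothFlow.eventually_mem_domain (hN : IsOpen N) {t : ℝ} {x : M}
    (h : t ∈ F.domain N 0 x) : ∀ᶠ q : ℝ × M in 𝓝 (t, x), q.1 ∈ F.domain N 0 q.2 := by
  rw [SmoothFlow.mem_domain_zero_iff] at h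
  simp only [SmoothFlow.mem_domain_zero_iff]
  refine isCompact_Icc.eventually_forall_of_forall_eventually fun r hr ↦ ?_
  have hc : Continuous fun q : (ℝ × M) × ℝ ↦ F.map (q.2 * q.1.1) q.1.2 :=
    F.continuous_map.comp (by fun_prop : Continuous fun q : (ℝ × M) × ℝ ↦ (q.2 * q.1.1, q.1.2))
  exact hc.continuousAt.eventually (hN.mem_nhds (h r hr))

namespace LorentzianMetric.IsCauchyFlow

variable [T2Space M]

/-- The flow is transverse to a Cauchy hypersurface. -/
theorem transverse (h : g.IsCauchyFlow F N S) {p : M} (hp : p ∈ S)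
    {c : OpenPartialHomeomorph M (EuclideanSpace ℝ (Fin (d + 1)))}
    (hc : c ∈ IsManifold.maximalAtlas (𝓡 (d + 1)) ∞ M) (hpc : p ∈ c.source)
    (hcS : ∀ q ∈ c.source, q ∈ S ↔ c q 0 = 0)
    {w : EuclideanSpace ℝ (Fin (d + 1))}
    (hw : mfderiv (𝓡 (d + 1)) (𝓡 (d + 1)) c p (F.field p) = w) : w 0 ≠ 0 := by
  intro hw0
  have : IsManifold (𝓡 (d + 1)) 1 M := IsManifold.of_le (n := ∞) (by simp)
  have hy : c p ∈ c.target := c.map_source hpc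
  have hsmooth : ∀ᶠ y in 𝓝 (c p), ContMDiffAt (𝓡 (d + 1)) (𝓡 (d + 1)) ∞ c.symm y := by
    filter_upwards [c.open_target.mem_nhds hy] with y hy
    exact contMDiffAt_symm_of_mem_maximalAtlas hc hy
  have hc1 : c.MDifferentiable (𝓡 (d + 1)) (𝓡 (d + 1)) :=
    ⟨(contMDiffOn_of_mem_maximalAtlas hc).mdifferentiableOn (by simp),
      (contMDiffOn_symm_of_mem_maximalAtlas hc).mdifferentiableOn (by simp)⟩
  -- With `w 0 = 0` this line stays in the slice, so its image would be a future curve inside `S`.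
  set L : ℝ → EuclideanSpace ℝ (Fin (d + 1)) := fun t ↦ c p + t • w with hL
  have hL0 : L 0 = c p := by simp [hL]
  have hfield : mfderiv (𝓡 (d + 1)) (𝓡 (d + 1)) c.symm (c p) w ∈
      g.cone (F.field (c.symm (c p))) := by
    have h1 := DFunLike.congr_fun (hc1.symm_comp_deriv hpc) (F.field p)
    have h2 : mfderiv (𝓡 (d + 1)) (𝓡 (d + 1)) c.symm (c p) w = F.field p := by
      rw [← hw]; exact h1
    have key : ∀ (x y : M) (_ : x = y) (v : EuclideanSpace ℝ (Fin (d + 1))), v = F.field x →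
        g.IsTimelike (F.field x) → (v : TangentSpace (𝓡 (d + 1)) y) ∈ g.cone (F.field y) := by
      rintro x _ rfl _ rfl hx
      exact ⟨hx, hx⟩
    exact key p _ (c.left_inv hpc).symm _ h2 (h.timelike p (h.cauchy.subset hp))
  have hα : g.IsFutureAt F (fun t ↦ c.symm (L t)) 0 :=
    isFutureAt_line (v := w) (fun t ↦ by simp [hL]) (by rw [hL0]; exact hsmooth)
      (by rw [hL0]; exact hfield)
  refine h.not_eventually_mem hα ?_
  have hLc : ContinuousAt L 0 := by fun_prop
  filter_upwards [hLc.eventually (by rw [hL0]; exact c.open_target.mem_nhds hy)] with t ht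
  rw [hcS _ (c.map_target ht), c.right_inv ht]
  simp [hL, hw0, (hcS p hpc).1 hp]

theorem existsUnique_hit (h : g.IsCauchyFlow F N S) {x : M} (hx : x ∈ N) :
    ∃! t, t ∈ F.domain N 0 x ∧ F.map t x ∈ S := by
  simpa only [sub_zero] using h.existsUnique (h.flowCurve hx 0)

/-- The time at which the flow lines through a smooth family of points hit a Cauchy hypersurface
depends smoothly on the point. -/
theorem exists_hittingTime (h : g.IsCauchyFlow F N S) {E : Type*} [NormedAddCommGroup E]
    [NormedSpace ℝ E] [CompleteSpace E] {V : Set E} (hV : IsOpen V) {Ψ : E → M}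
    (hΨ : ∀ u ∈ V, ContMDiffAt 𝓘(ℝ, E) (𝓡 (d + 1)) ∞ Ψ u) (hΨN : MapsTo Ψ V N) :
    ∃ f : E → ℝ, ∀ u ∈ V, f u ∈ F.domain N 0 (Ψ u) ∧ F.map (f u) (Ψ u) ∈ S ∧
      ContDiffAt ℝ ∞ f u := by
  choose! f hf hfu using fun u (hu : u ∈ V) ↦ h.existsUnique_hit (hΨN hu)
  refine ⟨f, fun u hu ↦ ⟨(hf u hu).1, (hf u hu).2, ?_⟩⟩
  obtain ⟨hdom, hS⟩ := hf u hu
  obtain ⟨c, hc, hpc, hcS⟩ := h.cauchy.hypersurface _ hS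
  set H : E × ℝ → M := fun q ↦ F.map q.2 (Ψ q.1) with hH
  have hHs : ContMDiffAt 𝓘(ℝ, E × ℝ) (𝓡 (d + 1)) ∞ H (u, f u) := by
    have e1 : ContMDiffAt 𝓘(ℝ, E × ℝ) 𝓘(ℝ, ℝ) ∞ (Prod.snd : E × ℝ → ℝ) (u, f u) := by
      rw [contMDiffAt_iff_contDiffAt]; fun_prop
    have e2 : ContMDiffAt 𝓘(ℝ, E × ℝ) 𝓘(ℝ, E) ∞ (Prod.fst : E × ℝ → E) (u, f u) := by
      rw [contMDiffAt_iff_contDiffAt]; fun_prop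
    have e3 : ContMDiffAt 𝓘(ℝ, E × ℝ) (𝓡 (d + 1)) ∞ (fun q : E × ℝ ↦ Ψ q.1) (u, f u) :=
      (hΨ u hu).comp (u, f u) e2
    exact (F.contMDiff_map.contMDiffAt (x := (f u, Ψ u))).comp (u, f u) (e1.prodMk e3)
  have hcs : ContMDiffAt (𝓡 (d + 1)) (𝓡 (d + 1)) ∞ c (F.map (f u) (Ψ u)) :=
    contMDiffAt_of_mem_maximalAtlas hc hpc
  have hcH : ContDiffAt ℝ ∞ (fun q ↦ c (H q)) (u, f u) := (hcs.comp (u, f u) hHs).contDiffAt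
  set k : E × ℝ → ℝ := fun q ↦ c (H q) 0 with hk
  have hks : ContDiffAt ℝ ∞ k (u, f u) := contDiffAt_euclidean.1 hcH 0
  have hpart : fderiv ℝ k (u, f u) (0, 1) ≠ 0 := by
    obtain ⟨D, h1, hD⟩ : ∃ D : ℝ →L[ℝ] EuclideanSpace ℝ (Fin (d + 1)),
        HasFDerivAt (fun t ↦ c (F.map t (Ψ u))) D (f u) ∧
        D 1 = mfderiv (𝓡 (d + 1)) (𝓡 (d + 1)) c (F.map (f u) (Ψ u))
          ((1 : ℝ) • F.field (F.map (f u) (Ψ u))) :=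
      ⟨_, ((hcs.mdifferentiableAt (by simp)).hasMFDerivAt.comp (f u)
        (F.isMIntegralCurve (Ψ u) (f u))).hasFDerivAt, rfl⟩
    rw [one_smul] at hD
    have h2 := h.transverse hS hc hpc hcS hD.symm
    have h3 : HasDerivAt (fun t : ℝ ↦ (u, t)) ((0, 1) : E × ℝ) (f u) :=
      (hasDerivAt_const _ _).prodMk (hasDerivAt_id _)
    have h4 : HasDerivAt (fun t ↦ k (u, t)) (fderiv ℝ k (u, f u) (0, 1)) (f u) :=
      HasFDerivAt.comp_hasDerivAt (f := fun t : ℝ ↦ (u, t)) (f u)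
        (hks.differentiableAt (by simp)).hasFDerivAt h3
    have h5 : HasDerivAt (fun t ↦ k (u, t)) (D 1 0) (f u) := by
      exact ((EuclideanSpace.proj (𝕜 := ℝ) (0 : Fin (d + 1))).hasFDerivAt.comp (f u)
        h1).hasDerivAt
    rw [h4.unique h5]
    exact h2
  have hinv : (fderiv ℝ k (u, f u) ∘L .inr ℝ E ℝ).IsInvertible := by
    refine ⟨ContinuousLinearEquiv.unitsEquivAut ℝ (Units.mk0 _ hpart), ?_⟩
    ext
    simp
  have hk0 : k (u, f u) = 0 := (hcS _ hpc).1 hS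
  -- Transversality makes the implicit function theorem applicable to the defining coordinate of
  -- `S`. Near `u` the solution `θ` remains an admissible flow time, and uniqueness of the hit gives
  -- `θ = f`.
  set θ := hks.implicitFunction (by simp) hinv with hθ
  have hθu : θ u = f u := hks.implicitFunction_apply_self (by simp) hinv
  have hθs : ContDiffAt ℝ ∞ θ u := hks.contDiffAt_implicitFunction (by simp) hinv
  refine hθs.congr_of_eventuallyEq ?_
  have hθc : ContinuousAt θ u := hθs.continuousAt
  have hpair : Tendsto (fun v ↦ (θ v, Ψ v)) (𝓝 u) (𝓝 (f u, Ψ u)) := by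
    rw [nhds_prod_eq, ← hθu]
    exact hθc.tendsto.prodMk (hΨ u hu).continuousAt.tendsto
  have hpair' : Tendsto (fun v ↦ (v, θ v)) (𝓝 u) (𝓝 (u, f u)) := by
    rw [nhds_prod_eq, ← hθu]
    exact tendsto_id.prodMk hθc.tendsto
  filter_upwards [hks.eventually_apply_implicitFunction (by simp) hinv,
    hpair.eventually (SmoothFlow.eventually_mem_domain h.isOpen hdom),
    hpair'.eventually (hHs.continuousAt.eventually (c.open_source.mem_nhds hpc)),
    hV.mem_nhds hu] with v h1 h2 h3 hv
  refine (hfu v hv (θ v) ⟨h2, ?_⟩).symm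
  exact (hcS _ h3).2 (h1.trans hk0)

end LorentzianMetric.IsCauchyFlow
end HittingTime

/-! ### Lengths of curves in graphs over the flow -/

section SpacelikeDiameter

variable {d : ℕ} {M : Type*} [TopologicalSpace M]
  [ChartedSpace (EuclideanSpace ℝ (Fin (d + 1))) M] [IsManifold (𝓡 (d + 1)) ∞ M]
  {g : LorentzianMetric d M} {F : SmoothFlow (EuclideanSpace ℝ (Fin (d + 1))) M} {N S : Set M}
  {E : Type*} [NormedAddCommGroup E] [NormedSpace ℝ E] {V : Set E} {Ψ : E → M}

/-- The points reached by the flow from a family of points. -/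
def flowOut (F : SmoothFlow (EuclideanSpace ℝ (Fin (d + 1))) M) (Ψ : E → M) (p : ℝ × E) : M :=
  F.map p.1 (Ψ p.2)

theorem contMDiffAt_flowOut {p : ℝ × E} (h : ContMDiffAt 𝓘(ℝ, E) (𝓡 (d + 1)) ∞ Ψ p.2) :
    ContMDiffAt 𝓘(ℝ, ℝ × E) (𝓡 (d + 1)) ∞ (flowOut F Ψ) p := by
  have e1 : ContMDiffAt 𝓘(ℝ, ℝ × E) 𝓘(ℝ, ℝ) ∞ (Prod.fst : ℝ × E → ℝ) p := by
    rw [contMDiffAt_iff_contDiffAt]; fun_prop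
  have e2 : ContMDiffAt 𝓘(ℝ, ℝ × E) 𝓘(ℝ, E) ∞ (Prod.snd : ℝ × E → E) p := by
    rw [contMDiffAt_iff_contDiffAt]; fun_prop
  exact (F.contMDiff_map.contMDiffAt (x := (p.1, Ψ p.2))).comp p (e1.prodMk (h.comp p e2))

theorem mfderiv_flowOut_time {p : ℝ × E} (h : ContMDiffAt 𝓘(ℝ, E) (𝓡 (d + 1)) ∞ Ψ p.2) :
    mfderiv 𝓘(ℝ, ℝ × E) (𝓡 (d + 1)) (flowOut F Ψ) p ((1, 0) : ℝ × E) =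
      F.field (flowOut F Ψ p) := by
  have h1 : HasDerivAt (fun t : ℝ ↦ (t, p.2)) ((1, 0) : ℝ × E) p.1 :=
    (hasDerivAt_id _).prodMk (hasDerivAt_const _ _)
  have h2 := LorentzianMetric.mfderiv_comp_of_hasDerivAt (f := flowOut F Ψ) h1
    (contMDiffAt_flowOut h)
  exact h2.symm.trans (F.mfderiv_curve (Ψ p.2) p.1)

variable (g) in
/-- Adding a multiple of the timelike vector `u` to `v` makes the form at most the form of the
component of `v` orthogonal to `u`. -/
theorem LorentzianMetric.form_smul_add_le {x : M} {u : TangentSpace (𝓡 (d + 1)) x}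
    (hu : g.IsTimelike u) (v : TangentSpace (𝓡 (d + 1)) x) (a : ℝ) :
    g.form x (a • u + v) (a • u + v) ≤ g.form x v v - g.form x u v ^ 2 / g.form x u u := by
  have e : g.form x (a • u + v) (a • u + v) =
      a ^ 2 * g.form x u u + 2 * a * g.form x u v + g.form x v v := by
    simp only [map_add, map_smul, _root_.add_apply, _root_.smul_apply, smul_eq_mul,
      g.symm x v u]
    ring
  have key : ∀ A b : ℝ, A < 0 → a ^ 2 * A + 2 * a * b ≤ -(b ^ 2 / A) := by
    intro A b hA
    have e2 : a ^ 2 * A + 2 * a * b + b ^ 2 / A = (a * A + b) ^ 2 / A := by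
      have := hA.ne
      field_simp
      ring
    linarith [div_nonpos_of_nonneg_of_nonpos (sq_nonneg (a * A + b)) hA.le]
  rw [e]
  linarith [key _ (g.form x u v) hu]

/-- The form of the component orthogonal to the flow of the velocity of `flowOut` in direction `e`. -/
def transverseForm (g : LorentzianMetric d M) (F : SmoothFlow (EuclideanSpace ℝ (Fin (d + 1))) M)
    (Ψ : E → M) (q : (ℝ × E) × E) : ℝ :=
  g.form (flowOut F Ψ q.1) (mfderiv 𝓘(ℝ, ℝ × E) (𝓡 (d + 1)) (flowOut F Ψ) q.1 ((0, q.2) : ℝ × E))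
    (mfderiv 𝓘(ℝ, ℝ × E) (𝓡 (d + 1)) (flowOut F Ψ) q.1 ((0, q.2) : ℝ × E)) -
  g.form (flowOut F Ψ q.1) (F.field (flowOut F Ψ q.1))
    (mfderiv 𝓘(ℝ, ℝ × E) (𝓡 (d + 1)) (flowOut F Ψ) q.1 ((0, q.2) : ℝ × E)) ^ 2 /
  g.form (flowOut F Ψ q.1) (F.field (flowOut F Ψ q.1)) (F.field (flowOut F Ψ q.1))

theorem continuousAt_transverseForm (hV : IsOpen V)
    (hΨ : ∀ u ∈ V, ContMDiffAt 𝓘(ℝ, E) (𝓡 (d + 1)) ∞ Ψ u) {q : (ℝ × E) × E} (hq : q.1.2 ∈ V)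
    (hF : g.IsTimelike (F.field (flowOut F Ψ q.1))) :
    ContinuousAt (transverseForm g F Ψ) q := by
  have hU : IsOpen {p : ℝ × E | p.2 ∈ V} := hV.preimage continuous_snd
  have h1 := continuousOn_mk_mfderiv (f := flowOut F Ψ) hU fun p hp ↦
    ((contMDiffAt_flowOut (hΨ p.2 hp)).of_le (by simp)).contMDiffWithinAt
  have h2 : ContinuousAt (fun q : (ℝ × E) × E ↦ (⟨flowOut F Ψ q.1,
      mfderiv 𝓘(ℝ, ℝ × E) (𝓡 (d + 1)) (flowOut F Ψ) q.1 ((0, q.2) : ℝ × E)⟩ :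
      TangentBundle (𝓡 (d + 1)) M)) q :=
    (h1.continuousAt ((hU.prod isOpen_univ).mem_nhds (⟨hq, mem_univ _⟩ :
      (q.1, ((0, q.2) : ℝ × E)) ∈ {p : ℝ × E | p.2 ∈ V} ×ˢ univ))).comp
      (f := fun q : (ℝ × E) × E ↦ (q.1, ((0, q.2) : ℝ × E))) (by fun_prop)
  have h3 : ContinuousAt (fun q : (ℝ × E) × E ↦
      (⟨flowOut F Ψ q.1, F.field (flowOut F Ψ q.1)⟩ : TangentBundle (𝓡 (d + 1)) M)) q :=
    F.continuous_mk_field.continuousAt.comp (f := fun q : (ℝ × E) × E ↦ flowOut F Ψ q.1)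
      ((contMDiffAt_flowOut (hΨ _ hq)).continuousAt.comp continuousAt_fst)
  exact (g.continuousAt_form h2 h2).sub (((g.continuousAt_form h3 h2).pow 2).div
    (g.continuousAt_form h3 h3) (ne_of_lt hF))

/-- On a compact family, the transverse form is bounded where the flow stays in a closed set. -/
theorem exists_transverseForm_le (hV : IsOpen V)
    (hΨ : ∀ u ∈ V, ContMDiffAt 𝓘(ℝ, E) (𝓡 (d + 1)) ∞ Ψ u) {C : Set M} (hC : IsClosed C)
    (hF : ∀ x ∈ C, g.IsTimelike (F.field x)) {A : Set ℝ} {B B' : Set E} (hA : IsCompact A)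
    (hB : IsCompact B) (hBV : B ⊆ V) (hB' : IsCompact B') :
    ∃ R : ℝ, ∀ q ∈ (A ×ˢ B) ×ˢ B', flowOut F Ψ q.1 ∈ C → transverseForm g F Ψ q ≤ R := by
  have hK : IsCompact ((A ×ˢ B) ×ˢ B') := (hA.prod hB).prod hB'
  have hcont : ContinuousOn (fun q : (ℝ × E) × E ↦ flowOut F Ψ q.1) ((A ×ˢ B) ×ˢ B') :=
    fun q hq ↦ ((contMDiffAt_flowOut (hΨ _ (hBV hq.1.2))).continuousAt.comp
      (f := Prod.fst) (x := q) continuousAt_fst).continuousWithinAt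
  have hK' := hK.of_isClosed_subset (hcont.preimage_isClosed_of_isClosed hK.isClosed hC)
    inter_subset_left
  obtain ⟨R, hR⟩ := hK'.exists_bound_of_continuousOn (f := transverseForm g F Ψ) fun q hq ↦
    (continuousAt_transverseForm hV hΨ (hBV hq.1.1.2) (hF _ hq.2)).continuousWithinAt
  exact ⟨R, fun q hq hqC ↦ (le_abs_self _).trans (hR q ⟨hq, hqC⟩)⟩

/-- The graph over a segment of a smooth function, with the flow as vertical direction, is
piecewise smooth, and its length is controlled by the transverse form. -/
theorem LorentzianMetric.distIn_flowOut_le [CompleteSpace E]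
    (hV : Convex ℝ V)
    (hΨ : ∀ u ∈ V, ContMDiffAt 𝓘(ℝ, E) (𝓡 (d + 1)) ∞ Ψ u) {f : E → ℝ}
    (hf : ∀ u ∈ V, ContDiffAt ℝ ∞ f u) (hfS : ∀ u ∈ V, flowOut F Ψ (f u, u) ∈ S)
    (hF : ∀ x ∈ S, g.IsTimelike (F.field x)) {u v : E} (hu : u ∈ V) (hv : v ∈ V) {R : ℝ}
    (hR : ∀ w ∈ V, transverseForm g F Ψ ((f w, w), v - u) ≤ R) :
    g.distIn S (flowOut F Ψ (f u, u)) (flowOut F Ψ (f v, v)) ≤ ENNReal.ofReal (√R) := by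
  set σ : ℝ → E := fun s ↦ u + s • (v - u) with hσ
  have hσV : ∀ s ∈ Icc (0 : ℝ) 1, σ s ∈ V := fun s hs ↦
    hV.add_smul_sub_mem hu hv hs
  set κ : ℝ → ℝ × E := fun s ↦ (f (σ s), σ s) with hκ
  set γ : ℝ → M := fun s ↦ flowOut F Ψ (κ s) with hγ
  have hσs : ContDiff ℝ ∞ σ := by fun_prop
  have hκs : ∀ s ∈ Icc (0 : ℝ) 1, ContDiffAt ℝ ∞ κ s := fun s hs ↦
    ((hf _ (hσV s hs)).comp s hσs.contDiffAt).prodMk hσs.contDiffAt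
  have hγs : ∀ s ∈ Icc (0 : ℝ) 1, ContMDiffAt 𝓘(ℝ, ℝ) (𝓡 (d + 1)) ∞ γ s := fun s hs ↦
    (contMDiffAt_flowOut (p := κ s) (hΨ _ (hσV s hs))).comp s (hκs s hs).contMDiffAt
  have hγS : MapsTo γ (Icc 0 1) S := fun s hs ↦ hfS _ (hσV s hs)
  have hle : ∀ s ∈ Icc (0 : ℝ) 1, g.form (γ s) (mfderiv 𝓘(ℝ, ℝ) (𝓡 (d + 1)) γ s (1 : ℝ))
      (mfderiv 𝓘(ℝ, ℝ) (𝓡 (d + 1)) γ s (1 : ℝ)) ≤ R := by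
    intro s hs
    have h1 : HasDerivAt σ (v - u) s := hasDerivAt_of_eq_line fun t ↦ by
      simp only [hσ]
      module
    have h2 : HasDerivAt (fun s ↦ f (σ s)) (fderiv ℝ f (σ s) (v - u)) s :=
      HasFDerivAt.comp_hasDerivAt (f := σ) s
        ((hf _ (hσV s hs)).differentiableAt (by simp)).hasFDerivAt h1
    set a := fderiv ℝ f (σ s) (v - u) with ha
    have h3 : HasDerivAt κ (a, v - u) s := h2.prodMk h1
    have hΨs := hΨ _ (hσV s hs)
    have h4 : mfderiv 𝓘(ℝ, ℝ) (𝓡 (d + 1)) γ s (1 : ℝ) =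
        mfderiv 𝓘(ℝ, ℝ × E) (𝓡 (d + 1)) (flowOut F Ψ) (κ s) ((a, v - u) : ℝ × E) :=
      mfderiv_comp_of_hasDerivAt h3 (contMDiffAt_flowOut (p := κ s) hΨs)
    -- The slope `a` of the graph is not controlled, but it enters only as a multiple of the flow
    -- field and so drops out in `form_smul_add_le`.
    have h5 : ((a, v - u) : ℝ × E) = a • ((1, 0) : ℝ × E) + (0, v - u) := by simp
    have h6 : mfderiv 𝓘(ℝ, ℝ) (𝓡 (d + 1)) γ s (1 : ℝ) = a • F.field (flowOut F Ψ (κ s)) +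
        mfderiv 𝓘(ℝ, ℝ × E) (𝓡 (d + 1)) (flowOut F Ψ) (κ s) ((0, v - u) : ℝ × E) := by
      rw [h4, h5, ← mfderiv_flowOut_time (p := κ s) hΨs]
      exact (map_add _ _ _).trans (congrArg (· + _) (map_smul _ _ _))
    rw [h6]
    exact (g.form_smul_add_le (hF _ (hγS hs)) _ a).trans (hR _ (hσV s hs))
  have hmem : IsPiecewiseSmoothCurveOn d γ (Icc 0 1) ∧ MapsTo γ (Icc 0 1) S ∧
      γ 0 = flowOut F Ψ (f u, u) ∧ γ 1 = flowOut F Ψ (f v, v) := by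
    refine ⟨⟨fun s hs ↦ (hγs s hs).continuousAt.continuousWithinAt, ∅, by simp,
      fun a b _ hab _ s hs ↦ (hγs s (hab hs)).contMDiffWithinAt⟩, hγS, ?_, ?_⟩
    · simp [hγ, hκ, hσ]
    · simp [hγ, hκ, hσ]
  refine (iInf₂_le γ hmem).trans ?_
  calc g.length γ ≤ ∫⁻ _ in Icc (0 : ℝ) 1, ENNReal.ofReal (√R) :=
        setLIntegral_mono measurable_const fun s hs ↦
          ENNReal.ofReal_le_ofReal (Real.sqrt_le_sqrt (hle s hs))
    _ = ENNReal.ofReal (√R) := by simp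

end SpacelikeDiameter

end

/-! ### Assembly of the uniform bound -/

theorem mainTheorem9 (d : ℕ) (hd : 1 ≤ d) {M : Type*} [TopologicalSpace M] [T2Space M]
    [SecondCountableTopology M] [ChartedSpace (EuclideanSpace ℝ (Fin (d + 1))) M]
    [IsManifold (𝓡 (d + 1)) ∞ M] (g : LorentzianMetric d M) (τ : g.TimeOrientation)
    (N : Set M) (hN_open : IsOpen N) (hN_hyp : g.IsGloballyHyperbolic N)
    (hN_precompact : IsCompact (closure N))
    (ψ : openBall d 2 → M) (hψ : Manifold.IsSmoothEmbedding (𝓡 d) (𝓡 (d + 1)) ∞ ψ)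
    (hψ_cauchy : g.IsCauchyHypersurface N
      (ψ '' {x | (x : EuclideanSpace ℝ (Fin d)) ∈ Metric.ball 0 1})) :
    g.spacelikeDiam N < ⊤ := by
  classical
  obtain ⟨F, hF⟩ := g.exists_smoothFlow_field_mem_cone τ hN_precompact
  have hF' : ∀ x ∈ closure N, g.IsTimelike (F.field x) := fun x hx ↦ (hF x hx).1
  set B : Set (openBall d 2) := {x | (x : EuclideanSpace ℝ (Fin d)) ∈ Metric.ball 0 1} with hB
  have hBo : IsOpen B := Metric.isOpen_ball.preimage continuous_subtype_val
  have hBc : IsCompact (closure B) := by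
    have h1 : IsCompact (Subtype.val ⁻¹' Metric.closedBall 0 1 : Set (openBall d 2)) := by
      rw [Subtype.isCompact_iff, image_preimage_eq_of_subset]
      · exact isCompact_closedBall _ _
      · exact fun u hu ↦ ⟨⟨u, Metric.closedBall_subset_ball one_lt_two hu⟩, rfl⟩
    exact h1.of_isClosed_subset isClosed_closure
      (closure_minimal (preimage_mono Metric.ball_subset_closedBall) h1.isClosed)
  have h₀ : g.IsCauchyFlow F N (ψ '' B) := ⟨hN_open, fun x hx ↦ hF' x (subset_closure hx), hψ_cauchy⟩
  have hFr : ∀ x ∈ closure N, g.IsTimelike (F.reverse.field x) := fun x hx ↦ by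
    have := hF' x hx
    rw [LorentzianMetric.IsTimelike] at this ⊢
    rw [SmoothFlow.reverse_field]
    simpa using this
  obtain ⟨T₁, hT₁⟩ := h₀.exists_time_bound hN_precompact hF' fun z hz ↦
    exists_isBarrierAt h₀ hψ hBo hBc rfl (hF' z hz)
  -- The notion of Cauchy hypersurface does not depend on the direction of time, so the reversed
  -- flow bounds the times in the past.
  obtain ⟨T₂, hT₂⟩ := h₀.reverse.exists_time_bound hN_precompact hFr fun z hz ↦
    exists_isBarrierAt h₀.reverse hψ hBo hBc rfl (hFr z hz)
  have hbound : ∀ x ∈ ψ '' B, ∀ t ∈ F.domain N 0 x, t ∈ Icc (-T₂) T₁ := by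
    intro x hx t ht
    constructor
    · have := hT₂ x hx (-t) fun r hr ↦ by
        have := ht (-r) (by
          rw [mem_uIcc]; right; constructor <;> linarith [hr.1, hr.2])
        rwa [sub_zero] at this
      linarith
    · refine hT₁ x hx t fun r hr ↦ ?_
      have := ht r (by rw [mem_uIcc]; left; exact hr)
      rwa [sub_zero] at this
  have hzero : (0 : EuclideanSpace ℝ (Fin d)) ∈ Metric.ball (0 : EuclideanSpace ℝ (Fin d)) 2 :=
    Metric.mem_ball_self two_pos
  -- Extension of `ψ` to the whole vector space; the value off the ball is arbitrary and never used.
  set Ψ : EuclideanSpace ℝ (Fin d) → M := fun u ↦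
    if hu : u ∈ Metric.ball 0 2 then ψ ⟨u, hu⟩ else ψ ⟨0, hzero⟩ with hΨ
  have hΨψ : ∀ u : openBall d 2, Ψ u = ψ u := fun u ↦ by
    simp only [hΨ, dif_pos (show (u : EuclideanSpace ℝ (Fin d)) ∈ Metric.ball 0 2 from u.2)]
  have hΨs : ∀ u ∈ Metric.ball (0 : EuclideanSpace ℝ (Fin d)) 2,
      ContMDiffAt (𝓡 d) (𝓡 (d + 1)) ∞ Ψ u := by
    intro u hu
    refine contMDiffAt_subtype_iff (U := openBall d 2) (x := ⟨u, hu⟩).1 ?_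
    simp only [hΨψ]
    exact hψ.contMDiff _
  have hΨB : ∀ u ∈ Metric.ball (0 : EuclideanSpace ℝ (Fin d)) 1, Ψ u ∈ ψ '' B := by
    intro u hu
    have hu2 : u ∈ Metric.ball (0 : EuclideanSpace ℝ (Fin d)) 2 :=
      Metric.ball_subset_ball one_le_two hu
    exact ⟨⟨u, hu2⟩, hu, (hΨψ ⟨u, hu2⟩).symm⟩
  -- `R` is fixed before `S` is chosen. Directions range over the ball of radius `2`, which contains
  -- all differences of points of the unit ball.
  obtain ⟨R, hR⟩ := exists_transverseForm_le (g := g) (F := F) Metric.isOpen_ball hΨs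
    isClosed_closure hF' (isCompact_Icc (a := -T₂) (b := T₁))
    (isCompact_closedBall (0 : EuclideanSpace ℝ (Fin d)) 1)
    (Metric.closedBall_subset_ball one_lt_two)
    (isCompact_closedBall (0 : EuclideanSpace ℝ (Fin d)) 2)
  refine lt_of_le_of_lt (iSup₂_le fun S hS ↦ iSup₂_le fun p hp ↦ iSup₂_le fun q hq ↦ ?_)
    (ENNReal.ofReal_lt_top (r := √R))
  have h : g.IsCauchyFlow F N S := ⟨hN_open, h₀.timelike, hS⟩
  have hΨs' : ∀ u ∈ Metric.ball (0 : EuclideanSpace ℝ (Fin d)) 1,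
      ContMDiffAt (𝓡 d) (𝓡 (d + 1)) ∞ Ψ u :=
    fun u hu ↦ hΨs u (Metric.ball_subset_ball one_le_two hu)
  obtain ⟨f, hf⟩ := h.exists_hittingTime Metric.isOpen_ball hΨs'
    fun u hu ↦ hψ_cauchy.subset (hΨB u hu)
  -- The flow line through `p` hits `ψ '' B` at some `ψ x` after a time `t`. Backwards it reaches
  -- `S` from `ψ x` at time `-t`, which by uniqueness is the hitting time `f x`.
  have hsurj : ∀ p ∈ S, ∃ u ∈ Metric.ball (0 : EuclideanSpace ℝ (Fin d)) 1,
      p = flowOut F Ψ (f u, u) := by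
    intro p hp
    obtain ⟨t, ⟨ht, x, hx, htx⟩, -⟩ := h₀.existsUnique_hit (hS.subset hp)
    have hfx := hf x hx
    rw [hΨψ x] at hfx
    refine ⟨x, hx, ?_⟩
    have hp' : p = F.map (-t) (ψ x) := by rw [htx, F.map_neg_map]
    have hdom : -t ∈ F.domain N 0 (ψ x) := by
      intro r hr
      rw [htx, sub_zero, ← F.map_add]
      have := ht (r + t) (by
        rw [mem_uIcc] at hr ⊢
        rcases hr with hr | hr
        · right; constructor <;> linarith [hr.1, hr.2]
        · left; constructor <;> linarith [hr.1, hr.2])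
      rwa [sub_zero] at this
    have := (h.existsUnique_hit (hψ_cauchy.subset ⟨x, hx, rfl⟩)).unique
      ⟨hfx.1, hfx.2.1⟩ ⟨hdom, hp' ▸ hp⟩
    rw [flowOut, hΨψ x]
    simp only [this]
    exact hp'
  obtain ⟨u, hu, rfl⟩ := hsurj p hp
  obtain ⟨v, hv, rfl⟩ := hsurj q hq
  refine LorentzianMetric.distIn_flowOut_le (convex_ball 0 1) hΨs'
    (fun w hw ↦ (hf w hw).2.2) (fun w hw ↦ (hf w hw).2.1)
    (fun x hx ↦ h.timelike x (hS.subset hx)) hu hv fun w hw ↦ ?_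
  refine hR _ ⟨⟨hbound _ (hΨB w hw) _ (hf w hw).1, Metric.ball_subset_closedBall hw⟩, ?_⟩
    (subset_closure (hS.subset (hf w hw).2.1))
  rw [mem_closedBall_zero_iff]
  have h1 := mem_ball_zero_iff.1 hu
  have h2 := mem_ball_zero_iff.1 hv
  exact (norm_sub_le v u).trans (by linarith)
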